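/- Let $n\in\mathbb N$, $m,\rho,\delta\in\mathbb R$ with $0\le\delta\le\rho\le1$ and $\delta<1$. Let $BS^m_{\rho,\delta}(\mathbb R^n)$ be the class of all smooth functions $\sigma:\mathbb R^n\times\mathbb R^n\times\mathbb R^n\to\mathbb C$ such that for all multi-indices $\alpha,\beta,\gamma$ there is a constant $C_{\alpha\beta\gamma}>0$ with $$|\partial_x^\alpha\partial_\xi^\beta\partial_\eta^\gamma\sigma(x,\xi,\eta)|\le C_{\alpha\beta\gamma}(1+|\xi|+|\eta|)^{m+\delta|\alpha|-\rho(|\beta|+|\gamma|)}\qquad\text{for all }x,\xi,\eta\in\mathbb R^n .$$ For $\sigma\in BS^m_{\rho,\delta}(\mathbb R^n)$ and Schwartz functions $f,g\in\mathcal S(\mathbb R^n)$ let $$T_\sigma(f,g)(x)=\int_{\mathbb R^n}\int_{\mathbb R^n}\sigma(x,\xi,\eta)\,\widehat f(\xi)\,\widehat g(\eta)\,e^{ix\cdot(\xi+\eta)}\,d\xi\,d\eta,\qquad \widehat f(\xi)=(2\pi)^{-n}\int_{\mathbb R^n} f(x)e^{-ix\cdot\xi}\,dx,$$ regarded as a bilinear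 operator $\mathcal S\times\mathcal S\to\mathcal S'$. With $\langle u,h\rangle$ the bilinear duality pairing of $\mathcal S'$ and $\mathcal S$ (for a function $u$, $\langle u,h\rangle=\int u\,h\,dx$), the transposes $T^{*1},T^{*2}:\mathcal S\times\mathcal S\to\mathcal S'$ of such an operator $T$ are defined by $$\langle T(f,g),h\rangle=\langle T^{*1}(h,g),f\rangle=\langle T^{*2}(f,h),g\rangle\qquad\text{for all } f,g,h\in\mathcal S(\mathbb R^n).$$ Then for every $\sigma\in BS^m_{\rho,\delta}(\mathbb R^n)$ and each $j\in\{1,2\}$ there is $\sigma^{*j}\in BS^m_{\rho,\delta}(\mathbb R^n)$ such that $T_\sigma^{*j}=T_{\sigma^{*j}}$. -/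

import Mathlib

open MeasureTheory SchwartzMap
open scoped ContDiff FourierTransform InnerProductSpace

namespace BilinearPDO

/-- The Euclidean space `ℝⁿ`. -/
abbrev Rn (n : ℕ) : Type := EuclideanSpace ℝ (Fin n)

/-! ### Multi-index derivatives -/

/-- The first-order directional derivative `∂_v f`. -/
noncomputable def dirDeriv {V : Type*} [NormedAddCommGroup V] [NormedSpace ℝ V]
    (v : V) (f : V → ℂ) : V → ℂ :=
  fun p => lineDeriv ℝ f p v

/-- The partial derivative `∂_{e 0}^{α 0} ⋯ ∂_{e (n-1)}^{α (n-1)} f` for a multi-index `α`. -/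
noncomputable def multiDeriv {V : Type*} [NormedAddCommGroup V] [NormedSpace ℝ V] {n : ℕ}
    (e : Fin n → V) (α : Fin n → ℕ) (f : V → ℂ) : V → ℂ :=
  (List.finRange n).foldr (fun i F => (dirDeriv (e i))^[α i] F) f

/-- The length `|α|` of a multi-index. -/
def mlen {n : ℕ} (α : Fin n → ℕ) : ℕ := ∑ i, α i

/-- The coordinate directions of the variable `x` in `(x, ξ, η)`. -/
noncomputable def dirX {n : ℕ} (i : Fin n) : Rn n × Rn n × Rn n :=
  (EuclideanSpace.single i 1, 0, 0)

/-- The coordinate directions of the variable `ξ` in `(x, ξ, η)`. -/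
noncomputable def dirXi {n : ℕ} (i : Fin n) : Rn n × Rn n × Rn n :=
  (0, EuclideanSpace.single i 1, 0)

/-- The coordinate directions of the variable `η` in `(x, ξ, η)`. -/
noncomputable def dirEta {n : ℕ} (i : Fin n) : Rn n × Rn n × Rn n :=
  (0, 0, EuclideanSpace.single i 1)

/-! ### The bilinear Hörmander classes -/

/-- The bilinear Hörmander class `BS^m_{ρ,δ}(ℝⁿ)`: the smooth functions `σ(x, ξ, η)` with
`|∂_x^α ∂_ξ^β ∂_η^γ σ(x, ξ, η)| ≤ C_{αβγ} (1 + |ξ| + |η|)^{m + δ|α| - ρ(|β| + |γ|)}`. -/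
def BS (n : ℕ) (m ρ δ : ℝ) : Set (Rn n × Rn n × Rn n → ℂ) :=
  {σ | ContDiff ℝ ∞ σ ∧
    ∀ α β γ : Fin n → ℕ, ∃ C : ℝ, 0 < C ∧ ∀ x ξ η : Rn n,
      ‖multiDeriv dirX α (multiDeriv dirXi β (multiDeriv dirEta γ σ)) (x, ξ, η)‖ ≤
        C * (1 + ‖ξ‖ + ‖η‖) ^ (m + δ * (mlen α : ℝ) - ρ * ((mlen β : ℝ) + (mlen γ : ℝ)))}

/-! ### The bilinear operator of a symbol, as a function -/

/-- The Fourier transform `f̂(ξ) = (2π)^{-n} ∫ f(x) e^{-i x·ξ} dx`, normalized so that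
`f(x) = ∫ f̂(ξ) e^{i x·ξ} dξ`. -/
noncomputable def hat {n : ℕ} (f : 𝓢(Rn n, ℂ)) (ξ : Rn n) : ℂ :=
  ((2 * Real.pi : ℝ) : ℂ)⁻¹ ^ n * ∫ x : Rn n, f x * Complex.exp (-Complex.I * ⟪x, ξ⟫_ℝ)

/-- `T_σ(f, g)(x) = ∫∫ σ(x, ξ, η) f̂(ξ) ĝ(η) e^{i x·(ξ+η)} dξ dη`. -/
noncomputable def opFun {n : ℕ} (σ : Rn n × Rn n × Rn n → ℂ) (f g : 𝓢(Rn n, ℂ)) (x : Rn n) : ℂ :=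
  ∫ p : Rn n × Rn n, σ (x, p.1, p.2) * hat f p.1 * hat g p.2 *
    Complex.exp (Complex.I * ⟪x, p.1 + p.2⟫_ℝ)

/-! ### Bilinear operators from `𝓢 × 𝓢` to `𝓢'` and their transposes -/

/-- Separately continuous bilinear operators `T : 𝓢(ℝⁿ) × 𝓢(ℝⁿ) → 𝓢'(ℝⁿ)`, where `𝓢'` carries the
weak-* topology; `T f g h` is the (bilinear) duality pairing `⟨T(f, g), h⟩`. -/
abbrev BilinOp (n : ℕ) : Type :=
  𝓢(Rn n, ℂ) →L[ℂ] 𝓢(Rn n, ℂ) →Lₚₜ[ℂ] 𝓢'(Rn n, ℂ)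

/-- A separately continuous trilinear form on `𝓢` seen as a bilinear operator into `𝓢'`. -/
noncomputable def BilinOp.ofForm {n : ℕ}
    (B : 𝓢(Rn n, ℂ) → 𝓢(Rn n, ℂ) → 𝓢(Rn n, ℂ) → ℂ)
    (l₁ : ∀ g h, IsLinearMap ℂ (fun f => B f g h)) (c₁ : ∀ g h, Continuous (fun f => B f g h))
    (l₂ : ∀ f h, IsLinearMap ℂ (fun g => B f g h)) (c₂ : ∀ f h, Continuous (fun g => B f g h))
    (l₃ : ∀ f g, IsLinearMap ℂ (fun h => B f g h)) (c₃ : ∀ f g, Continuous (fun h => B f g h)) :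
    BilinOp n :=
  let D (f g : 𝓢(Rn n, ℂ)) : 𝓢'(Rn n, ℂ) :=
    ContinuousLinearMap.toPointwiseConvergenceCLM _ _ _ _
      ({ toLinearMap := (l₃ f g).mk' _, cont := c₃ f g } : 𝓢(Rn n, ℂ) →L[ℂ] ℂ)
  let L (f : 𝓢(Rn n, ℂ)) : 𝓢(Rn n, ℂ) →Lₚₜ[ℂ] 𝓢'(Rn n, ℂ) :=
    ContinuousLinearMap.toPointwiseConvergenceCLM _ _ _ _
      ({ toFun := D f
         map_add' := fun g g' => by ext h; exact (l₂ f h).map_add g g'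
         map_smul' := fun c g => by ext h; exact (l₂ f h).map_smul c g
         cont := PointwiseConvergenceCLM.continuous_of_continuous_eval fun h => c₂ f h } :
        𝓢(Rn n, ℂ) →L[ℂ] 𝓢'(Rn n, ℂ))
  { toFun := L
    map_add' := fun f f' => by ext g h; exact (l₁ g h).map_add f f'
    map_smul' := fun c f => by ext g h; exact (l₁ g h).map_smul c f
    cont := PointwiseConvergenceCLM.continuous_of_continuous_eval fun g =>
      PointwiseConvergenceCLM.continuous_of_continuous_eval fun h => c₁ g h }

theorem BilinOp.ofForm_apply {n : ℕ} (B : 𝓢(Rn n, ℂ) → 𝓢(Rn n, ℂ) → 𝓢(Rn n, ℂ) → ℂ)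
    (l₁ c₁ l₂ c₂ l₃ c₃) (f g h : 𝓢(Rn n, ℂ)) :
    BilinOp.ofForm B l₁ c₁ l₂ c₂ l₃ c₃ f g h = B f g h := rfl

theorem BilinOp.linear₁ {n : ℕ} (T : BilinOp n) (g h : 𝓢(Rn n, ℂ)) :
    IsLinearMap ℂ (fun f => T f g h) :=
  ⟨fun f f' => by rw [map_add]; rfl, fun c f => by rw [map_smul]; rfl⟩

theorem BilinOp.linear₂ {n : ℕ} (T : BilinOp n) (f h : 𝓢(Rn n, ℂ)) :
    IsLinearMap ℂ (fun g => T f g h) :=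
  ⟨fun g g' => by rw [map_add]; rfl, fun c g => by rw [map_smul]; rfl⟩

theorem BilinOp.linear₃ {n : ℕ} (T : BilinOp n) (f g : 𝓢(Rn n, ℂ)) :
    IsLinearMap ℂ (fun h => T f g h) :=
  ⟨fun h h' => map_add _ h h', fun c h => map_smul _ c h⟩

theorem BilinOp.cont₁ {n : ℕ} (T : BilinOp n) (g h : 𝓢(Rn n, ℂ)) :
    Continuous (fun f => T f g h) :=
  (continuous_eval_const h).comp ((continuous_eval_const g).comp T.continuous)

theorem BilinOp.cont₂ {n : ℕ} (T : BilinOp n) (f h : 𝓢(Rn n, ℂ)) :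
    Continuous (fun g => T f g h) :=
  (continuous_eval_const h).comp (T f).continuous

theorem BilinOp.cont₃ {n : ℕ} (T : BilinOp n) (f g : 𝓢(Rn n, ℂ)) :
    Continuous (fun h => T f g h) :=
  (T f g).continuous

/-- The first transpose `T^{*1}`, given by `⟨T^{*1}(h, g), f⟩ = ⟨T(f, g), h⟩`. -/
noncomputable def BilinOp.transpose₁ {n : ℕ} (T : BilinOp n) : BilinOp n :=
  BilinOp.ofForm (fun h g f => T f g h)
    (fun g f => T.linear₃ f g) (fun g f => T.cont₃ f g)
    (fun h f => T.linear₂ f h) (fun h f => T.cont₂ f h)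
    (fun h g => T.linear₁ g h) (fun h g => T.cont₁ g h)

/-- The second transpose `T^{*2}`, given by `⟨T^{*2}(f, h), g⟩ = ⟨T(f, g), h⟩`. -/
noncomputable def BilinOp.transpose₂ {n : ℕ} (T : BilinOp n) : BilinOp n :=
  BilinOp.ofForm (fun f h g => T f g h)
    (fun h g => T.linear₁ g h) (fun h g => T.cont₁ g h)
    (fun f g => T.linear₃ f g) (fun f g => T.cont₃ f g)
    (fun f h => T.linear₂ f h) (fun f h => T.cont₂ f h)

theorem BilinOp.transpose₁_apply {n : ℕ} (T : BilinOp n) (f g h : 𝓢(Rn n, ℂ)) :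
    T.transpose₁ h g f = T f g h := rfl

theorem BilinOp.transpose₂_apply {n : ℕ} (T : BilinOp n) (f g h : 𝓢(Rn n, ℂ)) :
    T.transpose₂ f h g = T f g h := rfl

/-! ### The operator of a symbol maps `𝓢 × 𝓢` into `𝓢'` -/

theorem hat_eq {n : ℕ} (f : 𝓢(Rn n, ℂ)) (ξ : Rn n) :
    hat f ξ = ((2 * Real.pi : ℝ) : ℂ)⁻¹ ^ n * (𝓕 f : 𝓢(Rn n, ℂ)) ((2 * Real.pi)⁻¹ • ξ) := by
  rw [SchwartzMap.fourier_coe, Real.fourier_eq', hat]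
  congr 1
  refine integral_congr_ae (Filter.Eventually.of_forall fun x => ?_)
  simp only [smul_eq_mul, inner_smul_right]
  rw [mul_comm]
  congr 2
  have : (Real.pi : ℂ) ≠ 0 := by exact_mod_cast Real.pi_ne_zero
  push_cast
  field_simp

theorem hat_add {n : ℕ} (f g : 𝓢(Rn n, ℂ)) (ξ : Rn n) : hat (f + g) ξ = hat f ξ + hat g ξ := by
  simp only [hat_eq, FourierTransform.fourier_add, add_apply, mul_add]

theorem hat_smul {n : ℕ} (c : ℂ) (f : 𝓢(Rn n, ℂ)) (ξ : Rn n) : hat (c • f) ξ = c * hat f ξ := by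
  simp only [hat_eq, FourierTransform.fourier_smul, smul_apply, smul_eq_mul]
  ring

theorem continuous_hat {n : ℕ} (f : 𝓢(Rn n, ℂ)) : Continuous (hat f) := by
  have : hat f = fun ξ => ((2 * Real.pi : ℝ) : ℂ)⁻¹ ^ n *
      (𝓕 f : 𝓢(Rn n, ℂ)) ((2 * Real.pi)⁻¹ • ξ) := funext (hat_eq f)
  rw [this]
  exact continuous_const.mul ((SchwartzMap.continuous _).comp (continuous_const_smul _))

/-- `C p(f)` where `p` is a continuous Schwartz seminorm, majorizing `(1 + |x|)^K |f(x)|`. -/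
noncomputable def decay {n : ℕ} (K : ℕ) (f : 𝓢(Rn n, ℂ)) : ℝ :=
  2 ^ K * (Finset.Iic (K, 0)).sup (fun m : ℕ × ℕ => SchwartzMap.seminorm ℂ m.1 m.2) f

theorem decay_nonneg {n : ℕ} (K : ℕ) (f : 𝓢(Rn n, ℂ)) : 0 ≤ decay K f :=
  mul_nonneg (by positivity) (apply_nonneg _ _)

theorem continuous_decay {n : ℕ} (K : ℕ) : Continuous (decay K : 𝓢(Rn n, ℂ) → ℝ) := by
  refine continuous_const.mul ?_
  exact Seminorm.continuous_finsetSup fun m _ =>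
    (schwartz_withSeminorms ℂ (Rn n) ℂ).continuous_seminorm m

theorem decay_zero {n : ℕ} (K : ℕ) : decay K (0 : 𝓢(Rn n, ℂ)) = 0 := by
  simp [decay]

theorem decay_spec {n : ℕ} (K : ℕ) (f : 𝓢(Rn n, ℂ)) (x : Rn n) :
    (1 + ‖x‖) ^ K * ‖f x‖ ≤ decay K f := by
  have := SchwartzMap.one_add_le_sup_seminorm_apply (𝕜 := ℂ) (m := (K, 0)) le_rfl le_rfl f x
  simpa [decay] using this

/-- A constant times `decay` of the Fourier transform, majorizing `(1 + |ξ|)^K |f̂(ξ)|`. -/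
noncomputable def hatDecay {n : ℕ} (K : ℕ) (f : 𝓢(Rn n, ℂ)) : ℝ :=
  (2 * Real.pi) ^ K * ((2 * Real.pi)⁻¹ ^ n * decay K (𝓕 f : 𝓢(Rn n, ℂ)))

theorem hatDecay_nonneg {n : ℕ} (K : ℕ) (f : 𝓢(Rn n, ℂ)) : 0 ≤ hatDecay K f := by
  have := decay_nonneg K (𝓕 f : 𝓢(Rn n, ℂ))
  unfold hatDecay
  positivity

theorem continuous_hatDecay {n : ℕ} (K : ℕ) : Continuous (hatDecay K : 𝓢(Rn n, ℂ) → ℝ) :=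
  continuous_const.mul (continuous_const.mul
    ((continuous_decay K).comp (fourierTransformCLM ℂ).continuous))

theorem hatDecay_zero {n : ℕ} (K : ℕ) : hatDecay K (0 : 𝓢(Rn n, ℂ)) = 0 := by
  have : (𝓕 (0 : 𝓢(Rn n, ℂ)) : 𝓢(Rn n, ℂ)) = 0 := (fourierTransformCLM ℂ).map_zero
  simp [hatDecay, this, decay_zero]

theorem hatDecay_spec {n : ℕ} (K : ℕ) (f : 𝓢(Rn n, ℂ)) (ξ : Rn n) :
    (1 + ‖ξ‖) ^ K * ‖hat f ξ‖ ≤ hatDecay K f := by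
  have hpi : (1 : ℝ) ≤ 2 * Real.pi := by linarith [Real.pi_gt_three]
  have h1 : 1 + ‖ξ‖ ≤ 2 * Real.pi * (1 + ‖(2 * Real.pi)⁻¹ • ξ‖) := by
    rw [norm_smul, Real.norm_of_nonneg (by positivity), mul_add, ← mul_assoc,
      mul_inv_cancel₀ (by positivity)]
    linarith
  have h2 := decay_spec K (𝓕 f : 𝓢(Rn n, ℂ)) ((2 * Real.pi)⁻¹ • ξ)
  have h3 : ‖hat f ξ‖ = (2 * Real.pi)⁻¹ ^ n * ‖(𝓕 f : 𝓢(Rn n, ℂ)) ((2 * Real.pi)⁻¹ • ξ)‖ := by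
    rw [hat_eq, norm_mul, norm_pow, norm_inv, Complex.norm_real,
      Real.norm_of_nonneg (by positivity)]
  rw [h3, hatDecay]
  calc (1 + ‖ξ‖) ^ K * ((2 * Real.pi)⁻¹ ^ n * ‖(𝓕 f : 𝓢(Rn n, ℂ)) ((2 * Real.pi)⁻¹ • ξ)‖)
      ≤ (2 * Real.pi * (1 + ‖(2 * Real.pi)⁻¹ • ξ‖)) ^ K *
          ((2 * Real.pi)⁻¹ ^ n * ‖(𝓕 f : 𝓢(Rn n, ℂ)) ((2 * Real.pi)⁻¹ • ξ)‖) := by gcongr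
    _ = (2 * Real.pi) ^ K * ((2 * Real.pi)⁻¹ ^ n *
          ((1 + ‖(2 * Real.pi)⁻¹ • ξ‖) ^ K * ‖(𝓕 f : 𝓢(Rn n, ℂ)) ((2 * Real.pi)⁻¹ • ξ)‖)) := by
        rw [mul_pow]; ring
    _ ≤ _ := by gcongr

/-- The integrable weight `(1 + |x|)^{-(n+1)}`. -/
noncomputable def wt {n : ℕ} (x : Rn n) : ℝ := ((1 + ‖x‖) ^ (n + 1))⁻¹

theorem wt_nonneg {n : ℕ} (x : Rn n) : 0 ≤ wt x := by unfold wt; positivity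

theorem integrable_wt {n : ℕ} : Integrable (wt : Rn n → ℝ) := by
  have h := integrable_one_add_norm (E := Rn n) (μ := volume) (r := ((n + 1 : ℕ) : ℝ)) (by simp)
  refine h.congr (Filter.Eventually.of_forall fun x => ?_)
  simp only [wt]
  rw [Real.rpow_neg (by positivity), Real.rpow_natCast]

theorem le_wt_of_decay {n : ℕ} {k : ℕ} {x : Rn n} {a D : ℝ}
    (h : (1 + ‖x‖) ^ (k + (n + 1)) * a ≤ D) : (1 + ‖x‖) ^ k * a ≤ D * wt x := by
  rw [wt, ← div_eq_mul_inv, le_div_iff₀ (by positivity)]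
  calc _ = (1 + ‖x‖) ^ (k + (n + 1)) * a := by rw [pow_add]; ring
    _ ≤ D := h

theorem multiDeriv_zero {V : Type*} [NormedAddCommGroup V] [NormedSpace ℝ V] {n : ℕ}
    (e : Fin n → V) (f : V → ℂ) : multiDeriv e 0 f = f := by
  unfold multiDeriv
  induction List.finRange n with
  | nil => rfl
  | cons i l ih => simp

theorem BS.bound {n : ℕ} {m ρ δ : ℝ} {σ : Rn n × Rn n × Rn n → ℂ} (hσ : σ ∈ BS n m ρ δ) :
    ∃ C : ℝ, 0 < C ∧ ∃ k : ℕ, ∀ x ξ η, ‖σ (x, ξ, η)‖ ≤ C * ((1 + ‖ξ‖) ^ k * (1 + ‖η‖) ^ k) := by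
  obtain ⟨C, hC, h⟩ := hσ.2 0 0 0
  refine ⟨C, hC, ⌈m⌉₊, fun x ξ η => ?_⟩
  have h1 := h x ξ η
  simp only [multiDeriv_zero, mlen, Pi.zero_apply, Finset.sum_const_zero, Nat.cast_zero, mul_zero,
    add_zero, sub_zero] at h1
  have hξ := norm_nonneg ξ
  have hη := norm_nonneg η
  refine h1.trans (mul_le_mul_of_nonneg_left ?_ hC.le)
  calc (1 + ‖ξ‖ + ‖η‖) ^ m ≤ (1 + ‖ξ‖ + ‖η‖) ^ (⌈m⌉₊ : ℝ) :=
        Real.rpow_le_rpow_of_exponent_le (by linarith) (Nat.le_ceil m)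
    _ = (1 + ‖ξ‖ + ‖η‖) ^ ⌈m⌉₊ := Real.rpow_natCast _ _
    _ ≤ ((1 + ‖ξ‖) * (1 + ‖η‖)) ^ ⌈m⌉₊ := by
        gcongr
        nlinarith
    _ = _ := mul_pow _ _ _

/-- The integrand of `opFun`. -/
noncomputable def opIntegrand {n : ℕ} (σ : Rn n × Rn n × Rn n → ℂ) (f g : 𝓢(Rn n, ℂ)) (x : Rn n)
    (p : Rn n × Rn n) : ℂ :=
  σ (x, p.1, p.2) * hat f p.1 * hat g p.2 * Complex.exp (Complex.I * ⟪x, p.1 + p.2⟫_ℝ)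

theorem norm_opIntegrand_le {n : ℕ} {σ : Rn n × Rn n × Rn n → ℂ} {C : ℝ} (hC : 0 < C) {k : ℕ}
    (h : ∀ x ξ η, ‖σ (x, ξ, η)‖ ≤ C * ((1 + ‖ξ‖) ^ k * (1 + ‖η‖) ^ k))
    (f g : 𝓢(Rn n, ℂ)) (x : Rn n) (p : Rn n × Rn n) :
    ‖opIntegrand σ f g x p‖ ≤
      C * (hatDecay (k + (n + 1)) f * hatDecay (k + (n + 1)) g) * (wt p.1 * wt p.2) := by
  have hexp : ‖Complex.exp (Complex.I * ⟪x, p.1 + p.2⟫_ℝ)‖ = 1 := by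
    rw [mul_comm]; exact Complex.norm_exp_ofReal_mul_I _
  rw [opIntegrand, norm_mul, norm_mul, norm_mul, hexp, mul_one]
  have hf := le_wt_of_decay (hatDecay_spec (k + (n + 1)) f p.1)
  have hg := le_wt_of_decay (hatDecay_spec (k + (n + 1)) g p.2)
  have hf0 := mul_nonneg (hatDecay_nonneg (k + (n + 1)) f) (wt_nonneg p.1)
  calc ‖σ (x, p.1, p.2)‖ * ‖hat f p.1‖ * ‖hat g p.2‖
      ≤ C * ((1 + ‖p.1‖) ^ k * (1 + ‖p.2‖) ^ k) * ‖hat f p.1‖ * ‖hat g p.2‖ := by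
        gcongr; exact h _ _ _
    _ = C * (((1 + ‖p.1‖) ^ k * ‖hat f p.1‖) * ((1 + ‖p.2‖) ^ k * ‖hat g p.2‖)) := by ring
    _ ≤ C * ((hatDecay (k + (n + 1)) f * wt p.1) * (hatDecay (k + (n + 1)) g * wt p.2)) := by
        gcongr
    _ = _ := by ring

theorem integrable_wt_mul {n : ℕ} : Integrable (fun p : Rn n × Rn n => wt p.1 * wt p.2) :=
  integrable_wt.mul_prod integrable_wt

theorem integrable_opIntegrand {n : ℕ} {m ρ δ : ℝ} {σ : Rn n × Rn n × Rn n → ℂ}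
    (hσ : σ ∈ BS n m ρ δ) (f g : 𝓢(Rn n, ℂ)) (x : Rn n) : Integrable (opIntegrand σ f g x) := by
  obtain ⟨C, hC, k, h⟩ := BS.bound hσ
  have hc := hσ.1.continuous
  have hf := continuous_hat f
  have hg := continuous_hat g
  refine (integrable_wt_mul.const_mul _).mono' ?_
    (Filter.Eventually.of_forall (norm_opIntegrand_le hC h f g x))
  refine Continuous.aestronglyMeasurable ?_
  unfold opIntegrand
  fun_prop

theorem continuous_opFun {n : ℕ} {m ρ δ : ℝ} {σ : Rn n × Rn n × Rn n → ℂ}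
    (hσ : σ ∈ BS n m ρ δ) (f g : 𝓢(Rn n, ℂ)) : Continuous (opFun σ f g) := by
  obtain ⟨C, hC, k, h⟩ := BS.bound hσ
  have hc := hσ.1.continuous
  refine continuous_of_dominated (F := fun x p => opIntegrand σ f g x p)
    (fun x => (integrable_opIntegrand hσ f g x).aestronglyMeasurable)
    (fun x => Filter.Eventually.of_forall (norm_opIntegrand_le hC h f g x))
    (integrable_wt_mul.const_mul _) (Filter.Eventually.of_forall fun p => ?_)
  unfold opIntegrand
  fun_prop

theorem norm_opFun_le {n : ℕ} {σ : Rn n × Rn n × Rn n → ℂ} {C : ℝ} (hC : 0 < C) {k : ℕ}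
    (h : ∀ x ξ η, ‖σ (x, ξ, η)‖ ≤ C * ((1 + ‖ξ‖) ^ k * (1 + ‖η‖) ^ k))
    (f g : 𝓢(Rn n, ℂ)) (x : Rn n) :
    ‖opFun σ f g x‖ ≤ C * (hatDecay (k + (n + 1)) f * hatDecay (k + (n + 1)) g) *
      ∫ p : Rn n × Rn n, wt p.1 * wt p.2 := by
  rw [← integral_const_mul]
  exact norm_integral_le_of_norm_le (integrable_wt_mul.const_mul _)
    (Filter.Eventually.of_forall (norm_opIntegrand_le hC h f g x))

/-- The duality pairing `⟨T_σ(f, g), h⟩ = ∫ T_σ(f, g)(x) h(x) dx`. -/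
noncomputable def opForm {n : ℕ} (σ : Rn n × Rn n × Rn n → ℂ) (f g h : 𝓢(Rn n, ℂ)) : ℂ :=
  ∫ x : Rn n, opFun σ f g x * h x

theorem integrable_opFun_mul {n : ℕ} {m ρ δ : ℝ} {σ : Rn n × Rn n × Rn n → ℂ}
    (hσ : σ ∈ BS n m ρ δ) (f g h : 𝓢(Rn n, ℂ)) : Integrable (fun x => opFun σ f g x * h x) := by
  obtain ⟨C, hC, k, hb⟩ := BS.bound hσ
  exact h.integrable.bdd_mul (continuous_opFun hσ f g).aestronglyMeasurable
    (Filter.Eventually.of_forall (norm_opFun_le hC hb f g))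

theorem opForm_bound {n : ℕ} {m ρ δ : ℝ} {σ : Rn n × Rn n × Rn n → ℂ} (hσ : σ ∈ BS n m ρ δ) :
    ∃ (C : ℝ) (K : ℕ), ∀ f g h : 𝓢(Rn n, ℂ),
      ‖opForm σ f g h‖ ≤ C * hatDecay K f * hatDecay K g * decay (n + 1) h := by
  obtain ⟨C, hC, k, hb⟩ := BS.bound hσ
  refine ⟨C * (∫ p : Rn n × Rn n, wt p.1 * wt p.2) * ∫ x : Rn n, wt x, k + (n + 1),
    fun f g h => ?_⟩
  have key : ∀ x, ‖opFun σ f g x * h x‖ ≤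
      C * (hatDecay (k + (n + 1)) f * hatDecay (k + (n + 1)) g) *
        (∫ p : Rn n × Rn n, wt p.1 * wt p.2) * decay (n + 1) h * wt x := fun x => by
    have h1 := norm_opFun_le hC hb f g x
    have h2 : (1 + ‖x‖) ^ 0 * ‖h x‖ ≤ decay (n + 1) h * wt x :=
      le_wt_of_decay (by simpa using decay_spec (n + 1) h x)
    rw [pow_zero, one_mul] at h2
    rw [norm_mul, mul_assoc _ (decay (n + 1) h)]
    exact mul_le_mul h1 h2 (norm_nonneg _) ((norm_nonneg _).trans h1)
  have := norm_integral_le_of_norm_le (integrable_wt.const_mul _)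
    (Filter.Eventually.of_forall key)
  rw [integral_const_mul] at this
  refine this.trans (le_of_eq ?_)
  ring

theorem opForm_linear₁ {n : ℕ} {m ρ δ : ℝ} {σ : Rn n × Rn n × Rn n → ℂ} (hσ : σ ∈ BS n m ρ δ)
    (g h : 𝓢(Rn n, ℂ)) : IsLinearMap ℂ (fun f => opForm σ f g h) := by
  refine ⟨fun f f' => ?_, fun c f => ?_⟩
  · have : ∀ x, opFun σ (f + f') g x = opFun σ f g x + opFun σ f' g x := fun x => by
      refine Eq.trans ?_
        (integral_add (integrable_opIntegrand hσ f g x) (integrable_opIntegrand hσ f' g x))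
      refine integral_congr_ae (Filter.Eventually.of_forall fun p => ?_)
      simp only [hat_add]
      ring
    simp only [opForm, this, add_mul]
    exact integral_add (integrable_opFun_mul hσ f g h) (integrable_opFun_mul hσ f' g h)
  · have : ∀ x, opFun σ (c • f) g x = c * opFun σ f g x := fun x => by
      rw [opFun, opFun, ← integral_const_mul]
      refine integral_congr_ae (Filter.Eventually.of_forall fun p => ?_)
      simp only [hat_smul]
      ring
    simp only [opForm, this, smul_eq_mul, mul_assoc]
    exact integral_const_mul _ _

theorem opForm_linear₂ {n : ℕ} {m ρ δ : ℝ} {σ : Rn n × Rn n × Rn n → ℂ} (hσ : σ ∈ BS n m ρ δ)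
    (f h : 𝓢(Rn n, ℂ)) : IsLinearMap ℂ (fun g => opForm σ f g h) := by
  refine ⟨fun g g' => ?_, fun c g => ?_⟩
  · have : ∀ x, opFun σ f (g + g') x = opFun σ f g x + opFun σ f g' x := fun x => by
      refine Eq.trans ?_
        (integral_add (integrable_opIntegrand hσ f g x) (integrable_opIntegrand hσ f g' x))
      refine integral_congr_ae (Filter.Eventually.of_forall fun p => ?_)
      simp only [hat_add]
      ring
    simp only [opForm, this, add_mul]
    exact integral_add (integrable_opFun_mul hσ f g h) (integrable_opFun_mul hσ f g' h)
  · have : ∀ x, opFun σ f (c • g) x = c * opFun σ f g x := fun x => by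
      rw [opFun, opFun, ← integral_const_mul]
      refine integral_congr_ae (Filter.Eventually.of_forall fun p => ?_)
      simp only [hat_smul]
      ring
    simp only [opForm, this, smul_eq_mul, mul_assoc]
    exact integral_const_mul _ _

theorem opForm_linear₃ {n : ℕ} {m ρ δ : ℝ} {σ : Rn n × Rn n × Rn n → ℂ} (hσ : σ ∈ BS n m ρ δ)
    (f g : 𝓢(Rn n, ℂ)) : IsLinearMap ℂ (fun h => opForm σ f g h) := by
  refine ⟨fun h h' => ?_, fun c h => ?_⟩
  · simp only [opForm, add_apply, mul_add]
    exact integral_add (integrable_opFun_mul hσ f g h) (integrable_opFun_mul hσ f g h')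
  · simp only [opForm, smul_apply, smul_eq_mul, mul_left_comm _ c]
    exact integral_const_mul _ _

theorem continuous_of_majorant {n : ℕ} {L : 𝓢(Rn n, ℂ) → ℂ} (hL : IsLinearMap ℂ L)
    {N : 𝓢(Rn n, ℂ) → ℝ} (hN : Continuous N) (hN0 : N 0 = 0) (h : ∀ f, ‖L f‖ ≤ N f) :
    Continuous L := by
  refine continuous_of_continuousAt_zero (hL.mk' L) ?_
  have h0 : Filter.Tendsto N (nhds 0) (nhds 0) := by simpa [hN0] using hN.tendsto 0
  have : Filter.Tendsto L (nhds 0) (nhds 0) := squeeze_zero_norm h h0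
  have h1 : L 0 = 0 := hL.map_zero
  change Filter.Tendsto L (nhds 0) (nhds (L 0))
  rwa [h1]

/-- The bilinear pseudodifferential operator `T_σ` with symbol `σ ∈ BS^m_{ρ,δ}`, given by
`⟨T_σ(f, g), h⟩ = ∫ T_σ(f, g)(x) h(x) dx`. -/
noncomputable def op {n : ℕ} {m ρ δ : ℝ} (σ : BS n m ρ δ) : BilinOp n :=
  BilinOp.ofForm (opForm σ.1)
    (opForm_linear₁ σ.2)
    (fun g h => by
      obtain ⟨C, K, hb⟩ := opForm_bound σ.2
      refine continuous_of_majorant (opForm_linear₁ σ.2 g h)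
        (N := fun f => C * hatDecay K f * hatDecay K g * decay (n + 1) h) ?_ ?_ fun f => hb f g h
      · have := continuous_hatDecay (n := n) K
        fun_prop
      · simp [hatDecay_zero])
    (opForm_linear₂ σ.2)
    (fun f h => by
      obtain ⟨C, K, hb⟩ := opForm_bound σ.2
      refine continuous_of_majorant (opForm_linear₂ σ.2 f h)
        (N := fun g => C * hatDecay K f * hatDecay K g * decay (n + 1) h) ?_ ?_ fun g => hb f g h
      · have := continuous_hatDecay (n := n) K
        fun_prop
      · simp [hatDecay_zero])
    (opForm_linear₃ σ.2)
    (fun f g => by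
      obtain ⟨C, K, hb⟩ := opForm_bound σ.2
      refine continuous_of_majorant (opForm_linear₃ σ.2 f g)
        (N := fun h => C * hatDecay K f * hatDecay K g * decay (n + 1) h) ?_ ?_ fun h => hb f g h
      · have := continuous_decay (n := n) (n + 1)
        fun_prop
      · simp [decay_zero])

theorem op_apply {n : ℕ} {m ρ δ : ℝ} (σ : BS n m ρ δ) (f g h : 𝓢(Rn n, ℂ)) :
    op σ f g h = ∫ x : Rn n, opFun σ.1 f g x * h x := rfl

end BilinearPDO

/-! For fixed η, the form ⟨T_σ(f, g), h⟩ is a linear transposition problem in the pair (f, h).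
Expanding f̂, substituting x = y + z and writing h by Fourier inversion leads formally to σ^{*1}(x,
ξ, η) = (2π)^{-n} ∫∫ σ(x + z, -ξ - η + θ, η) e^{i z·θ} dz dθ, that is, (2π)^{-n} times `dualSym σ`
evaluated at (x, -ξ - η, η). The integral does not converge absolutely. The work lies in giving it a
meaning and in showing that it stays in the class.

Two integrations by parts give the meaning. In z, a factor θ_j is traded for a z-derivative, which
raises the order only by δ. Since δ < 1, enough of them yield any decay in θ (`AmpFam.osc_bound`),
provided the amplitude is integrable in z. In θ, the exponential is reproduced by (1 + i t z_j)^{-1}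
(1 + t ∂_{θ_j}), so an amplitude may be replaced by its image under ∏ (1 - t ∂_{θ_j})² times the
window ∏ (1 + i t z_j)^{-2} (`oscInt_prodOp`). The window supplies integrability in z. The resulting
`regInt t` does not depend on t (`SymFam.regInt_eq`).

The sharp bound comes from this freedom in t. Put Λ = 1 + |ξ| + |η| and rescale (z, θ) to (Λ^{-δ} z,
Λ^δ θ), which preserves both z·θ and dz dθ. A z-derivative now costs Λ^{-δ} Λ^δ and a θ-derivative
costs Λ^{δ-ρ} ≤ 1, up to powers of 1 + |θ|: because δ < 1, the weight at the displaced point is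
comparable to Λ up to such powers. Hence the rescaled amplitude is of size Λ^m with constants
uniform in the base point (`IsSymbol.centred_scale`), and |`dualSym` a| ≤ C Λ^m
(`IsSymbol.dualSym_bound`). Derivatives pass under the integral (`wordDeriv_dualSym`), so this
bound, applied to the derivatives of a, gives all symbol estimates (`IsSymbol.dualSym`).

The substitution (ξ, η) ↦ (-ξ - η, η) preserves the class because ξ- and η-derivatives have the same
order -ρ (`IsSymbol.comp_freqMap`). Fubini and Fourier inversion make the formal computation
rigorous (`integral_dualSym`, `transpose_identity`). The second transpose is the first one
conjugated by the exchange of the two arguments. -/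

namespace BilinearPDO

/-! ### Directional derivatives along words -/

section Words

variable {V : Type*} [NormedAddCommGroup V] [NormedSpace ℝ V]

theorem smooth_add {f g : V → ℂ} (hf : ContDiff ℝ ∞ f) (hg : ContDiff ℝ ∞ g) :
    ContDiff ℝ ∞ (f + g) := hf.add hg

theorem smooth_mul {f g : V → ℂ} (hf : ContDiff ℝ ∞ f) (hg : ContDiff ℝ ∞ g) :
    ContDiff ℝ ∞ (f * g) := hf.mul hg

theorem smooth_const_smul {f : V → ℂ} (hf : ContDiff ℝ ∞ f) (c : ℂ) :
    ContDiff ℝ ∞ (c • f) := hf.const_smul c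

theorem dirDeriv_apply {f : V → ℂ} (hf : ContDiff ℝ ∞ f) (v p : V) :
    dirDeriv v f p = fderiv ℝ f p v :=
  ((hf.differentiable (by simp)) p).lineDeriv_eq_fderiv

theorem dirDeriv_eq_fderiv {f : V → ℂ} (hf : ContDiff ℝ ∞ f) (v : V) :
    dirDeriv v f = fun p => fderiv ℝ f p v :=
  funext fun p => dirDeriv_apply hf v p

theorem contDiff_dirDeriv {f : V → ℂ} (hf : ContDiff ℝ ∞ f) (v : V) :
    ContDiff ℝ ∞ (dirDeriv v f) := by
  rw [dirDeriv_eq_fderiv hf]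
  exact (hf.fderiv_right (m := ∞) (by simp)).clm_apply contDiff_const

theorem dirDeriv_add {f g : V → ℂ} (hf : ContDiff ℝ ∞ f) (hg : ContDiff ℝ ∞ g) (v : V) :
    dirDeriv v (f + g) = dirDeriv v f + dirDeriv v g := by
  funext p
  rw [Pi.add_apply, dirDeriv_apply hf, dirDeriv_apply hg, dirDeriv_apply (smooth_add hf hg),
    fderiv_add (hf.differentiable (by simp) p) (hg.differentiable (by simp) p)]
  rfl

theorem dirDeriv_const_smul {f : V → ℂ} (hf : ContDiff ℝ ∞ f) (c : ℂ) (v : V) :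
    dirDeriv v (c • f) = c • dirDeriv v f := by
  funext p
  rw [Pi.smul_apply, dirDeriv_apply hf, dirDeriv_apply (smooth_const_smul hf c),
    fderiv_const_smul (hf.differentiable (by simp) p)]
  rfl

theorem dirDeriv_mul {f g : V → ℂ} (hf : ContDiff ℝ ∞ f) (hg : ContDiff ℝ ∞ g) (v : V) :
    dirDeriv v (f * g) = dirDeriv v f * g + f * dirDeriv v g := by
  funext p
  rw [Pi.add_apply, Pi.mul_apply, Pi.mul_apply, dirDeriv_apply hf, dirDeriv_apply hg,
    dirDeriv_apply (smooth_mul hf hg),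
    fderiv_mul (hf.differentiable (by simp) p) (hg.differentiable (by simp) p)]
  simp [mul_comm, add_comm]

theorem dirDeriv_comm {f : V → ℂ} (hf : ContDiff ℝ ∞ f) (v w : V) :
    dirDeriv v (dirDeriv w f) = dirDeriv w (dirDeriv v f) := by
  have hd : Differentiable ℝ (fderiv ℝ f) :=
    (hf.fderiv_right (m := ∞) (by simp)).differentiable (by simp)
  have key : ∀ v w p, dirDeriv v (dirDeriv w f) p = fderiv ℝ (fderiv ℝ f) p v w := fun v w p => by
    rw [dirDeriv_eq_fderiv (contDiff_dirDeriv hf w), dirDeriv_eq_fderiv hf]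
    change fderiv ℝ (fun p => fderiv ℝ f p w) p v = _
    rw [fderiv_clm_apply (hd p) (differentiableAt_const w)]
    simp
  funext p
  rw [key, key]
  exact ((contDiff_infty.1 hf 2).contDiffAt.isSymmSndFDerivAt (by simp)) v w

/-- Chain rule for precomposition with an affine map. -/
theorem dirDeriv_comp_affine {U : Type*} [NormedAddCommGroup U] [NormedSpace ℝ U] {f : V → ℂ}
    (hf : ContDiff ℝ ∞ f) (p : V) (L : U →L[ℝ] V) (u : U) :
    dirDeriv u (fun x => f (p + L x)) = fun x => dirDeriv (L u) f (p + L x) := by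
  funext x
  have hc : ContDiff ℝ ∞ (fun x => f (p + L x)) := hf.comp (contDiff_const.add L.contDiff)
  rw [dirDeriv_eq_fderiv hf, dirDeriv_eq_fderiv hc]
  have h1 : HasFDerivAt (fun x => p + L x) L x := L.hasFDerivAt.const_add p
  have h2 := ((hf.differentiable (by simp)) (p + L x)).hasFDerivAt.comp x h1
  change fderiv ℝ (f ∘ fun x => p + L x) x u = _
  rw [h2.fderiv]
  rfl

theorem dirDeriv_add_left {f : V → ℂ} (hf : ContDiff ℝ ∞ f) (v w : V) :
    dirDeriv (v + w) f = dirDeriv v f + dirDeriv w f := by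
  funext p; simp [dirDeriv_eq_fderiv hf]

theorem dirDeriv_smul_left {f : V → ℂ} (hf : ContDiff ℝ ∞ f) (c : ℝ) (v : V) :
    dirDeriv (c • v) f = (c : ℂ) • dirDeriv v f := by
  funext p; simp [dirDeriv_eq_fderiv hf]

/-- The iterated derivative of `f` along a word in the directions `d`. -/
noncomputable def wordDeriv {ι : Type*} (d : ι → V) : List ι → (V → ℂ) → V → ℂ
  | [], f => f
  | i :: l, f => wordDeriv d l (dirDeriv (d i) f)

variable {ι : Type*} (d : ι → V)

@[simp] theorem wordDeriv_nil (f : V → ℂ) : wordDeriv d [] f = f := rfl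

@[simp] theorem wordDeriv_cons (i : ι) (l : List ι) (f : V → ℂ) :
    wordDeriv d (i :: l) f = wordDeriv d l (dirDeriv (d i) f) := rfl

theorem wordDeriv_append (l l' : List ι) (f : V → ℂ) :
    wordDeriv d (l ++ l') f = wordDeriv d l' (wordDeriv d l f) := by
  induction l generalizing f with
  | nil => rfl
  | cons i l ih => exact ih _

theorem wordDeriv_add (l : List ι) {f g : V → ℂ} (hf : ContDiff ℝ ∞ f) (hg : ContDiff ℝ ∞ g) :
    wordDeriv d l (f + g) = wordDeriv d l f + wordDeriv d l g := by
  induction l generalizing f g with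
  | nil => rfl
  | cons i l ih =>
    rw [wordDeriv_cons, dirDeriv_add hf hg, ih (contDiff_dirDeriv hf _) (contDiff_dirDeriv hg _)]
    rfl

theorem wordDeriv_const_smul (l : List ι) {f : V → ℂ} (hf : ContDiff ℝ ∞ f) (c : ℂ) :
    wordDeriv d l (c • f) = c • wordDeriv d l f := by
  induction l generalizing f with
  | nil => rfl
  | cons i l ih =>
    rw [wordDeriv_cons, dirDeriv_const_smul hf, ih (contDiff_dirDeriv hf _)]
    rfl

theorem wordDeriv_zero_fun (l : List ι) : wordDeriv d l (0 : V → ℂ) = 0 := by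
  have h := wordDeriv_const_smul d l (contDiff_const : ContDiff ℝ ∞ (0 : V → ℂ)) 0
  rwa [zero_smul, zero_smul] at h

/-- Symmetry of second derivatives. This is what allows words in any order to replace multi-indices.
-/
theorem wordDeriv_perm {l l' : List ι} (h : l.Perm l') {f : V → ℂ} (hf : ContDiff ℝ ∞ f) :
    wordDeriv d l f = wordDeriv d l' f := by
  induction h generalizing f with
  | nil => rfl
  | cons i _ ih => exact ih (contDiff_dirDeriv hf _)
  | swap i j l => simp only [wordDeriv_cons, dirDeriv_comm hf]
  | trans _ _ ih1 ih2 => rw [ih1 hf, ih2 hf]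

end Words

/-! ### Families of symbols -/

/-- A family `F s` of smooth functions whose derivative along a word `l` of directions `d i` is
bounded by a multiple, uniform in `s`, of `N s · Λ s ^ (m + ∑_{i ∈ l} κ i)`. -/
structure SymFam {P V ι : Type*} [NormedAddCommGroup V] [NormedSpace ℝ V] (d : ι → V) (κ : ι → ℝ)
    (N Λ : P → V → ℝ) (m : ℝ) (F : P → V → ℂ) : Prop where
  smooth : ∀ s, ContDiff ℝ ∞ (F s)
  bound : ∀ l : List ι, ∃ C : ℝ, 0 ≤ C ∧ ∀ s v,
    ‖wordDeriv d l (F s) v‖ ≤ C * (N s v * Λ s v ^ (m + (l.map κ).sum))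

namespace SymFam

variable {P V ι : Type*} [NormedAddCommGroup V] [NormedSpace ℝ V] {d : ι → V} {κ : ι → ℝ}
  {N N₁ N₂ Λ : P → V → ℝ} {m m₁ m₂ : ℝ} {F G : P → V → ℂ}

theorem deriv (h : SymFam d κ N Λ m F) (i : ι) :
    SymFam d κ N Λ (m + κ i) (fun s => dirDeriv (d i) (F s)) where
  smooth s := contDiff_dirDeriv (h.smooth s) _
  bound l := by
    obtain ⟨C, hC, hb⟩ := h.bound (i :: l)
    refine ⟨C, hC, fun s v => ?_⟩
    simpa [add_assoc] using hb s v

theorem word (h : SymFam d κ N Λ m F) (l : List ι) :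
    SymFam d κ N Λ (m + (l.map κ).sum) (fun s => wordDeriv d l (F s)) := by
  induction l generalizing F m with
  | nil => simpa using h
  | cons i l ih => simpa [add_assoc] using ih (h.deriv i)

theorem add (hF : SymFam d κ N Λ m F) (hG : SymFam d κ N Λ m G) :
    SymFam d κ N Λ m (fun s => F s + G s) where
  smooth s := smooth_add (hF.smooth s) (hG.smooth s)
  bound l := by
    obtain ⟨C, hC, hb⟩ := hF.bound l
    obtain ⟨D, hD, hb'⟩ := hG.bound l
    refine ⟨C + D, by positivity, fun s v => ?_⟩
    rw [wordDeriv_add d l (hF.smooth s) (hG.smooth s), add_mul]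
    exact (norm_add_le _ _).trans (add_le_add (hb s v) (hb' s v))

theorem const_smul (hF : SymFam d κ N Λ m F) (c : ℂ) :
    SymFam d κ N Λ m (fun s => c • F s) where
  smooth s := smooth_const_smul (hF.smooth s) c
  bound l := by
    obtain ⟨C, hC, hb⟩ := hF.bound l
    refine ⟨‖c‖ * C, by positivity, fun s v => ?_⟩
    rw [wordDeriv_const_smul d l (hF.smooth s), mul_assoc, Pi.smul_apply, norm_smul]
    exact mul_le_mul_of_nonneg_left (hb s v) (norm_nonneg _)

theorem mono (hF : SymFam d κ N₁ Λ m₁ F) (hN : ∀ s v, 0 ≤ N₁ s v) (hΛ : ∀ s v, 1 ≤ Λ s v)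
    {A : ℝ} (hA : 0 ≤ A) (h : ∀ s v, N₁ s v ≤ A * N₂ s v) (hm : m₁ ≤ m₂) :
    SymFam d κ N₂ Λ m₂ F where
  smooth := hF.smooth
  bound l := by
    obtain ⟨C, hC, hb⟩ := hF.bound l
    refine ⟨C * A, by positivity, fun s v => (hb s v).trans ?_⟩
    rw [mul_assoc, ← mul_assoc A]
    have h1 := h s v
    have h2 : Λ s v ^ (m₁ + (l.map κ).sum) ≤ Λ s v ^ (m₂ + (l.map κ).sum) :=
      Real.rpow_le_rpow_of_exponent_le (hΛ s v) (by linarith)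
    have h3 : 0 ≤ Λ s v ^ (m₁ + (l.map κ).sum) := Real.rpow_nonneg (by linarith [hΛ s v]) _
    have h4 := (hN s v).trans h1
    gcongr

theorem mono_order (hF : SymFam d κ N Λ m₁ F) (hN : ∀ s v, 0 ≤ N s v) (hΛ : ∀ s v, 1 ≤ Λ s v)
    (hm : m₁ ≤ m₂) : SymFam d κ N Λ m₂ F :=
  hF.mono hN hΛ zero_le_one (fun s v => by simp) hm

/-- Leibniz rule by induction on the word: the first letter falls on one factor and shifts its order
by `κ i`. The induction therefore runs over all factors and orders at once, and no multinomial
coefficients appear. -/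
theorem mul (hF : SymFam d κ N₁ Λ m₁ F) (hG : SymFam d κ N₂ Λ m₂ G) (hΛ : ∀ s v, 0 < Λ s v) :
    SymFam d κ (fun s v => N₁ s v * N₂ s v) Λ (m₁ + m₂) (fun s => F s * G s) where
  smooth s := smooth_mul (hF.smooth s) (hG.smooth s)
  bound l := by
    induction l generalizing F G m₁ m₂ with
    | nil =>
      obtain ⟨C, hC, hb⟩ := hF.bound []
      obtain ⟨D, hD, hb'⟩ := hG.bound []
      refine ⟨C * D, by positivity, fun s v => ?_⟩
      have h1 := hb s v
      have h2 := hb' s v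
      simp only [wordDeriv_nil, List.map_nil, List.sum_nil, add_zero, Pi.mul_apply,
        norm_mul] at h1 h2 ⊢
      refine (mul_le_mul h1 h2 (norm_nonneg _) ((norm_nonneg _).trans h1)).trans (le_of_eq ?_)
      rw [Real.rpow_add (hΛ s v)]
      ring
    | cons i l ih =>
      obtain ⟨C, hC, hb⟩ := ih (hF.deriv i) hG
      obtain ⟨D, hD, hb'⟩ := ih hF (hG.deriv i)
      refine ⟨C + D, by positivity, fun s v => ?_⟩
      have e1 : m₁ + κ i + m₂ + (l.map κ).sum = m₁ + m₂ + ((i :: l).map κ).sum := by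
        simp; ring
      have e2 : m₁ + (m₂ + κ i) + (l.map κ).sum = m₁ + m₂ + ((i :: l).map κ).sum := by
        simp; ring
      have h1 := hb s v
      have h2 := hb' s v
      rw [e1] at h1
      rw [e2] at h2
      rw [wordDeriv_cons, dirDeriv_mul (hF.smooth s) (hG.smooth s), wordDeriv_add d l
        (smooth_mul (contDiff_dirDeriv (hF.smooth s) _) (hG.smooth s))
        (smooth_mul (hF.smooth s) (contDiff_dirDeriv (hG.smooth s) _)), add_mul]
      exact (norm_add_le _ _).trans (add_le_add h1 h2)

theorem comp {Q : Type*} (hF : SymFam d κ N Λ m F) (g : Q → P) :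
    SymFam d κ (fun s => N (g s)) (fun s => Λ (g s)) m (fun s => F (g s)) where
  smooth s := hF.smooth _
  bound l := by
    obtain ⟨C, hC, hb⟩ := hF.bound l
    exact ⟨C, hC, fun s v => hb _ _⟩

end SymFam

/-! ### Oscillatory integrals on `ℝⁿ × ℝⁿ` -/

/-- The coordinate directions of `(z, θ) ∈ ℝⁿ × ℝⁿ`. -/
noncomputable def phaseDir {n : ℕ} : Fin n ⊕ Fin n → Rn n × Rn n :=
  Sum.elim (fun j => (EuclideanSpace.single j 1, 0)) (fun j => (0, EuclideanSpace.single j 1))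

/-- The orders `δ` of `∂_z` and `μ` of `∂_θ`. -/
def phaseOrd {n : ℕ} (δ μ : ℝ) : Fin n ⊕ Fin n → ℝ := Sum.elim (fun _ => δ) (fun _ => μ)

/-- The integrable weight `∏ⱼ (1 + zⱼ²)⁻¹`. -/
noncomputable def prodWt {n : ℕ} (z : Rn n) : ℝ := ∏ j, (1 + z j ^ 2)⁻¹

theorem prodWt_nonneg {n : ℕ} (z : Rn n) : 0 ≤ prodWt z :=
  Finset.prod_nonneg fun _ _ => by positivity

theorem integrable_prodWt {n : ℕ} : Integrable (prodWt : Rn n → ℝ) := by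
  have h : Integrable (fun x : Fin n → ℝ => ∏ i, (1 + x i ^ 2)⁻¹) :=
    Integrable.fintype_prod (f := fun _ x => (1 + x ^ 2)⁻¹) fun _ => integrable_inv_one_add_sq
  exact (EuclideanSpace.volume_preserving_symm_measurableEquiv_toLp (Fin n)).integrable_comp_of_integrable h

/-- The unimodular phase `e^{i z·θ}`. -/
noncomputable def phase {n : ℕ} (z θ : Rn n) : ℂ := Complex.exp (Complex.I * ⟪z, θ⟫_ℝ)

theorem norm_phase {n : ℕ} (z θ : Rn n) : ‖phase z θ‖ = 1 := by
  rw [phase, mul_comm]; exact Complex.norm_exp_ofReal_mul_I _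

theorem continuous_phase {n : ℕ} : Continuous (fun v : Rn n × Rn n => phase v.1 v.2) := by
  unfold phase; fun_prop

theorem phase_comm {n : ℕ} (z θ : Rn n) : phase z θ = phase θ z := by
  rw [phase, phase, real_inner_comm]

theorem phase_add_left {n : ℕ} (z z' θ : Rn n) : phase (z + z') θ = phase z θ * phase z' θ := by
  rw [phase, phase, phase, ← Complex.exp_add, inner_add_left]; push_cast; ring_nf

theorem phase_add_right {n : ℕ} (z θ θ' : Rn n) : phase z (θ + θ') = phase z θ * phase z θ' := by
  rw [phase_comm, phase_add_left, phase_comm θ, phase_comm θ']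

/-- `∫ F(z, θ) e^{i z·θ} dz`. -/
noncomputable def osc {n : ℕ} (F : Rn n × Rn n → ℂ) (θ : Rn n) : ℂ :=
  ∫ z, F (z, θ) * phase z θ

/-- `∫∫ F(z, θ) e^{i z·θ} dz dθ` as an iterated integral. -/
noncomputable def oscInt {n : ℕ} (F : Rn n × Rn n → ℂ) : ℂ := ∫ θ, osc F θ

/-- Families of amplitudes in `(z, θ)` which are integrable in `z`. -/
abbrev AmpFam {P : Type*} {n : ℕ} (δ μ : ℝ) (M L : P → ℝ) (m : ℝ)
    (F : P → Rn n × Rn n → ℂ) : Prop :=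
  SymFam phaseDir (phaseOrd δ μ) (fun s v => M s * prodWt v.1) (fun s v => L s * (1 + ‖v.2‖)) m F

/-- Amplitudes in `(z, θ)` which are integrable in `z`. -/
abbrev Amp {n : ℕ} (δ μ m : ℝ) (F : Rn n × Rn n → ℂ) : Prop :=
  AmpFam δ μ (fun _ : Unit => 1) (fun _ => 1) m (fun _ => F)

section

variable {P : Type*} {n : ℕ} {δ μ m : ℝ} {M L : P → ℝ} {Fs : P → Rn n × Rn n → ℂ}
  {F : Rn n × Rn n → ℂ}

/-- For a frozen parameter the powers of `L s` go into the constant. `M` and `L` matter only for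
estimates uniform in `s`. -/
theorem AmpFam.amp (h : AmpFam δ μ M L m Fs) (hL : ∀ s, 1 ≤ L s) (s : P) :
    Amp δ μ m (Fs s) where
  smooth _ := h.smooth s
  bound l := by
    obtain ⟨C, hC, hb⟩ := h.bound l
    refine ⟨C * |M s| * L s ^ (m + (l.map (phaseOrd δ μ)).sum), ?_, fun _ v => ?_⟩
    · have := Real.rpow_nonneg (zero_le_one.trans (hL s)) (m + (l.map (phaseOrd (n := n) δ μ)).sum)
      positivity
    · refine (hb s v).trans ?_
      rw [Real.mul_rpow (zero_le_one.trans (hL s)) (by positivity)]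
      have h1 := Real.rpow_nonneg (zero_le_one.trans (hL s))
        (m + (l.map (phaseOrd (n := n) δ μ)).sum)
      have h2 : 0 ≤ (1 + ‖v.2‖) ^ (m + (l.map (phaseOrd (n := n) δ μ)).sum) := by positivity
      have h3 := prodWt_nonneg v.1
      have h4 := le_abs_self (M s)
      calc _ ≤ C * (|M s| * prodWt v.1 * (L s ^ (m + (l.map (phaseOrd δ μ)).sum) *
            (1 + ‖v.2‖) ^ (m + (l.map (phaseOrd δ μ)).sum))) := by gcongr
        _ = _ := by simp only [one_mul]; ring

theorem Amp.slice (h : Amp δ μ m F) (l : List (Fin n ⊕ Fin n)) (θ : Rn n) :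
    ∃ C : ℝ, ∀ z, ‖wordDeriv phaseDir l F (z, θ)‖ ≤ C * prodWt z := by
  obtain ⟨C, -, hb⟩ := h.bound l
  refine ⟨C * (1 + ‖θ‖) ^ (m + (l.map (phaseOrd (n := n) δ μ)).sum), fun z => ?_⟩
  refine (hb () (z, θ)).trans (le_of_eq ?_)
  simp only [one_mul]; ring

theorem integrable_mul_phase (hF : Continuous F) {C : ℝ} {θ : Rn n}
    (h : ∀ z, ‖F (z, θ)‖ ≤ C * prodWt z) : Integrable (fun z => F (z, θ) * phase z θ) := by
  refine (integrable_prodWt.const_mul C).mono' ?_ (Filter.Eventually.of_forall fun z => ?_)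
  · have := continuous_phase (n := n)
    refine Continuous.aestronglyMeasurable (Continuous.mul (by fun_prop) ?_)
    exact this.comp (by fun_prop : Continuous fun z : Rn n => (z, θ))
  · rw [norm_mul, norm_phase, mul_one]; exact h z

theorem norm_osc_le {C : ℝ} {θ : Rn n} (h : ∀ z, ‖F (z, θ)‖ ≤ C * prodWt z) :
    ‖osc F θ‖ ≤ C * ∫ z : Rn n, prodWt z := by
  rw [← integral_const_mul]
  refine norm_integral_le_of_norm_le (integrable_prodWt.const_mul C)
    (Filter.Eventually.of_forall fun z => ?_)
  rw [norm_mul, norm_phase, mul_one]; exact h z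

theorem Amp.continuous (h : Amp δ μ m F) : Continuous F := (h.smooth ()).continuous

theorem Amp.integrable_slice (h : Amp δ μ m F) (θ : Rn n) :
    Integrable (fun z => F (z, θ) * phase z θ) := by
  obtain ⟨C, hC⟩ := h.slice [] θ
  exact integrable_mul_phase h.continuous hC

theorem inner_add_smul_single {n : ℕ} (z θ : Rn n) (t : ℝ) (j : Fin n) :
    ⟪z + t • EuclideanSpace.single j 1, θ⟫_ℝ = ⟪z, θ⟫_ℝ + t * θ j := by
  rw [inner_add_left, real_inner_smul_left, EuclideanSpace.inner_single_left, map_one, one_mul]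

theorem hasLineDerivAt_phase (z θ : Rn n) (j : Fin n) :
    HasLineDerivAt ℝ (fun z => phase z θ) (Complex.I * θ j * phase z θ) z
      (EuclideanSpace.single j 1) := by
  have h1 : HasDerivAt (fun t : ℝ => Complex.I * ((⟪z, θ⟫_ℝ + t * θ j : ℝ) : ℂ))
      (Complex.I * ((1 * θ j : ℝ) : ℂ)) 0 :=
    (((hasDerivAt_id (0 : ℝ)).mul_const (θ j)).const_add _).ofReal_comp.const_mul _
  have h2 := h1.cexp
  unfold HasLineDerivAt
  simp only [phase, inner_add_smul_single]
  refine h2.congr_deriv ?_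
  simp only [zero_mul, add_zero, one_mul]
  ring

theorem hasLineDerivAt_slice_fst (hF : ContDiff ℝ ∞ F) (z θ : Rn n) (j : Fin n) :
    HasLineDerivAt ℝ (fun z => F (z, θ)) (dirDeriv (phaseDir (Sum.inl j)) F (z, θ)) z
      (EuclideanSpace.single j 1) := by
  have h := ((hF.differentiable (by simp)) (z, θ)).lineDifferentiableAt
    (v := phaseDir (Sum.inl j)) |>.hasLineDerivAt
  unfold HasLineDerivAt at h ⊢
  simpa [phaseDir, dirDeriv] using h

theorem hasLineDerivAt_slice_snd (hF : ContDiff ℝ ∞ F) (z θ : Rn n) (j : Fin n) :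
    HasLineDerivAt ℝ (fun θ => F (z, θ)) (dirDeriv (phaseDir (Sum.inr j)) F (z, θ)) θ
      (EuclideanSpace.single j 1) := by
  have h := ((hF.differentiable (by simp)) (z, θ)).lineDifferentiableAt
    (v := phaseDir (Sum.inr j)) |>.hasLineDerivAt
  unfold HasLineDerivAt at h ⊢
  simpa [phaseDir, dirDeriv] using h

/-- Integration by parts in z. There are no boundary terms because the amplitude and its
z-derivative are integrable in z. -/
theorem osc_dirDeriv_fst (h : Amp δ μ m F) (θ : Rn n) (j : Fin n) :
    osc (dirDeriv (phaseDir (Sum.inl j)) F) θ = -(Complex.I * θ j * osc F θ) := by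
  have hd : Amp δ μ _ (dirDeriv (phaseDir (Sum.inl j)) F) := h.deriv (Sum.inl j)
  have key := integral_bilinear_hasLineDerivAt_right_eq_neg_left_of_integrable
    (μ := (volume : Measure (Rn n))) (f := fun z => F (z, θ))
    (f' := fun z => dirDeriv (phaseDir (Sum.inl j)) F (z, θ))
    (g := fun z => phase z θ) (g' := fun z => Complex.I * θ j * phase z θ)
    (v := EuclideanSpace.single j 1) (B := ContinuousLinearMap.mul ℝ ℂ)
    (by simpa using hd.integrable_slice θ)
    (by
      have := (h.integrable_slice θ).const_mul (Complex.I * θ j)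
      refine this.congr (Filter.Eventually.of_forall fun z => ?_)
      simp only [ContinuousLinearMap.mul_apply']
      ring)
    (by simpa using h.integrable_slice θ)
    (fun z _ => hasLineDerivAt_slice_fst (h.smooth ()) z θ j)
    (fun z _ => hasLineDerivAt_phase z θ j)
  simp only [ContinuousLinearMap.mul_apply'] at key
  rw [osc, ← neg_eq_iff_eq_neg, ← key, osc, ← integral_const_mul]
  congr 1
  funext z
  ring

theorem norm_osc_replicate (h : Amp δ μ m F) (θ : Rn n) (j : Fin n) (k : ℕ) :
    ‖osc (wordDeriv phaseDir (List.replicate k (Sum.inl j)) F) θ‖ = |θ j| ^ k * ‖osc F θ‖ := by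
  induction k generalizing F m with
  | zero => simp
  | succ k ih =>
    have hd : Amp δ μ _ (dirDeriv (phaseDir (Sum.inl j)) F) := h.deriv (Sum.inl j)
    rw [List.replicate_succ, wordDeriv_cons, ih hd, osc_dirDeriv_fst h]
    simp
    ring

/-! ### Decay in θ of the inner integral. -/

theorem one_add_norm_pow_le (n k : ℕ) : ∃ A : ℝ, 0 ≤ A ∧ ∀ θ : Rn n,
    (1 + ‖θ‖) ^ (k + 1) ≤ A * (1 + ∑ j, |θ j| ^ (k + 1)) := by
  refine ⟨2 ^ k * (1 + n ^ k), by positivity, fun θ => ?_⟩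
  have h1 : (1 + ‖θ‖) ^ (k + 1) ≤ 2 ^ k * (1 ^ (k + 1) + ‖θ‖ ^ (k + 1)) :=
    add_pow_le zero_le_one (norm_nonneg θ) (k + 1)
  have h2 : ‖θ‖ ≤ ∑ j, |θ j| := by
    calc ‖θ‖ = ‖∑ j, θ j • EuclideanSpace.single j (1 : ℝ)‖ := by
          congr 1; ext i; simp [Finset.sum_apply, Pi.single_apply]
      _ ≤ ∑ j, ‖θ j • EuclideanSpace.single j (1 : ℝ)‖ := norm_sum_le _ _
      _ = ∑ j, |θ j| := by simp [norm_smul]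
  have h3 : (∑ j, |θ j|) ^ (k + 1) ≤ (n : ℝ) ^ k * ∑ j, |θ j| ^ (k + 1) := by
    rcases Nat.eq_zero_or_pos n with rfl | hn
    · simp
    have := pow_sum_div_card_le_sum_pow (s := Finset.univ) (f := fun j => |θ j|)
      (fun _ _ => abs_nonneg _) k
    rwa [Finset.card_univ, Fintype.card_fin, div_le_iff₀ (by positivity), mul_comm] at this
  have h4 : 0 ≤ ∑ j, |θ j| ^ (k + 1) := by positivity
  have h5 : ‖θ‖ ^ (k + 1) ≤ (∑ j, |θ j|) ^ (k + 1) := by gcongr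
  calc _ ≤ 2 ^ k * (1 ^ (k + 1) + (n : ℝ) ^ k * ∑ j, |θ j| ^ (k + 1)) :=
        h1.trans (by gcongr; exact h5.trans h3)
    _ ≤ _ := by
      rw [mul_assoc]
      gcongr
      rw [one_pow]
      nlinarith [(by positivity : (0:ℝ) ≤ (n : ℝ) ^ k)]

/-- Multiplication by |θ_j|^(k+1) is k + 1 derivatives in z_j, at a cost of δ (k + 1) in the order.
The net gain (1 - δ)(k + 1) is as large as desired. Only powers of `L s` are lost, with an exponent
independent of `s`. -/
theorem AmpFam.osc_bound (h : AmpFam δ μ M L m Fs) (hδ : 0 ≤ δ) (hδ1 : δ < 1)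
    (hM : ∀ s, 0 ≤ M s) (hL : ∀ s, 1 ≤ L s) (K : ℕ) :
    ∃ C : ℝ, 0 ≤ C ∧ ∃ k : ℕ, ∀ s θ, (1 + ‖θ‖) ^ K * ‖osc (Fs s) θ‖ ≤ C * M s * L s ^ k := by
  -- The condition k (1 - δ) ≥ m + K says that k + 1 integrations by parts pay for the order m,
  -- their own cost δ (k + 1), and the weight of power K.
  obtain ⟨k, hk⟩ := exists_nat_ge ((m + K) / (1 - δ))
  have hk' : m + δ * (k + 1 : ℕ) + K ≤ (k + 1 : ℕ) := by
    rw [div_le_iff₀ (by linarith)] at hk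
    push_cast
    nlinarith
  obtain ⟨A, hA, hpow⟩ := one_add_norm_pow_le n k
  obtain ⟨C₀, hC₀, hb₀⟩ := h.bound []
  choose C hC hb using fun j : Fin n => h.bound (List.replicate (k + 1) (Sum.inl j))
  set W : ℝ := ∫ z : Rn n, prodWt z
  have hW : 0 ≤ W := integral_nonneg prodWt_nonneg
  refine ⟨A * (C₀ + ∑ j, C j) * W, ?_, k + 1, fun s θ => ?_⟩
  · have : 0 ≤ ∑ j, C j := Finset.sum_nonneg fun j _ => hC j
    positivity
  have hamp := h.amp hL s
  have hΛ : 1 ≤ L s * (1 + ‖θ‖) := by nlinarith [hL s, norm_nonneg θ]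
  set R : ℝ := (L s * (1 + ‖θ‖)) ^ (m + δ * (k + 1 : ℕ)) with hR
  have hR0 : 0 ≤ R := by positivity
  have hosc₀ : ‖osc (Fs s) θ‖ ≤ C₀ * M s * R * W := by
    refine norm_osc_le fun z => (hb₀ s (z, θ)).trans ?_
    have h1 : (L s * (1 + ‖θ‖)) ^ m ≤ R :=
      Real.rpow_le_rpow_of_exponent_le hΛ (by nlinarith [(Nat.cast_nonneg (k + 1) : (0:ℝ) ≤ _)])
    simp only [List.map_nil, List.sum_nil, add_zero]
    have := hM s
    have := prodWt_nonneg z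
    calc _ ≤ C₀ * (M s * prodWt z * R) := by gcongr
      _ = _ := by ring
  have hosc : ∀ j, |θ j| ^ (k + 1) * ‖osc (Fs s) θ‖ ≤ C j * M s * R * W := fun j => by
    rw [← norm_osc_replicate hamp]
    refine norm_osc_le fun z => (hb j s (z, θ)).trans (le_of_eq ?_)
    have : m + ((List.replicate (k + 1) (Sum.inl j)).map (phaseOrd (n := n) δ μ)).sum =
        m + δ * (k + 1 : ℕ) := by
      simp [phaseOrd]; ring
    rw [this, ← hR]
    ring
  have hsum : (1 + ‖θ‖) ^ (k + 1) * ‖osc (Fs s) θ‖ ≤ A * (C₀ + ∑ j, C j) * W * M s * R := by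
    calc _ ≤ A * (1 + ∑ j, |θ j| ^ (k + 1)) * ‖osc (Fs s) θ‖ := by gcongr; exact hpow θ
      _ = A * (‖osc (Fs s) θ‖ + ∑ j, |θ j| ^ (k + 1) * ‖osc (Fs s) θ‖) := by
        rw [← Finset.sum_mul]; ring
      _ ≤ A * (C₀ * M s * R * W + ∑ j, C j * M s * R * W) := by
        exact mul_le_mul_of_nonneg_left
          (add_le_add hosc₀ (Finset.sum_le_sum fun j _ => hosc j)) hA
      _ = _ := by simp only [← Finset.sum_mul]; ring
  -- After multiplication by (1 + ‖θ‖)^K the bound is at most (L (1 + ‖θ‖))^(k+1). Its θ-part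
  -- cancels the left side of `hsum`, and L^(k+1) remains.
  have hRle : R * (1 + ‖θ‖) ^ K ≤ L s ^ (k + 1) * (1 + ‖θ‖) ^ (k + 1) := by
    have hL0 : 0 ≤ L s := zero_le_one.trans (hL s)
    have h1 : (1 + ‖θ‖) ^ K ≤ (L s * (1 + ‖θ‖)) ^ K := by
      gcongr; nlinarith [hL s, norm_nonneg θ]
    calc R * (1 + ‖θ‖) ^ K ≤ R * (L s * (1 + ‖θ‖)) ^ K := by gcongr
      _ = (L s * (1 + ‖θ‖)) ^ (m + δ * (k + 1 : ℕ) + K) := by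
        rw [Real.rpow_add (by linarith), Real.rpow_natCast]
      _ ≤ (L s * (1 + ‖θ‖)) ^ ((k + 1 : ℕ) : ℝ) := Real.rpow_le_rpow_of_exponent_le hΛ hk'
      _ = _ := by rw [Real.rpow_natCast, mul_pow]
  have hpos : 0 < (1 + ‖θ‖) ^ (k + 1) := by positivity
  refine le_of_mul_le_mul_left ?_ hpos
  have hD : 0 ≤ A * (C₀ + ∑ j, C j) * W * M s := by
    have : 0 ≤ ∑ j, C j := Finset.sum_nonneg fun j _ => hC j
    have := hM s
    positivity
  calc _ = (1 + ‖θ‖) ^ K * ((1 + ‖θ‖) ^ (k + 1) * ‖osc (Fs s) θ‖) := by ring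
    _ ≤ (1 + ‖θ‖) ^ K * (A * (C₀ + ∑ j, C j) * W * M s * R) := by gcongr
    _ = A * (C₀ + ∑ j, C j) * W * M s * (R * (1 + ‖θ‖) ^ K) := by ring
    _ ≤ A * (C₀ + ∑ j, C j) * W * M s * (L s ^ (k + 1) * (1 + ‖θ‖) ^ (k + 1)) := by gcongr
    _ = _ := by ring

theorem stronglyMeasurable_osc (hF : Continuous F) : StronglyMeasurable (osc F) := by
  have hc : Continuous (fun p : Rn n × Rn n => F (p.2, p.1) * phase p.2 p.1) := by
    have := continuous_phase (n := n)
    exact (by fun_prop : Continuous fun p : Rn n × Rn n => F (p.2, p.1)).mul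
      (this.comp continuous_swap)
  exact hc.stronglyMeasurable.integral_prod_right

theorem AmpFam.osc_le_wt (h : AmpFam δ μ M L m Fs) (hδ : 0 ≤ δ) (hδ1 : δ < 1)
    (hM : ∀ s, 0 ≤ M s) (hL : ∀ s, 1 ≤ L s) :
    ∃ C : ℝ, 0 ≤ C ∧ ∃ k : ℕ, ∀ s θ, ‖osc (Fs s) θ‖ ≤ C * M s * L s ^ k * wt θ := by
  obtain ⟨C, hC, k, hb⟩ := h.osc_bound hδ hδ1 hM hL (n + 1)
  refine ⟨C, hC, k, fun s θ => ?_⟩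
  simpa using le_wt_of_decay (k := 0) (by simpa using hb s θ)

theorem Amp.integrable_osc (h : Amp δ μ m F) (hδ : 0 ≤ δ) (hδ1 : δ < 1) :
    Integrable (osc F) := by
  obtain ⟨C, -, k, hb⟩ := AmpFam.osc_le_wt h hδ hδ1 (by simp) (by simp)
  refine (integrable_wt.const_mul C).mono' (stronglyMeasurable_osc h.continuous).aestronglyMeasurable
    (Filter.Eventually.of_forall fun θ => ?_)
  simpa using hb () θ

theorem AmpFam.oscInt_bound (h : AmpFam δ μ M L m Fs) (hδ : 0 ≤ δ) (hδ1 : δ < 1)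
    (hM : ∀ s, 0 ≤ M s) (hL : ∀ s, 1 ≤ L s) :
    ∃ C : ℝ, 0 ≤ C ∧ ∃ k : ℕ, ∀ s, ‖oscInt (Fs s)‖ ≤ C * M s * L s ^ k := by
  obtain ⟨C, hC, k, hb⟩ := h.osc_le_wt hδ hδ1 hM hL
  refine ⟨C * ∫ θ : Rn n, wt θ, mul_nonneg hC (integral_nonneg wt_nonneg), k, fun s => ?_⟩
  have := norm_integral_le_of_norm_le (integrable_wt.const_mul _)
    (Filter.Eventually.of_forall (hb s))
  rw [integral_const_mul] at this
  exact this.trans (le_of_eq (by ring))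

end

/-! ### Integration by parts in the frequency variable -/

section

variable {n : ℕ}

/-- The function `(1 + i t zⱼ)^{-k}` of `(z, θ)`. -/
noncomputable def res (t : ℝ) (j : Fin n) (k : ℕ) (v : Rn n × Rn n) : ℂ :=
  (1 + Complex.I * ((t * v.1 j : ℝ) : ℂ))⁻¹ ^ k

theorem one_add_I_mul_ne_zero (x : ℝ) : (1 + Complex.I * (x : ℂ)) ≠ 0 := by
  intro h
  simpa using congrArg Complex.re h

theorem contDiff_res (t : ℝ) (j : Fin n) (k : ℕ) : ContDiff ℝ ∞ (res t j k) := by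
  refine ContDiff.pow (ContDiff.inv ?_ fun v => one_add_I_mul_ne_zero _) k
  refine contDiff_const.add (contDiff_const.mul (Complex.ofRealCLM.contDiff.comp ?_))
  exact contDiff_const.mul ((EuclideanSpace.proj (𝕜 := ℝ) j).contDiff.comp contDiff_fst)

theorem dirDeriv_res_inl (t : ℝ) (i j : Fin n) (k : ℕ) :
    dirDeriv (phaseDir (Sum.inl i)) (res t j k) =
      (if i = j then -(k * Complex.I * t) else 0 : ℂ) • res t j (k + 1) := by
  funext v
  refine HasLineDerivAt.lineDeriv ?_
  set δ : ℝ := if i = j then 1 else 0 with hδ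
  have h0 : HasDerivAt (fun s : ℝ => 1 + Complex.I * ((t * (v.1 j + s * δ) : ℝ) : ℂ))
      (Complex.I * ((t * (1 * δ) : ℝ) : ℂ)) 0 :=
    (((((hasDerivAt_id (0 : ℝ)).mul_const δ).const_add (v.1 j)).const_mul t).ofReal_comp.const_mul
      Complex.I).const_add 1
  have h1 := (h0.inv (one_add_I_mul_ne_zero _)).pow k
  have h2 : (fun s : ℝ => res t j k (v + s • phaseDir (Sum.inl i))) =
      fun s : ℝ => (1 + Complex.I * ((t * (v.1 j + s * δ) : ℝ) : ℂ))⁻¹ ^ k := by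
    funext s
    have : (v + s • phaseDir (Sum.inl i)).1 j = v.1 j + s * δ := by
      simp [phaseDir, hδ, eq_comm]
    rw [res, this]
  unfold HasLineDerivAt
  rw [h2]
  refine h1.congr_deriv ?_
  simp only [zero_mul, add_zero, one_mul, Pi.smul_apply, smul_eq_mul, res]
  rcases k with _ | k
  · simp
  · rw [hδ]
    split_ifs
    · simp only [Nat.add_sub_cancel, pow_succ, Pi.inv_apply, div_eq_mul_inv, mul_inv]
      push_cast
      simp only [add_zero, mul_one]
      ring
    · simp

theorem dirDeriv_res_inr (t : ℝ) (i j : Fin n) (k : ℕ) :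
    dirDeriv (phaseDir (Sum.inr i)) (res t j k) = 0 := by
  funext v
  have : (fun s : ℝ => res t j k (v + s • phaseDir (Sum.inr i))) = fun _ => res t j k v := by
    funext s; simp [res, phaseDir]
  simp [dirDeriv, lineDeriv, this]

/-- Each z_j-derivative gives a multiple of a higher power of the same function, and all other
derivatives vanish. The decay in z_j is therefore never lost. -/
theorem wordDeriv_res (t : ℝ) (j : Fin n) (k : ℕ) (l : List (Fin n ⊕ Fin n)) :
    ∃ (c : ℂ) (k' : ℕ), k ≤ k' ∧ wordDeriv phaseDir l (res t j k) = c • res t j k' := by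
  induction l generalizing k with
  | nil => exact ⟨1, k, le_rfl, by simp⟩
  | cons i l ih =>
    rcases i with i | i
    · obtain ⟨c, k', hk, h⟩ := ih (k + 1)
      refine ⟨(if i = j then -(k * Complex.I * t) else 0 : ℂ) * c, k', by omega, ?_⟩
      rw [wordDeriv_cons, dirDeriv_res_inl, wordDeriv_const_smul _ _ (contDiff_res _ _ _), h,
        smul_smul]
    · refine ⟨0, k, le_rfl, ?_⟩
      rw [wordDeriv_cons, dirDeriv_res_inr, wordDeriv_zero_fun, zero_smul]

theorem norm_res_sq (t : ℝ) (j : Fin n) (v : Rn n × Rn n) :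
    ‖res t j 2 v‖ = (1 + t ^ 2 * v.1 j ^ 2)⁻¹ := by
  rw [res, norm_pow, norm_inv, inv_pow, ← Complex.normSq_eq_norm_sq, Complex.normSq_apply]
  simp
  ring

theorem norm_inv_one_add_le (x : ℝ) : ‖(1 + Complex.I * (x : ℂ))⁻¹‖ ≤ 1 := by
  rw [norm_inv]
  refine inv_le_one_of_one_le₀ ?_
  refine le_trans ?_ (Complex.abs_re_le_norm _)
  simp

theorem norm_res_le_one (t : ℝ) (j : Fin n) (k : ℕ) (v : Rn n × Rn n) : ‖res t j k v‖ ≤ 1 := by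
  rw [res, norm_pow]
  exact pow_le_one₀ (norm_nonneg _) (norm_inv_one_add_le _)

theorem norm_res_le {t : ℝ} (ht : 0 < t) (j : Fin n) {k : ℕ} (hk : 2 ≤ k) (v : Rn n × Rn n) :
    ‖res t j k v‖ ≤ (1 + (t ^ 2)⁻¹) * (1 + v.1 j ^ 2)⁻¹ := by
  obtain ⟨i, rfl⟩ := Nat.exists_eq_add_of_le hk
  have h1 : ‖res t j (2 + i) v‖ ≤ ‖res t j 2 v‖ := by
    have : res t j (2 + i) v = res t j 2 v * res t j i v := by simp only [res, pow_add]
    rw [this, norm_mul]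
    exact mul_le_of_le_one_right (norm_nonneg _) (norm_res_le_one _ _ _ _)
  refine h1.trans ?_
  rw [norm_res_sq, ← div_eq_mul_inv, inv_le_iff_one_le_mul₀ (by positivity),
    div_mul_eq_mul_div, le_div_iff₀ (by positivity)]
  have : (t ^ 2)⁻¹ * (t ^ 2) = 1 := inv_mul_cancel₀ (by positivity)
  have h3 : 0 ≤ (t ^ 2)⁻¹ := by positivity
  have h4 : 0 ≤ t ^ 2 * v.1 j ^ 2 := by positivity
  have h5 : (1 + (t ^ 2)⁻¹) * (1 + t ^ 2 * v.1 j ^ 2) =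
    1 + (t ^ 2)⁻¹ + t ^ 2 * v.1 j ^ 2 + ((t ^ 2)⁻¹ * t ^ 2) * v.1 j ^ 2 := by ring
  rw [h5, this]
  linarith

/-- With κ ≥ 0 and Λ ≥ 1 the allowed growth only helps, so functions whose derivatives share one
bound `N` have order 0. It serves for windows, Schwartz translates and modulations. -/
theorem symFam_of_bounded {P V ι : Type*} [NormedAddCommGroup V] [NormedSpace ℝ V] {d : ι → V}
    {κ : ι → ℝ} {N Λ : P → V → ℝ} {F : P → V → ℂ} (hκ : ∀ i, 0 ≤ κ i) (hN : ∀ s v, 0 ≤ N s v)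
    (hΛ : ∀ s v, 1 ≤ Λ s v) (hF : ∀ s, ContDiff ℝ ∞ (F s))
    (h : ∀ l, ∃ C, 0 ≤ C ∧ ∀ s v, ‖wordDeriv d l (F s) v‖ ≤ C * N s v) :
    SymFam d κ N Λ 0 F where
  smooth := hF
  bound l := by
    obtain ⟨C, hC, hb⟩ := h l
    refine ⟨C, hC, fun s v => (hb s v).trans ?_⟩
    have : 1 ≤ Λ s v ^ (0 + (l.map κ).sum) := by
      refine Real.one_le_rpow (hΛ s v) ?_
      rw [zero_add]
      exact List.sum_nonneg (by simpa using fun i _ => hκ i)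
    exact mul_le_mul_of_nonneg_left (le_mul_of_one_le_right (hN s v) this) hC

theorem phaseOrd_nonneg {δ μ : ℝ} (hδ : 0 ≤ δ) (hμ : 0 ≤ μ) (i : Fin n ⊕ Fin n) :
    0 ≤ phaseOrd δ μ i := by
  rcases i with i | i <;> assumption

variable {P : Type*} {δ μ m : ℝ} {N Λ : P → Rn n × Rn n → ℝ} {F G : Rn n × Rn n → ℂ}

theorem symFam_res (hδ : 0 ≤ δ) (hμ : 0 ≤ μ) (hΛ : ∀ s v, 1 ≤ Λ s v) (t : ℝ) (j : Fin n)
    (k : ℕ) : SymFam phaseDir (phaseOrd δ μ) (fun _ _ => 1) Λ 0 (fun _ => res t j k) := by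
  refine symFam_of_bounded (phaseOrd_nonneg hδ hμ) (by simp) hΛ
    (fun _ => contDiff_res _ _ _) fun l => ?_
  obtain ⟨c, k', -, h⟩ := wordDeriv_res t j k l
  refine ⟨‖c‖, norm_nonneg _, fun _ v => ?_⟩
  rw [h, Pi.smul_apply, norm_smul]
  exact mul_le_mul_of_nonneg_left (norm_res_le_one _ _ _ _) (norm_nonneg _)

theorem symFam_res_two (hδ : 0 ≤ δ) (hμ : 0 ≤ μ) (hΛ : ∀ s v, 1 ≤ Λ s v) {t : ℝ} (ht : 0 < t)
    (j : Fin n) :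
    SymFam phaseDir (phaseOrd δ μ) (fun _ v => (1 + v.1 j ^ 2)⁻¹) Λ 0 (fun _ => res t j 2) := by
  refine symFam_of_bounded (phaseOrd_nonneg hδ hμ) (fun _ v => by positivity) hΛ
    (fun _ => contDiff_res _ _ _) fun l => ?_
  obtain ⟨c, k', hk, h⟩ := wordDeriv_res t j 2 l
  refine ⟨‖c‖ * (1 + (t ^ 2)⁻¹), by positivity, fun _ v => ?_⟩
  rw [h, Pi.smul_apply, norm_smul, mul_assoc]
  exact mul_le_mul_of_nonneg_left (norm_res_le ht _ hk _) (norm_nonneg _)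

/-! ### The first-order operators dual to the windows. -/

/-- The operator `1 - t ∂_{θⱼ}`, for a family of directions `e`. -/
noncomputable def stepOp {V : Type*} [NormedAddCommGroup V] [NormedSpace ℝ V] (e : Fin n → V)
    (t : ℝ) (j : Fin n) (F : V → ℂ) : V → ℂ := F + (-t : ℂ) • dirDeriv (e j) F

/-- The operator `∏_{j ∈ L} (1 - t ∂_{θⱼ})`. -/
noncomputable def prodOp {V : Type*} [NormedAddCommGroup V] [NormedSpace ℝ V] (e : Fin n → V)
    (t : ℝ) : List (Fin n) → (V → ℂ) → V → ℂ
  | [], F => F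
  | j :: L, F => prodOp e t L (stepOp e t j F)

section prodOp

variable {V : Type*} [NormedAddCommGroup V] [NormedSpace ℝ V] {e : Fin n → V}

theorem contDiff_stepOp {F : V → ℂ} (hF : ContDiff ℝ ∞ F) (t : ℝ) (j : Fin n) :
    ContDiff ℝ ∞ (stepOp e t j F) :=
  smooth_add hF (smooth_const_smul (contDiff_dirDeriv hF _) _)

theorem contDiff_prodOp {F : V → ℂ} (hF : ContDiff ℝ ∞ F) (t : ℝ) (L : List (Fin n)) :
    ContDiff ℝ ∞ (prodOp e t L F) := by
  induction L generalizing F with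
  | nil => exact hF
  | cons j L ih => exact ih (contDiff_stepOp hF t j)

theorem dirDeriv_stepOp {F : V → ℂ} (hF : ContDiff ℝ ∞ F) (t : ℝ) (j : Fin n) (v : V) :
    dirDeriv v (stepOp e t j F) = stepOp e t j (dirDeriv v F) := by
  rw [stepOp, dirDeriv_add hF (smooth_const_smul (contDiff_dirDeriv hF _) _),
    dirDeriv_const_smul (contDiff_dirDeriv hF _), dirDeriv_comm hF, stepOp]

theorem dirDeriv_prodOp {F : V → ℂ} (hF : ContDiff ℝ ∞ F) (t : ℝ) (L : List (Fin n)) (v : V) :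
    dirDeriv v (prodOp e t L F) = prodOp e t L (dirDeriv v F) := by
  induction L generalizing F with
  | nil => rfl
  | cons j L ih => rw [prodOp, ih (contDiff_stepOp hF t j), dirDeriv_stepOp hF, prodOp]

theorem stepOp_comm {F : V → ℂ} (hF : ContDiff ℝ ∞ F) (s t : ℝ) (i j : Fin n) :
    stepOp e s i (stepOp e t j F) = stepOp e t j (stepOp e s i F) := by
  rw [stepOp, dirDeriv_stepOp hF]
  conv_rhs => rw [stepOp, dirDeriv_stepOp hF]
  simp only [stepOp, dirDeriv_comm hF (e i) (e j)]
  module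

theorem stepOp_prodOp {F : V → ℂ} (hF : ContDiff ℝ ∞ F) (s t : ℝ) (i : Fin n)
    (L : List (Fin n)) :
    stepOp e s i (prodOp e t L F) = prodOp e t L (stepOp e s i F) := by
  induction L generalizing F with
  | nil => rfl
  | cons j L ih => rw [prodOp, ih (contDiff_stepOp hF t j), stepOp_comm hF, prodOp]

theorem prodOp_comm {F : V → ℂ} (hF : ContDiff ℝ ∞ F) (s t : ℝ) (L L' : List (Fin n)) :
    prodOp e s L (prodOp e t L' F) = prodOp e t L' (prodOp e s L F) := by
  induction L generalizing F with
  | nil => rfl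
  | cons j L ih =>
    rw [prodOp, stepOp_prodOp hF, ih (contDiff_stepOp hF s j), prodOp]

theorem prodOp_mul {w F : V → ℂ} (hw : ContDiff ℝ ∞ w) (hw' : ∀ j, dirDeriv (e j) w = 0)
    (hF : ContDiff ℝ ∞ F) (t : ℝ) (L : List (Fin n)) :
    prodOp e t L (w * F) = w * prodOp e t L F := by
  induction L generalizing F with
  | nil => rfl
  | cons j L ih =>
    rw [prodOp, prodOp, ← ih (contDiff_stepOp hF t j)]
    congr 1
    rw [stepOp, stepOp, dirDeriv_mul hw hF, hw', zero_mul, zero_add, mul_add, mul_smul_comm]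

/-- The chain rule turns `t` into `t * s`. With s = t it accounts for rescaling, and with s = 1 it
moves the operator from θ to the variable ξ of the symbol. -/
theorem prodOp_comp_affine {U : Type*} [NormedAddCommGroup U] [NormedSpace ℝ U] {F : V → ℂ}
    (hF : ContDiff ℝ ∞ F) (p : V) (A : U →L[ℝ] V) {e' : Fin n → U} {s t : ℝ}
    (hA : ∀ j, A (e' j) = s • e j) (L : List (Fin n)) :
    prodOp e' t L (fun x => F (p + A x)) = fun x => prodOp e (t * s) L F (p + A x) := by
  induction L generalizing F with
  | nil => rfl
  | cons j L ih =>
    rw [prodOp, prodOp, ← ih (contDiff_stepOp hF _ j)]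
    congr 1
    rw [stepOp, dirDeriv_comp_affine hF, hA, dirDeriv_smul_left hF]
    funext x
    simp only [stepOp, Pi.add_apply, Pi.smul_apply, smul_eq_mul]
    push_cast
    ring

end prodOp

theorem SymFam.prodOp {P V ι : Type*} [NormedAddCommGroup V] [NormedSpace ℝ V] {d : ι → V}
    {κ : ι → ℝ} {N Λ : P → V → ℝ} {m : ℝ} {F : P → V → ℂ} (h : SymFam d κ N Λ m F)
    (hN : ∀ s v, 0 ≤ N s v) (hΛ : ∀ s v, 1 ≤ Λ s v) {g : Fin n → ι} {μ : ℝ} (hμ : 0 ≤ μ)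
    (hg : ∀ j, κ (g j) ≤ μ) (t : ℝ) (L : List (Fin n)) :
    SymFam d κ N Λ (m + L.length * μ) (fun s => prodOp (fun j => d (g j)) t L (F s)) := by
  induction L generalizing F m with
  | nil => simpa [BilinearPDO.prodOp] using h
  | cons j L ih =>
    have h1 : SymFam d κ N Λ (m + μ) (fun s => stepOp (fun j => d (g j)) t j (F s)) :=
      (h.mono_order hN hΛ (by linarith)).add
        (((h.deriv (g j)).mono_order hN hΛ (by linarith [hg j])).const_smul _)
    have e : m + ((j :: L).length : ℝ) * μ = m + μ + L.length * μ := by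
      rw [List.length_cons]; push_cast; ring
    rw [e]
    exact ih h1

/-- The directions `∂_{θⱼ}` in `(z, θ)`. -/
noncomputable abbrev freqDir (j : Fin n) : Rn n × Rn n := phaseDir (Sum.inr j)

theorem Amp.add (hF : Amp δ μ m F) (hG : Amp δ μ m G) : Amp δ μ m (F + G) := SymFam.add hF hG

theorem Amp.const_smul (hF : Amp δ μ m F) (c : ℂ) : Amp δ μ m (c • F) := SymFam.const_smul hF c

theorem Amp.mono {m' : ℝ} (hF : Amp δ μ m F) (h : m ≤ m') : Amp δ μ m' F :=
  SymFam.mono_order hF (fun _ v => by simpa using prodWt_nonneg v.1) (fun _ v => by simp) h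

theorem Amp.res_mul (hδ : 0 ≤ δ) (hμ : 0 ≤ μ) (hF : Amp δ μ m F) (t : ℝ) (j : Fin n) (k : ℕ) :
    Amp δ μ m (res t j k * F) := by
  have h := SymFam.mul (symFam_res (P := Unit) hδ hμ (Λ := fun _ v => 1 * (1 + ‖v.2‖))
    (fun _ v => by simp) t j k) hF (fun _ v => by positivity)
  simpa [Amp, AmpFam] using h

theorem Amp.freqDeriv (hF : Amp δ μ m F) (j : Fin n) :
    Amp δ μ (m + μ) (dirDeriv (freqDir j) F) := SymFam.deriv hF (Sum.inr j)

theorem osc_add (hF : Amp δ μ m F) (hG : Amp δ μ m G) (θ : Rn n) :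
    osc (F + G) θ = osc F θ + osc G θ := by
  rw [osc, osc, osc, ← integral_add (hF.integrable_slice θ) (hG.integrable_slice θ)]
  simp only [Pi.add_apply, add_mul]

theorem osc_const_smul (c : ℂ) (θ : Rn n) : osc (c • F) θ = c * osc F θ := by
  rw [osc, osc, ← integral_const_mul]
  simp only [Pi.smul_apply, smul_eq_mul, mul_assoc]

theorem oscInt_add (hδ : 0 ≤ δ) (hδ1 : δ < 1) (hF : Amp δ μ m F) (hG : Amp δ μ m G) :
    oscInt (F + G) = oscInt F + oscInt G := by
  rw [oscInt, oscInt, oscInt, ← integral_add (hF.integrable_osc hδ hδ1) (hG.integrable_osc hδ hδ1)]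
  simp only [osc_add hF hG]

theorem oscInt_const_smul (c : ℂ) : oscInt (c • F) = c * oscInt F := by
  rw [oscInt, oscInt, ← integral_const_mul]
  simp only [osc_const_smul]

theorem hasDerivAt_line {V : Type*} [NormedAddCommGroup V] [NormedSpace ℝ V] {f : V → ℂ}
    {x v : V} {s : ℝ} {f' : ℂ} (h : HasLineDerivAt ℝ f f' (x + s • v) v) :
    HasDerivAt (fun t : ℝ => f (x + t • v)) f' s := by
  unfold HasLineDerivAt at h
  rw [← sub_self s] at h
  refine (h.comp_sub_const s s).congr_of_eventuallyEq (Filter.Eventually.of_forall fun t => ?_)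
  simp only [sub_smul]
  congr 1
  abel

/-! ### Integration by parts in θ. -/

/-- Differentiating the phase brings down i z_j, which could destroy integrability in z. The product
i z_j G is therefore supplied as an amplitude `Y` of its own; dominated convergence then needs only
the bound for `D` on a unit interval. -/
theorem hasLineDerivAt_osc (hG : Amp δ μ m G) {Y : Rn n × Rn n → ℂ} {m' : ℝ}
    (hY : Amp δ μ m' Y) (j : Fin n) (hYG : ∀ v, Y v = Complex.I * v.1 j * G v) (θ : Rn n) :
    HasLineDerivAt ℝ (osc G) (osc (dirDeriv (freqDir j) G + Y) θ) θ
      (EuclideanSpace.single j 1) := by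
  set e : Rn n := EuclideanSpace.single j 1 with he
  have hD : Amp δ μ (max (m + μ) m') (dirDeriv (freqDir j) G + Y) :=
    ((hG.freqDeriv j).mono (le_max_left _ _)).add (hY.mono (le_max_right _ _))
  set D := dirDeriv (freqDir j) G + Y with hDdef
  obtain ⟨C, hC, hb⟩ := hD.bound []
  set r := max (m + μ) m'
  have hbound : ∀ᵐ z : Rn n, ∀ s ∈ Metric.ball (0 : ℝ) 1,
      ‖D (z, θ + s • e) * phase z (θ + s • e)‖ ≤ C * (2 + ‖θ‖) ^ |r| * prodWt z := by
    refine Filter.Eventually.of_forall fun z s hs => ?_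
    rw [norm_mul, norm_phase, mul_one]
    refine (hb () (z, θ + s • e)).trans ?_
    have h1 : ‖θ + s • e‖ ≤ ‖θ‖ + 1 := by
      refine (norm_add_le _ _).trans ?_
      rw [norm_smul, he, PiLp.norm_single, norm_one, mul_one]
      have : ‖s‖ < 1 := by simpa using hs
      linarith
    have h2 : (1 * (1 + ‖θ + s • e‖)) ^ (r + ((([] : List (Fin n ⊕ Fin n))).map (phaseOrd δ μ)).sum)
        ≤ (2 + ‖θ‖) ^ |r| := by
      simp only [one_mul, List.map_nil, List.sum_nil, add_zero]
      calc _ ≤ (1 + ‖θ + s • e‖) ^ |r| :=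
            Real.rpow_le_rpow_of_exponent_le (by simp) (le_abs_self r)
        _ ≤ _ := Real.rpow_le_rpow (by positivity) (by linarith) (abs_nonneg r)
    have := prodWt_nonneg z
    calc _ ≤ C * (1 * prodWt z * (2 + ‖θ‖) ^ |r|) := by gcongr
      _ = _ := by ring
  have hdiff : ∀ᵐ z : Rn n, ∀ s ∈ Metric.ball (0 : ℝ) 1,
      HasDerivAt (fun s : ℝ => G (z, θ + s • e) * phase z (θ + s • e))
        (D (z, θ + s • e) * phase z (θ + s • e)) s := by
    refine Filter.Eventually.of_forall fun z s _ => ?_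
    have h1 := hasDerivAt_line (f := fun θ => G (z, θ))
      (hasLineDerivAt_slice_snd (hG.smooth ()) z (θ + s • e) j)
    have h2 := hasDerivAt_line (f := fun θ => phase θ z) (hasLineDerivAt_phase (θ + s • e) z j)
    simp only [phase_comm _ z] at h2
    refine (h1.mul h2).congr_deriv ?_
    rw [hDdef, Pi.add_apply, hYG]
    ring
  have hcont : ∀ (F : Rn n × Rn n → ℂ), Continuous F → ∀ θ', AEStronglyMeasurable
      (fun z => F (z, θ') * phase z θ') volume := fun F hF θ' => by
    refine Continuous.aestronglyMeasurable (Continuous.mul (by fun_prop) ?_)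
    exact continuous_phase.comp (by fun_prop : Continuous fun z : Rn n => (z, θ'))
  have key := (hasDerivAt_integral_of_dominated_loc_of_deriv_le
    (F := fun (s : ℝ) z => G (z, θ + s • e) * phase z (θ + s • e))
    (F' := fun (s : ℝ) z => D (z, θ + s • e) * phase z (θ + s • e))
    (x₀ := (0 : ℝ)) (Metric.ball_mem_nhds 0 one_pos)
    (Filter.Eventually.of_forall fun s => hcont G hG.continuous _)
    (by simpa using hG.integrable_slice θ) (hcont D hD.continuous _) hbound
    (integrable_prodWt.const_mul _) hdiff).2
  simpa [HasLineDerivAt, osc] using key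

/-- Integration by parts against the constant 1. -/
theorem integral_eq_zero_of_hasLineDerivAt {f f' : Rn n → ℂ} {v : Rn n} (hf : Integrable f)
    (hf' : Integrable f') (h : ∀ x, HasLineDerivAt ℝ f (f' x) x v) : ∫ x, f' x = 0 := by
  have key := integral_bilinear_hasLineDerivAt_right_eq_neg_left_of_integrable
    (μ := (volume : Measure (Rn n))) (f := fun _ => (1 : ℂ)) (f' := fun _ => (0 : ℂ)) (g := f)
    (g' := f') (v := v) (B := ContinuousLinearMap.mul ℝ ℂ) (by simp) (by simpa using hf')
    (by simpa using hf) (fun x _ => by simpa [HasLineDerivAt] using hasDerivAt_const (0 : ℝ) (1 : ℂ))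
    (fun x _ => h x)
  simpa using key

/-- Let G = (1 + i t z_j)^{-1} F. The θ_j-derivative of `osc G` has integral zero, so i z_j G and
-∂_{θ_j} G have the same oscillatory integral. Insert this into F = G + t (i z_j G). -/
theorem oscInt_step (hδ : 0 ≤ δ) (hδ1 : δ < 1) (hμ : 0 ≤ μ) (hF : Amp δ μ m F) {t : ℝ}
    (ht : 0 < t) (j : Fin n) :
    oscInt F = oscInt (res t j 1 * stepOp freqDir t j F) := by
  set G := res t j 1 * F with hGdef
  have hG : Amp δ μ m G := hF.res_mul hδ hμ t j 1
  -- This is i z_j G. In the form t⁻¹ (F - G) it is visibly an amplitude of the same order, with no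
  -- loss from the factor z_j.
  set Y := (t : ℂ)⁻¹ • (F + (-1 : ℂ) • G) with hYdef
  have hY : Amp δ μ m Y := (hF.add (hG.const_smul _)).const_smul _
  have htc : (t : ℂ) ≠ 0 := by exact_mod_cast ht.ne'
  have hYG : ∀ v, Y v = Complex.I * v.1 j * G v := fun v => by
    have h1 := mul_inv_cancel₀ (one_add_I_mul_ne_zero (t * v.1 j))
    have h2 := mul_inv_cancel₀ htc
    simp only [hYdef, hGdef, Pi.smul_apply, Pi.add_apply, Pi.mul_apply, smul_eq_mul, res, pow_one]
    set R := (1 + Complex.I * ((t * v.1 j : ℝ) : ℂ))⁻¹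
    push_cast at h1
    linear_combination -(t : ℂ)⁻¹ * F v * h1 + Complex.I * v.1 j * R * F v * h2
  have hF' : F = G + (t : ℂ) • Y := by
    rw [hYdef, smul_smul, mul_inv_cancel₀ htc]; module
  have hdG : dirDeriv (freqDir j) G = res t j 1 * dirDeriv (freqDir j) F := by
    rw [hGdef, dirDeriv_mul (contDiff_res _ _ _) (hF.smooth ()), dirDeriv_res_inr, zero_mul,
      zero_add]
  have hstep : res t j 1 * stepOp freqDir t j F = G + (-t : ℂ) • dirDeriv (freqDir j) G := by
    rw [stepOp, mul_add, mul_smul_comm, ← hdG]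
  have hdGA := hG.freqDeriv j
  have hzero : oscInt (dirDeriv (freqDir j) G + Y) = 0 :=
    integral_eq_zero_of_hasLineDerivAt (hG.integrable_osc hδ hδ1)
      ((hdGA.add (hY.mono (by linarith))).integrable_osc hδ hδ1) (hasLineDerivAt_osc hG hY j hYG)
  rw [oscInt_add hδ hδ1 hdGA (hY.mono (by linarith))] at hzero
  rw [hstep, oscInt_add hδ hδ1 (hG.mono (by linarith)) (hdGA.const_smul _), oscInt_const_smul]
  conv_lhs => rw [hF', oscInt_add hδ hδ1 hG (hY.const_smul _), oscInt_const_smul]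
  linear_combination (t : ℂ) * hzero

/-! ### Windows and the regularized integral. -/

/-- The window `∏_{j ∈ L} (1 + i t zⱼ)^{-1}`. -/
noncomputable def resProd (t : ℝ) : List (Fin n) → Rn n × Rn n → ℂ
  | [] => 1
  | j :: L => res t j 1 * resProd t L

theorem contDiff_resProd (t : ℝ) (L : List (Fin n)) : ContDiff ℝ ∞ (resProd t L) := by
  induction L with
  | nil => exact contDiff_const
  | cons j L ih => exact smooth_mul (contDiff_res t j 1) ih

theorem dirDeriv_resProd (t : ℝ) (L : List (Fin n)) (i : Fin n) :
    dirDeriv (freqDir i) (resProd t L) = 0 := by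
  induction L with
  | nil =>
    funext v
    simp [dirDeriv, lineDeriv, resProd]
  | cons j L ih =>
    rw [resProd, dirDeriv_mul (contDiff_res t j 1) (contDiff_resProd t L), ih, dirDeriv_res_inr]
    simp

theorem Amp.prodOp (hμ : 0 ≤ μ) (hF : Amp δ μ m F) (t : ℝ) (L : List (Fin n)) :
    Amp δ μ (m + L.length * μ) (prodOp freqDir t L F) :=
  SymFam.prodOp hF (fun _ v => by simpa using prodWt_nonneg v.1) (fun _ v => by simp) hμ
    (fun _ => le_rfl) t L

/-- Iterate the single step. The windows do not depend on θ, so the remaining operators pass through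
them. -/
theorem oscInt_prodOp (hδ : 0 ≤ δ) (hδ1 : δ < 1) (hμ : 0 ≤ μ) (hF : Amp δ μ m F) {t : ℝ}
    (ht : 0 < t) (L : List (Fin n)) :
    oscInt F = oscInt (resProd t L * prodOp freqDir t L F) := by
  induction L generalizing F m with
  | nil => simp [resProd, BilinearPDO.prodOp]
  | cons j L ih =>
    have h1 : Amp δ μ (m + ([j] : List (Fin n)).length * μ) (stepOp freqDir t j F) :=
      hF.prodOp hμ t [j]
    rw [oscInt_step hδ hδ1 hμ hF ht j, ih (h1.res_mul hδ hμ t j 1),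
      prodOp_mul (contDiff_res _ _ _) (fun i => dirDeriv_res_inr t i j 1) (h1.smooth ()),
      BilinearPDO.prodOp, resProd]
    congr 1
    ring

/-- The list in which each index occurs twice. -/
def doubleList (n : ℕ) : List (Fin n) := (List.finRange n).flatMap fun j => [j, j]

/-- The window `∏ⱼ (1 + i t zⱼ)^{-2}`. -/
noncomputable def window (t : ℝ) : Rn n × Rn n → ℂ := resProd t (doubleList n)

/-- |(1 + i t z_j)^{-2}| = (1 + t² z_j²)^{-1} is integrable in z_j, which the first power is not;
this is why each index is doubled. Derivatives do not spoil the decay, so the order is 0. -/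
theorem symFam_window (hδ : 0 ≤ δ) (hμ : 0 ≤ μ) (hΛ : ∀ s v, 1 ≤ Λ s v) {t : ℝ} (ht : 0 < t) :
    SymFam phaseDir (phaseOrd δ μ) (fun (_ : P) v => prodWt v.1) Λ 0
      (fun _ => (window t : Rn n × Rn n → ℂ)) := by
  have h : ∀ L : List (Fin n), SymFam phaseDir (phaseOrd δ μ)
      (fun (_ : P) v => (L.map fun j => (1 + v.1 j ^ 2)⁻¹).prod) Λ 0
      (fun _ => resProd t (L.flatMap fun j => [j, j])) := fun L => by
    induction L with
    | nil =>
      refine symFam_of_bounded (phaseOrd_nonneg hδ hμ) (by simp) hΛ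
        (fun _ => contDiff_const) fun l => ?_
      rcases l with _ | ⟨i, l⟩
      · exact ⟨1, zero_le_one, fun _ v => by simp [resProd]⟩
      · refine ⟨0, le_rfl, fun _ v => ?_⟩
        have : dirDeriv (phaseDir i) (resProd t ([] : List (Fin n))) = 0 := by
          funext v; simp [dirDeriv, lineDeriv, resProd]
        simp [this, wordDeriv_zero_fun]
    | cons j L ih =>
      have h1 := (symFam_res_two hδ hμ hΛ ht j).mul ih (fun s v => by linarith [hΛ s v])
      have h2 : ∀ j : Fin n, res t j 2 = res t j 1 * res t j 1 := fun j => by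
        funext v; simp [res, sq]
      simpa [List.flatMap_cons, resProd, h2, mul_assoc] using h1
  have h1 := h (List.finRange n)
  have h2 : ∀ v : Rn n × Rn n, ((List.finRange n).map fun j => (1 + v.1 j ^ 2)⁻¹).prod =
      prodWt v.1 := fun v => by
    rw [prodWt, ← List.ofFn_eq_map, List.prod_ofFn]
  simp only [h2] at h1
  exact h1

/-- The regularized oscillatory integral `∫∫ b(z, θ) e^{i z·θ} dz dθ`. -/
noncomputable def regInt (t : ℝ) (b : Rn n × Rn n → ℂ) : ℂ :=
  oscInt (window t * prodOp freqDir t (doubleList n) b)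

theorem SymFam.window_mul {M L : P → ℝ} {b : P → Rn n × Rn n → ℂ} (hδ : 0 ≤ δ) (hμ : 0 ≤ μ)
    (hL : ∀ s, 1 ≤ L s)
    (hb : SymFam phaseDir (phaseOrd δ μ) (fun s _ => M s) (fun s v => L s * (1 + ‖v.2‖)) m b)
    {t : ℝ} (ht : 0 < t) : AmpFam δ μ M L m (fun s => window t * b s) := by
  have hΛ : ∀ s (v : Rn n × Rn n), 1 ≤ L s * (1 + ‖v.2‖) := fun s v => by
    nlinarith [hL s, norm_nonneg v.2]
  have h := (symFam_window hδ hμ hΛ ht).mul hb (fun s v => by linarith [hΛ s v])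
  simpa [mul_comm] using h

theorem SymFam.window_prodOp {M L : P → ℝ} {b : P → Rn n × Rn n → ℂ} (hδ : 0 ≤ δ) (hμ : 0 ≤ μ)
    (hM : ∀ s, 0 ≤ M s) (hL : ∀ s, 1 ≤ L s)
    (hb : SymFam phaseDir (phaseOrd δ μ) (fun s _ => M s) (fun s v => L s * (1 + ‖v.2‖)) m b)
    {t : ℝ} (ht : 0 < t) (s : ℝ) : AmpFam δ μ M L (m + (doubleList n).length * μ)
      (fun x => window t * BilinearPDO.prodOp freqDir s (doubleList n) (b x)) := by
  have hΛ : ∀ s (v : Rn n × Rn n), 1 ≤ L s * (1 + ‖v.2‖) := fun s v => by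
    nlinarith [hL s, norm_nonneg v.2]
  exact SymFam.window_mul hδ hμ hL
    (hb.prodOp (fun s _ => hM s) hΛ hμ (fun _ => le_rfl) s (doubleList n)) ht

/-- Regularize each side once more with the other parameter. The operators commute with each other
and with the windows, so both sides become the same doubly regularized integral. -/
theorem SymFam.regInt_eq {M L : P → ℝ} {b : P → Rn n × Rn n → ℂ} (hδ : 0 ≤ δ) (hδ1 : δ < 1)
    (hμ : 0 ≤ μ) (hM : ∀ s, 0 ≤ M s) (hL : ∀ s, 1 ≤ L s)
    (hb : SymFam phaseDir (phaseOrd δ μ) (fun s _ => M s) (fun s v => L s * (1 + ‖v.2‖)) m b)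
    (x : P) {s t : ℝ} (hs : 0 < s) (ht : 0 < t) : regInt s (b x) = regInt t (b x) := by
  have hsmooth := hb.smooth x
  have hmul : ∀ r r' : ℝ, BilinearPDO.prodOp freqDir r (doubleList n) (window r' *
      BilinearPDO.prodOp freqDir r' (doubleList n) (b x)) = window r' *
        BilinearPDO.prodOp freqDir r (doubleList n)
          (BilinearPDO.prodOp freqDir r' (doubleList n) (b x)) := fun r r' =>
    prodOp_mul (contDiff_resProd _ _) (fun i => dirDeriv_resProd _ _ i)
      (contDiff_prodOp hsmooth _ _) _ _
  have hs' := (hb.window_prodOp hδ hμ hM hL hs s).amp hL x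
  have ht' := (hb.window_prodOp hδ hμ hM hL ht t).amp hL x
  rw [regInt, regInt, oscInt_prodOp hδ hδ1 hμ hs' ht (doubleList n),
    oscInt_prodOp hδ hδ1 hμ ht' hs (doubleList n), hmul, hmul, prodOp_comm hsmooth]
  congr 1
  simp only [window]
  ring

/-! ### Invariance under (z, θ) ↦ (t⁻¹ z, t θ). -/

theorem resProd_scale {t : ℝ} (ht : t ≠ 0) (L : List (Fin n)) (v : Rn n × Rn n) :
    resProd 1 L v = resProd t L (t⁻¹ • v.1, t • v.2) := by
  induction L with
  | nil => rfl
  | cons j L ih =>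
    simp only [resProd, Pi.mul_apply, ih, res]
    congr 4
    simp [ht]

/-- The pairing z·θ is unchanged, and the Jacobians t^n and t^{-n} of the two integrals cancel. -/
theorem oscInt_scale {t : ℝ} (ht : 0 < t) :
    oscInt (fun v => F (t⁻¹ • v.1, t • v.2)) = oscInt F := by
  have h1 : ∀ θ, osc (fun v => F (t⁻¹ • v.1, t • v.2)) θ = ((t ^ n : ℝ) : ℂ) * osc F (t • θ) :=
    fun θ => by
      have := Measure.integral_comp_inv_smul_of_nonneg (volume : Measure (Rn n))
        (fun z => F (z, t • θ) * phase z (t • θ)) ht.le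
      rw [finrank_euclideanSpace_fin, Complex.real_smul] at this
      rw [osc, osc, ← this]
      congr 1
      funext z
      congr 1
      simp only [phase, real_inner_smul_left, real_inner_smul_right]
      congr 3
      field_simp
  have := Measure.integral_comp_smul_of_nonneg (volume : Measure (Rn n)) (osc F) t (hR := ht.le)
  rw [finrank_euclideanSpace_fin, Complex.real_smul] at this
  simp only [oscInt, h1]
  rw [integral_const_mul, this, ← mul_assoc, ← Complex.ofReal_mul, mul_inv_cancel₀ (by positivity)]
  simp

theorem regInt_scale {b : Rn n × Rn n → ℂ} (hb : ContDiff ℝ ∞ b) {t : ℝ} (ht : 0 < t) :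
    regInt 1 (fun v => b (t⁻¹ • v.1, t • v.2)) = regInt t b := by
  rw [regInt, regInt, ← oscInt_scale (F := window t * _) ht]
  congr 1
  funext v
  let A : Rn n × Rn n →L[ℝ] Rn n × Rn n :=
    (t⁻¹ • ContinuousLinearMap.fst ℝ (Rn n) (Rn n)).prod (t • ContinuousLinearMap.snd ℝ (Rn n) (Rn n))
  have h := prodOp_comp_affine (e := freqDir) (e' := freqDir) hb 0 A (s := t) (t := 1)
    (fun j => by simp [A, freqDir, phaseDir]) (doubleList n)
  simp only [zero_add, one_mul] at h
  rw [Pi.mul_apply, Pi.mul_apply, window, window, resProd_scale ht.ne']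
  congr 1
  exact congrFun h v

end

/-! ### The Hörmander classes as symbol families -/

section

variable {n : ℕ}

/-- The coordinate directions of `(x, ξ, η)`. -/
noncomputable def symDir : Fin n ⊕ Fin n ⊕ Fin n → Rn n × Rn n × Rn n :=
  Sum.elim dirX (Sum.elim dirXi dirEta)

/-- The orders of the derivatives in `x`, `ξ`, `η`. -/
def symOrd (δ ρ : ℝ) : Fin n ⊕ Fin n ⊕ Fin n → ℝ :=
  Sum.elim (fun _ => δ) (Sum.elim (fun _ => -ρ) (fun _ => -ρ))

/-- The weight `1 + |ξ| + |η|`. -/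
noncomputable def freqWt (p : Rn n × Rn n × Rn n) : ℝ := 1 + ‖p.2.1‖ + ‖p.2.2‖

theorem one_le_freqWt (p : Rn n × Rn n × Rn n) : 1 ≤ freqWt p := by
  unfold freqWt
  linarith [norm_nonneg p.2.1, norm_nonneg p.2.2]

/-- Membership in the Hörmander class, in terms of derivatives along words. -/
abbrev IsSymbol (δ ρ m : ℝ) (a : Rn n × Rn n × Rn n → ℂ) : Prop :=
  SymFam symDir (symOrd δ ρ) (fun (_ : Unit) _ => 1) (fun _ => freqWt) m (fun _ => a)

/-- The word with `α i` letters `g i` for each `i` in `L`. -/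
def indexWord {ι : Type*} (g : Fin n → ι) (α : Fin n → ℕ) : List (Fin n) → List ι
  | [] => []
  | i :: L => indexWord g α L ++ List.replicate (α i) (g i)

theorem wordDeriv_replicate {V ι : Type*} [NormedAddCommGroup V] [NormedSpace ℝ V] (d : ι → V)
    (i : ι) (k : ℕ) (f : V → ℂ) :
    wordDeriv d (List.replicate k i) f = (dirDeriv (d i))^[k] f := by
  induction k generalizing f with
  | zero => rfl
  | succ k ih => rw [List.replicate_succ, wordDeriv_cons, ih, Function.iterate_succ_apply]

theorem multiDeriv_eq_wordDeriv {V ι : Type*} [NormedAddCommGroup V] [NormedSpace ℝ V] (d : ι → V)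
    (g : Fin n → ι) (α : Fin n → ℕ) (f : V → ℂ) :
    multiDeriv (fun j => d (g j)) α f = wordDeriv d (indexWord g α (List.finRange n)) f := by
  unfold multiDeriv
  induction List.finRange n with
  | nil => rfl
  | cons i L ih => rw [List.foldr_cons, ih, indexWord, wordDeriv_append, wordDeriv_replicate]

theorem sum_indexWord {ι : Type*} (g : Fin n → ι) (α : Fin n → ℕ) (κ : ι → ℝ) :
    ((indexWord g α (List.finRange n)).map κ).sum = ∑ i, α i * κ (g i) := by
  have h : ∀ L, ((indexWord g α L).map κ).sum = (L.map fun i => α i * κ (g i)).sum := fun L => by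
    induction L with
    | nil => rfl
    | cons i L ih => simp [indexWord, ih, add_comm]
  rw [h, ← List.ofFn_eq_map, List.sum_ofFn]

theorem count_indexWord {ι : Type*} [DecidableEq ι] (g : Fin n → ι) (α : Fin n → ℕ) (b : ι) :
    (indexWord g α (List.finRange n)).count b = ∑ i, if g i = b then α i else 0 := by
  have h : ∀ L, (indexWord g α L).count b = (L.map fun i => if g i = b then α i else 0).sum :=
    fun L => by
      induction L with
      | nil => rfl
      | cons i L ih => simp [indexWord, ih, add_comm, List.count_replicate]
  rw [h, ← List.ofFn_eq_map, List.sum_ofFn]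

/-- The word of the multi-index derivative `∂_x^α ∂_ξ^β ∂_η^γ`. -/
def tripleWord (α β γ : Fin n → ℕ) : List (Fin n ⊕ Fin n ⊕ Fin n) :=
  indexWord (fun j => Sum.inr (Sum.inr j)) γ (List.finRange n) ++
    (indexWord (fun j => Sum.inr (Sum.inl j)) β (List.finRange n) ++
      indexWord Sum.inl α (List.finRange n))

theorem multiDeriv_eq_tripleWord (α β γ : Fin n → ℕ) (f : Rn n × Rn n × Rn n → ℂ) :
    multiDeriv dirX α (multiDeriv dirXi β (multiDeriv dirEta γ f)) =
      wordDeriv symDir (tripleWord α β γ) f := by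
  rw [tripleWord, wordDeriv_append, wordDeriv_append, ← multiDeriv_eq_wordDeriv symDir,
    ← multiDeriv_eq_wordDeriv symDir, ← multiDeriv_eq_wordDeriv symDir]
  rfl

theorem sum_tripleWord (δ ρ : ℝ) (α β γ : Fin n → ℕ) :
    ((tripleWord α β γ).map (symOrd δ ρ)).sum =
      δ * (mlen α : ℝ) - ρ * ((mlen β : ℝ) + (mlen γ : ℝ)) := by
  simp only [tripleWord, List.map_append, List.sum_append, sum_indexWord, symOrd, Sum.elim_inl,
    Sum.elim_inr, ← Finset.sum_mul, mlen, Nat.cast_sum]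
  ring

/-- Counting letters determines a word up to permutation. -/
theorem exists_perm_tripleWord (l : List (Fin n ⊕ Fin n ⊕ Fin n)) :
    ∃ α β γ : Fin n → ℕ, l.Perm (tripleWord α β γ) := by
  let _ : BEq (Fin n ⊕ Fin n ⊕ Fin n) := instBEqOfDecidableEq
  refine ⟨fun j => l.count (Sum.inl j), fun j => l.count (Sum.inr (Sum.inl j)),
    fun j => l.count (Sum.inr (Sum.inr j)), ?_⟩
  rw [List.perm_iff_count]
  rintro (j | j | j) <;> simp [tripleWord, count_indexWord]

/-- Multi-indices fix one order of differentiation and words allow every order; symmetry of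
derivatives reconciles the two. Words turn the Leibniz and chain rules into inductions on lists. -/
theorem mem_BS_iff {m ρ δ : ℝ} {σ : Rn n × Rn n × Rn n → ℂ} :
    σ ∈ BS n m ρ δ ↔ IsSymbol δ ρ m σ := by
  constructor
  · rintro ⟨hs, hb⟩
    refine ⟨fun _ => hs, fun l => ?_⟩
    obtain ⟨α, β, γ, hp⟩ := exists_perm_tripleWord l
    obtain ⟨C, hC, h⟩ := hb α β γ
    refine ⟨C, hC.le, fun _ v => ?_⟩
    have h1 := h v.1 v.2.1 v.2.2
    rw [multiDeriv_eq_tripleWord, ← wordDeriv_perm symDir hp hs] at h1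
    rw [(hp.map (symOrd δ ρ)).sum_eq, sum_tripleWord, one_mul, ← add_sub_assoc]
    exact h1
  · intro h
    refine ⟨h.smooth (), fun α β γ => ?_⟩
    obtain ⟨C, hC, hb⟩ := h.bound (tripleWord α β γ)
    -- `BS` asks for a strictly positive constant, while families only provide C ≥ 0.
    refine ⟨C + 1, by positivity, fun x ξ η => ?_⟩
    have h1 := hb () (x, ξ, η)
    rw [sum_tripleWord, one_mul, ← add_sub_assoc] at h1
    rw [multiDeriv_eq_tripleWord]
    refine h1.trans (mul_le_mul_of_nonneg_right (by linarith) ?_)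
    exact Real.rpow_nonneg (zero_le_one.trans (one_le_freqWt _)) _

theorem IsSymbol.deriv {δ ρ m : ℝ} {a : Rn n × Rn n × Rn n → ℂ} (ha : IsSymbol δ ρ m a)
    (i : Fin n ⊕ Fin n ⊕ Fin n) : IsSymbol δ ρ (m + symOrd δ ρ i) (dirDeriv (symDir i) a) :=
  SymFam.deriv ha i

theorem IsSymbol.prodOp {δ ρ m : ℝ} {a : Rn n × Rn n × Rn n → ℂ} (ha : IsSymbol δ ρ m a)
    (hρ : 0 ≤ ρ) (t : ℝ) (L : List (Fin n)) : IsSymbol δ ρ m (prodOp dirXi t L a) := by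
  have h := SymFam.prodOp ha (by simp) (fun _ => one_le_freqWt)
    (g := fun j => Sum.inr (Sum.inl j)) le_rfl (fun j => by simpa [symOrd] using hρ) t L
  rw [mul_zero, add_zero] at h
  exact h

/-! ### Restriction of a symbol to `(x, ξ)`, centred at a point -/

theorem wordDeriv_comp_affine {U V ι ι' : Type*} [NormedAddCommGroup U] [NormedSpace ℝ U]
    [NormedAddCommGroup V] [NormedSpace ℝ V] {d : ι → V} {d' : ι' → U} {g : ι' → ι} {c : ι' → ℝ}
    {f : V → ℂ} (hf : ContDiff ℝ ∞ f) (p : V) (A : U →L[ℝ] V)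
    (hA : ∀ i, A (d' i) = c i • d (g i)) (l : List ι') :
    wordDeriv d' l (fun x => f (p + A x)) =
      (((l.map c).prod : ℝ) : ℂ) • fun x => wordDeriv d (l.map g) f (p + A x) := by
  induction l generalizing f with
  | nil => simp
  | cons i l ih =>
    have hd := contDiff_dirDeriv hf (d (g i))
    have h1 : (fun x => dirDeriv (A (d' i)) f (p + A x)) =
        (c i : ℂ) • fun x => dirDeriv (d (g i)) f (p + A x) := by
      rw [hA, dirDeriv_smul_left hf]; rfl
    rw [wordDeriv_cons, dirDeriv_comp_affine hf, h1, wordDeriv_const_smul, ih hd, smul_smul]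
    · simp
    · exact hd.comp (contDiff_const.add A.contDiff)

/-- The map `(z, θ) ↦ (t⁻¹ z, t θ, 0)`. -/
noncomputable def scaleEmb (t : ℝ) : Rn n × Rn n →L[ℝ] Rn n × Rn n × Rn n :=
  (t⁻¹ • ContinuousLinearMap.fst ℝ (Rn n) (Rn n)).prod
    ((t • ContinuousLinearMap.snd ℝ (Rn n) (Rn n)).prod 0)

theorem scaleEmb_apply (t : ℝ) (v : Rn n × Rn n) : scaleEmb t v = (t⁻¹ • v.1, t • v.2, 0) := rfl

/-- The inclusion of the labels of `(z, θ)` into those of `(x, ξ, η)`. -/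
def embLabel : Fin n ⊕ Fin n → Fin n ⊕ Fin n ⊕ Fin n := Sum.map id Sum.inl

theorem scaleEmb_phaseDir (t : ℝ) (i : Fin n ⊕ Fin n) :
    scaleEmb t (phaseDir i) =
      (Sum.elim (fun _ => t⁻¹) (fun _ => t) : Fin n ⊕ Fin n → ℝ) i • symDir (embLabel i) := by
  rcases i with i | i <;> simp [scaleEmb_apply, phaseDir, symDir, embLabel, dirX, dirXi]

/-- The function `(z, θ) ↦ a(x + t⁻¹ z, ξ + t θ, η)`, where `p = (x, ξ, η)`. -/
noncomputable def centred (a : Rn n × Rn n × Rn n → ℂ) (t : ℝ) (p : Rn n × Rn n × Rn n)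
    (v : Rn n × Rn n) : ℂ := a (p + scaleEmb t v)

theorem contDiff_centred {a : Rn n × Rn n × Rn n → ℂ} (ha : ContDiff ℝ ∞ a) (t : ℝ)
    (p : Rn n × Rn n × Rn n) : ContDiff ℝ ∞ (centred a t p) :=
  ha.comp (contDiff_const.add (scaleEmb t).contDiff)

theorem rpow_le_of_comparable {x y Y : ℝ} (hx : 0 < x) (hy : 0 < y) (hY : 0 < Y) (h : x ≤ y * Y)
    (h' : y ≤ x * Y) (m : ℝ) : x ^ m ≤ y ^ m * Y ^ |m| := by
  rcases le_total 0 m with hm | hm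
  · rw [abs_of_nonneg hm, ← Real.mul_rpow hy.le hY.le]
    exact Real.rpow_le_rpow hx.le h hm
  · rw [abs_of_nonpos hm]
    have h1 : y ^ (-m) ≤ x ^ (-m) * Y ^ (-m) := by
      rw [← Real.mul_rpow hx.le hY.le]
      exact Real.rpow_le_rpow hy.le h' (by linarith)
    rw [Real.rpow_neg hy.le, Real.rpow_neg hx.le] at h1
    have hxm : 0 < x ^ m := Real.rpow_pos_of_pos hx m
    have hym : 0 < y ^ m := Real.rpow_pos_of_pos hy m
    calc x ^ m = x ^ m * y ^ m * (y ^ m)⁻¹ := by field_simp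
      _ ≤ x ^ m * y ^ m * ((x ^ m)⁻¹ * Y ^ (-m)) := by gcongr
      _ = _ := by field_simp

theorem freqWt_add_le (p : Rn n × Rn n × Rn n) (t : ℝ) (ht : 0 ≤ t) (v : Rn n × Rn n) :
    freqWt (p + scaleEmb t v) ≤ freqWt p + t * ‖v.2‖ := by
  have := norm_add_le p.2.1 (t • v.2)
  rw [norm_smul, Real.norm_of_nonneg ht] at this
  simp only [freqWt, scaleEmb_apply, Prod.snd_add, Prod.fst_add, add_zero]
  linarith

theorem le_freqWt_add (p : Rn n × Rn n × Rn n) (t : ℝ) (ht : 0 ≤ t) (v : Rn n × Rn n) :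
    freqWt p ≤ freqWt (p + scaleEmb t v) + t * ‖v.2‖ := by
  have := norm_sub_le (p.2.1 + t • v.2) (t • v.2)
  rw [norm_smul, Real.norm_of_nonneg ht, add_sub_cancel_right] at this
  simp only [freqWt, scaleEmb_apply, Prod.snd_add, Prod.fst_add, add_zero]
  linarith

theorem freqWt_scale_le {δ : ℝ} (hδ1 : δ < 1) (p : Rn n × Rn n × Rn n)
    (v : Rn n × Rn n) :
    freqWt (p + scaleEmb (freqWt p ^ δ) v) ≤ freqWt p * (1 + ‖v.2‖) := by
  have h0 := one_le_freqWt p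
  have h1 : freqWt p ^ δ ≤ freqWt p := by
    simpa using Real.rpow_le_rpow_of_exponent_le h0 hδ1.le
  have h2 := freqWt_add_le p (freqWt p ^ δ) (by positivity) v
  nlinarith [norm_nonneg v.2]

/-- A slow-variation estimate: a shift of ξ by Λ^δ θ lowers the weight by at most a power of 1 +
‖θ‖. The exponent 1/(1 - δ) is where δ < 1 enters. -/
theorem le_freqWt_scale {δ : ℝ} (hδ : 0 ≤ δ) (hδ1 : δ < 1) (p : Rn n × Rn n × Rn n)
    (v : Rn n × Rn n) :
    freqWt p ≤ freqWt (p + scaleEmb (freqWt p ^ δ) v) * (2 * (1 + ‖v.2‖)) ^ (1 / (1 - δ)) := by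
  have h0 := one_le_freqWt p
  set t := freqWt p ^ δ with ht
  have ht0 : 0 < t := by positivity
  have h' := one_le_freqWt (p + scaleEmb t v)
  have hv := norm_nonneg v.2
  have hκ : 1 ≤ 1 / (1 - δ) := by rw [le_div_iff₀ (by linarith)]; linarith
  -- If the shift is at most Λ/2, the weight at least halves and no more. Otherwise Λ^(1-δ) ≤ 2 ‖θ‖,
  -- so the θ-factor alone dominates Λ.
  rcases le_total (t * ‖v.2‖) (freqWt p / 2) with h | h
  · have h2 := le_freqWt_add p t ht0.le v
    have h3 : (2 : ℝ) ≤ (2 * (1 + ‖v.2‖)) ^ (1 / (1 - δ)) := by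
      have := Real.rpow_le_rpow_of_exponent_le (x := 2 * (1 + ‖v.2‖)) (by linarith) hκ
      rw [Real.rpow_one] at this
      linarith
    nlinarith
  · have h2 : freqWt p ^ (1 - δ) ≤ 2 * (1 + ‖v.2‖) := by
      rw [Real.rpow_sub (by linarith), Real.rpow_one, ← ht, div_le_iff₀ ht0]
      nlinarith
    have h3 : freqWt p ≤ (2 * (1 + ‖v.2‖)) ^ (1 / (1 - δ)) := by
      calc freqWt p = (freqWt p ^ (1 - δ)) ^ (1 / (1 - δ)) := by
            rw [← Real.rpow_mul (by linarith), mul_one_div_cancel (by linarith), Real.rpow_one]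
        _ ≤ _ := Real.rpow_le_rpow (by positivity) h2 (by positivity)
    exact h3.trans (le_mul_of_one_le_left (by positivity) h')

variable {δ ρ m : ℝ} {a : Rn n × Rn n × Rn n → ℂ}

/-- Uniform estimates after the parabolic rescaling at the point `p`. -/
theorem IsSymbol.centred_scale (ha : IsSymbol δ ρ m a) (hδ : 0 ≤ δ) (hδρ : δ ≤ ρ)
    (hδ1 : δ < 1) :
    SymFam phaseDir (phaseOrd δ (1 / (1 - δ) * ρ)) (fun p _ => freqWt p ^ m)
      (fun _ v => 1 * (1 + ‖v.2‖)) (1 / (1 - δ) * |m|)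
      (fun p : Rn n × Rn n × Rn n => centred a (freqWt p ^ δ) p) where
  smooth p := contDiff_centred (ha.smooth ()) _ _
  bound l := by
    obtain ⟨C, hC, hb⟩ := ha.bound (l.map embLabel)
    set κ := 1 / (1 - δ) with hκdef
    have hκ : 1 ≤ κ := by rw [hκdef, le_div_iff₀ (by linarith)]; linarith
    have hρ : 0 ≤ ρ := hδ.trans hδρ
    -- Each letter contributes its scaling factor Λ^{∓δ} and one power of the displaced weight.
    -- Their product is bounded by a power of 1 + ‖θ‖ with a constant independent of p.
    have key : ∀ l : List (Fin n ⊕ Fin n), ∃ D : ℝ, 0 ≤ D ∧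
        ∀ (p : Rn n × Rn n × Rn n) (v : Rn n × Rn n),
        |((l.map (Sum.elim (fun _ => (freqWt p ^ δ)⁻¹) (fun _ => freqWt p ^ δ))).prod)| *
          freqWt (p + scaleEmb (freqWt p ^ δ) v) ^ (m + ((l.map embLabel).map (symOrd δ ρ)).sum) ≤
        D * (freqWt p ^ m * (1 + ‖v.2‖) ^ (κ * |m| + (l.map (phaseOrd δ (κ * ρ))).sum)) := by
      intro l
      induction l with
      | nil =>
        refine ⟨2 ^ (κ * |m|), by positivity, fun p v => ?_⟩
        have h1 := freqWt_scale_le hδ1 p v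
        have h2 := le_freqWt_scale hδ hδ1 p v
        have h0 := one_le_freqWt p
        have h0' := one_le_freqWt (p + scaleEmb (freqWt p ^ δ) v)
        have hv := norm_nonneg v.2
        have hY : 1 + ‖v.2‖ ≤ (2 * (1 + ‖v.2‖)) ^ κ := by
          have := Real.rpow_le_rpow_of_exponent_le (x := 2 * (1 + ‖v.2‖)) (by linarith) hκ
          rw [Real.rpow_one] at this
          linarith
        have h3 := rpow_le_of_comparable (by linarith) (by linarith)
          (by positivity : 0 < (2 * (1 + ‖v.2‖)) ^ κ) (h1.trans (by gcongr)) h2 m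
        rw [← Real.rpow_mul (by positivity), Real.mul_rpow (by positivity) (by positivity)] at h3
        simp only [List.map_nil, List.prod_nil, abs_one, one_mul, List.sum_nil, add_zero]
        refine h3.trans (le_of_eq (by ring))
      | cons i l ih =>
        obtain ⟨D, hD, ih⟩ := ih
        have hfac : ∃ A : ℝ, 0 ≤ A ∧ ∀ (p : Rn n × Rn n × Rn n) (v : Rn n × Rn n),
            |(Sum.elim (fun _ => (freqWt p ^ δ)⁻¹) (fun _ => freqWt p ^ δ) :
              Fin n ⊕ Fin n → ℝ) i| *
              freqWt (p + scaleEmb (freqWt p ^ δ) v) ^ symOrd δ ρ (embLabel i) ≤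
              A * (1 + ‖v.2‖) ^ phaseOrd δ (κ * ρ) i := by
          rcases i with i | i
          · refine ⟨1, zero_le_one, fun p v => ?_⟩
            have h1 := freqWt_scale_le hδ1 p v
            have h0 := one_le_freqWt p
            have h0' := one_le_freqWt (p + scaleEmb (freqWt p ^ δ) v)
            simp only [Sum.elim_inl, embLabel, Sum.map_inl, symOrd, phaseOrd, one_mul, id]
            rw [abs_of_nonneg (by positivity), inv_mul_le_iff₀ (by positivity),
              ← Real.mul_rpow (by linarith) (by positivity)]
            exact Real.rpow_le_rpow (by linarith) h1 hδ
          · refine ⟨2 ^ (κ * ρ), by positivity, fun p v => ?_⟩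
            have h2 := le_freqWt_scale hδ hδ1 p v
            have h0 := one_le_freqWt p
            have h0' := one_le_freqWt (p + scaleEmb (freqWt p ^ δ) v)
            -- Here δ ≤ ρ is decisive: the factor Λ^δ produced by the rescaling is absorbed by the
            -- gain -ρ of a ξ-derivative.
            have h3 : freqWt p ^ δ ≤ freqWt p ^ ρ := Real.rpow_le_rpow_of_exponent_le h0 hδρ
            simp only [Sum.elim_inr, embLabel, Sum.map_inr, symOrd, phaseOrd, Sum.elim_inl]
            rw [abs_of_nonneg (by positivity), Real.rpow_neg (by linarith), ← div_eq_mul_inv,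
              div_le_iff₀ (by positivity), ← Real.mul_rpow (by positivity) (by positivity),
              Real.rpow_mul (by positivity), ← Real.mul_rpow (by positivity) (by positivity),
              mul_comm]
            exact h3.trans (Real.rpow_le_rpow (by linarith) h2 hρ)
        obtain ⟨A, hA, hfac⟩ := hfac
        refine ⟨D * A, by positivity, fun p v => ?_⟩
        have h0 := one_le_freqWt (p + scaleEmb (freqWt p ^ δ) v)
        have hx := ih p v
        have hy := hfac p v
        simp only [List.map_cons, List.prod_cons, List.sum_cons, abs_mul]
        rw [add_left_comm m, Real.rpow_add (by linarith) (symOrd δ ρ (embLabel i)),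
          add_left_comm (κ * |m|), Real.rpow_add (by positivity) (phaseOrd δ (κ * ρ) i)]
        refine le_trans (le_of_eq ?_) ((mul_le_mul hx hy (by positivity)
          ((by positivity : (0:ℝ) ≤ _).trans hx)).trans (le_of_eq ?_))
        · ring
        · ring
    obtain ⟨D, hD, hk⟩ := key l
    refine ⟨C * D, by positivity, fun p v => ?_⟩
    have e : wordDeriv phaseDir l (centred a (freqWt p ^ δ) p) = _ :=
      wordDeriv_comp_affine (ha.smooth ()) p (scaleEmb (freqWt p ^ δ))
        (scaleEmb_phaseDir (freqWt p ^ δ)) l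
    rw [e, Pi.smul_apply, norm_smul, Complex.norm_real, Real.norm_eq_abs, one_mul]
    have h1 := hb () (p + scaleEmb (freqWt p ^ δ) v)
    rw [one_mul] at h1
    calc _ ≤ |_| * (C * freqWt (p + scaleEmb (freqWt p ^ δ) v) ^
          (m + ((l.map embLabel).map (symOrd δ ρ)).sum)) :=
          mul_le_mul_of_nonneg_left h1 (abs_nonneg _)
      _ = C * (|_| * freqWt (p + scaleEmb (freqWt p ^ δ) v) ^
          (m + ((l.map embLabel).map (symOrd δ ρ)).sum)) := by ring
      _ ≤ C * (D * _) := mul_le_mul_of_nonneg_left (hk p v) hC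
      _ = _ := by ring

/-- Crude estimates without rescaling. -/
theorem IsSymbol.centred_one (ha : IsSymbol δ ρ m a) (hδ : 0 ≤ δ) (hρ : 0 ≤ ρ) :
    SymFam phaseDir (phaseOrd δ 0) (fun _ _ => 1) (fun p v => freqWt p * (1 + ‖v.2‖)) |m|
      (fun p : Rn n × Rn n × Rn n => centred a 1 p) where
  smooth p := contDiff_centred (ha.smooth ()) _ _
  bound l := by
    obtain ⟨C, hC, hb⟩ := ha.bound (l.map embLabel)
    refine ⟨C, hC, fun p v => ?_⟩
    have e : wordDeriv phaseDir l (centred a 1 p) = _ :=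
      wordDeriv_comp_affine (ha.smooth ()) p (scaleEmb 1) (scaleEmb_phaseDir 1) l
    have hp : ((l.map (Sum.elim (fun _ => (1 : ℝ)⁻¹) (fun _ => 1))).prod) = 1 := by
      refine List.prod_eq_one ?_
      intro x hx
      obtain ⟨i, -, rfl⟩ := List.mem_map.1 hx
      rcases i with i | i <;> simp
    rw [e, Pi.smul_apply, norm_smul, hp]
    simp only [Complex.ofReal_one, norm_one, one_mul]
    have h1 := hb () (p + scaleEmb 1 v)
    rw [one_mul] at h1
    refine h1.trans (mul_le_mul_of_nonneg_left ?_ hC)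
    have h0 := one_le_freqWt (p + scaleEmb 1 v)
    have h2 : freqWt (p + scaleEmb 1 v) ≤ freqWt p * (1 + ‖v.2‖) := by
      have := freqWt_add_le p 1 zero_le_one v
      nlinarith [norm_nonneg v.2, one_le_freqWt p]
    -- The gains -ρ are discarded and m is replaced by |m|, so that all exponents are nonnegative
    -- and the base can be enlarged to Λ(p) (1 + ‖θ‖).
    have h3 : ((l.map embLabel).map (symOrd δ ρ)).sum ≤ (l.map (phaseOrd (n := n) δ 0)).sum := by
      rw [List.map_map]
      refine List.sum_le_sum fun i _ => ?_
      rcases i with i | i <;> simp [embLabel, symOrd, phaseOrd, hρ]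
    have h4 : 0 ≤ (l.map (phaseOrd (n := n) δ 0)).sum :=
      List.sum_nonneg fun x hx => by
        obtain ⟨i, -, rfl⟩ := List.mem_map.1 hx
        exact phaseOrd_nonneg hδ le_rfl i
    calc _ ≤ freqWt (p + scaleEmb 1 v) ^ (|m| + (l.map (phaseOrd (n := n) δ 0)).sum) :=
          Real.rpow_le_rpow_of_exponent_le h0 (add_le_add (le_abs_self m) h3)
      _ ≤ _ := Real.rpow_le_rpow (by linarith) h2 (add_nonneg (abs_nonneg m) h4)

/-- The oscillatory integral `∫∫ a(x + z, ξ + θ, η) e^{i z·θ} dz dθ`. -/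
noncomputable def dualSym (a : Rn n × Rn n × Rn n → ℂ) (p : Rn n × Rn n × Rn n) : ℂ :=
  regInt 1 (centred a 1 p)

/-- Scale invariance and independence of t allow the regularization parameter to vary with the
point. The choice t = Λ(p)^δ makes the amplitudes uniform, with Λ(p)^m as the only p-dependence. -/
theorem IsSymbol.dualSym_bound (ha : IsSymbol δ ρ m a) (hδ : 0 ≤ δ) (hδρ : δ ≤ ρ)
    (hδ1 : δ < 1) : ∃ C : ℝ, 0 ≤ C ∧ ∀ p, ‖dualSym a p‖ ≤ C * freqWt p ^ m := by
  have hρ : 0 ≤ ρ := hδ.trans hδρ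
  have hμ : 0 ≤ 1 / (1 - δ) * ρ := mul_nonneg (div_nonneg zero_le_one (by linarith)) hρ
  have hM : ∀ p : Rn n × Rn n × Rn n, 0 ≤ freqWt p ^ m := fun p =>
    Real.rpow_nonneg (zero_le_one.trans (one_le_freqWt p)) _
  -- In the rescaled family L = 1, so the unspecified exponent k does no harm.
  obtain ⟨C, hC, k, h⟩ := ((ha.centred_scale hδ hδρ hδ1).window_prodOp hδ hμ hM (by simp)
    one_pos 1).oscInt_bound hδ hδ1 hM (by simp)
  refine ⟨C, hC, fun p => ?_⟩
  have ht : 0 < freqWt p ^ δ := Real.rpow_pos_of_pos (zero_lt_one.trans_le (one_le_freqWt p)) _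
  have e : dualSym a p = regInt 1 (centred a (freqWt p ^ δ) p) := by
    have h1 := regInt_scale (contDiff_centred (ha.smooth ()) 1 p) ht
    have h2 : (fun v : Rn n × Rn n => centred a 1 p ((freqWt p ^ δ)⁻¹ • v.1, freqWt p ^ δ • v.2)) =
        centred a (freqWt p ^ δ) p := by
      funext v; simp [centred, scaleEmb_apply]
    rw [← h2, h1, dualSym]
    -- The crude unscaled estimates suffice here, since only an identity at one point p is wanted.
    exact (ha.centred_one hδ hρ).regInt_eq hδ hδ1 le_rfl (by simp) one_le_freqWt p one_pos ht
  have := h p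
  rw [one_pow, mul_one] at this
  rw [e]
  exact this

end

/-! ### Smoothness of the dual symbol -/

section

variable {n : ℕ}

/-- The coordinate functionals dual to `symDir`. -/
noncomputable def symCoord : Fin n ⊕ Fin n ⊕ Fin n → (Rn n × Rn n × Rn n →L[ℝ] ℝ) :=
  Sum.elim (fun j => EuclideanSpace.proj j ∘L ContinuousLinearMap.fst ℝ _ _)
    (Sum.elim
      (fun j => EuclideanSpace.proj j ∘L ContinuousLinearMap.fst ℝ _ _ ∘L
        ContinuousLinearMap.snd ℝ _ _)
      (fun j => EuclideanSpace.proj j ∘L ContinuousLinearMap.snd ℝ _ _ ∘L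
        ContinuousLinearMap.snd ℝ _ _))

theorem sum_smul_single (x : Rn n) : ∑ j, x j • EuclideanSpace.single j (1 : ℝ) = x := by
  ext i; simp [Finset.sum_apply, Pi.single_apply]

theorem sum_symCoord_smul (v : Rn n × Rn n × Rn n) : ∑ i, symCoord i v • symDir i = v := by
  obtain ⟨x, ξ, η⟩ := v
  have hx := sum_smul_single x
  have hξ := sum_smul_single ξ
  have hη := sum_smul_single η
  simp only [Fintype.sum_sum_type, symCoord, symDir, Sum.elim_inl, Sum.elim_inr, dirX, dirXi,
    dirEta]
  refine Prod.ext ?_ (Prod.ext ?_ ?_)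
  · simpa [Prod.fst_sum, Prod.snd_sum] using hx
  · simpa [Prod.fst_sum, Prod.snd_sum] using hξ
  · simpa [Prod.fst_sum, Prod.snd_sum] using hη

/-- The real-linear map with the given partial derivatives. -/
noncomputable def gradMap (c : Fin n ⊕ Fin n ⊕ Fin n → ℂ) : Rn n × Rn n × Rn n →L[ℝ] ℂ :=
  ∑ i, (symCoord i).smulRight (c i)

theorem gradMap_apply (c : Fin n ⊕ Fin n ⊕ Fin n → ℂ) (v : Rn n × Rn n × Rn n) :
    gradMap c v = ∑ i, (symCoord i v : ℂ) * c i := by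
  simp [gradMap]

theorem norm_gradMap_le (c : Fin n ⊕ Fin n ⊕ Fin n → ℂ) :
    ‖gradMap c‖ ≤ ∑ i, ‖symCoord (n := n) i‖ * ‖c i‖ := by
  refine (norm_sum_le _ _).trans (le_of_eq ?_)
  simp only [ContinuousLinearMap.norm_smulRight_apply]

/-- Expressing the total derivative through partial derivatives makes dominated differentiation a
question about the derived symbols, which the same estimates control. -/
theorem fderiv_eq_gradMap {f : Rn n × Rn n × Rn n → ℂ} (hf : ContDiff ℝ ∞ f)
    (p : Rn n × Rn n × Rn n) : fderiv ℝ f p = gradMap (fun i => dirDeriv (symDir i) f p) := by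
  refine ContinuousLinearMap.ext fun v => ?_
  rw [gradMap_apply]
  conv_lhs => rw [← sum_symCoord_smul v, map_sum]
  refine Finset.sum_congr rfl fun i _ => ?_
  rw [map_smul, dirDeriv_apply hf, Complex.real_smul]

theorem hasFDerivAt_gradMap {f : Rn n × Rn n × Rn n → ℂ} (hf : ContDiff ℝ ∞ f)
    (p : Rn n × Rn n × Rn n) :
    HasFDerivAt f (gradMap fun i => dirDeriv (symDir i) f p) p := by
  rw [← fderiv_eq_gradMap hf]
  exact (hf.differentiable (by simp) p).hasFDerivAt

theorem gradMap_mul_const (c : Fin n ⊕ Fin n ⊕ Fin n → ℂ) (a : ℂ) :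
    a • gradMap c = gradMap fun i => a * c i := by
  refine ContinuousLinearMap.ext fun v => ?_
  simp only [smul_apply, gradMap_apply, smul_eq_mul, Finset.mul_sum]
  exact Finset.sum_congr rfl fun i _ => by ring

theorem integrable_smulRight_symCoord {α : Type*} [MeasurableSpace α] {μ : Measure α}
    {g : α → ℂ} (hg : Integrable g μ) (i : Fin n ⊕ Fin n ⊕ Fin n) :
    Integrable (fun a => (symCoord (n := n) i).smulRight (g a)) μ :=
  (ContinuousLinearMap.smulRightL ℝ (Rn n × Rn n × Rn n) ℂ (symCoord i)).integrable_comp hg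

theorem integrable_gradMap {α : Type*} [MeasurableSpace α] {μ : Measure α}
    {g : Fin n ⊕ Fin n ⊕ Fin n → α → ℂ} (hg : ∀ i, Integrable (g i) μ) :
    Integrable (fun a => gradMap fun i => g i a) μ := by
  have h : Integrable (fun a => ∑ i, (symCoord (n := n) i).smulRight (g i a)) μ :=
    integrable_finsetSum (ε' := Rn n × Rn n × Rn n →L[ℝ] ℂ) Finset.univ
      (f := fun i a => (symCoord (n := n) i).smulRight (g i a))
      (fun i _ => integrable_smulRight_symCoord (hg i) i)
  simpa only [gradMap] using h

theorem integral_gradMap {α : Type*} [MeasurableSpace α] {μ : Measure α}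
    {g : Fin n ⊕ Fin n ⊕ Fin n → α → ℂ} (hg : ∀ i, Integrable (g i) μ) :
    ∫ a, gradMap (fun i => g i a) ∂μ = gradMap fun i => ∫ a, g i a ∂μ := by
  simp only [gradMap]
  rw [integral_finsetSum _ fun i _ => integrable_smulRight_symCoord (hg i) i]
  refine Finset.sum_congr rfl fun i _ => ?_
  exact (ContinuousLinearMap.smulRightL ℝ (Rn n × Rn n × Rn n) ℂ (symCoord i)).integral_comp_comm
    (hg i)

/-- Differentiation under the integral sign, in terms of partial derivatives. -/
theorem hasFDerivAt_integral_gradMap {α : Type*} [MeasurableSpace α] {μ : Measure α}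
    {f : Rn n × Rn n × Rn n → α → ℂ} {g : Fin n ⊕ Fin n ⊕ Fin n → Rn n × Rn n × Rn n → α → ℂ}
    {p : Rn n × Rn n × Rn n} {bound : α → ℝ} (hf : ∀ q, AEStronglyMeasurable (f q) μ)
    (hfi : Integrable (f p) μ) (hg : ∀ i, AEStronglyMeasurable (g i p) μ)
    (hb : ∀ i, ∀ q ∈ Metric.ball p 1, ∀ a, ‖g i q a‖ ≤ bound a) (hbi : Integrable bound μ)
    (hd : ∀ a, ∀ q ∈ Metric.ball p 1,
      HasFDerivAt (fun q => f q a) (gradMap fun i => g i q a) q) :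
    HasFDerivAt (fun q => ∫ a, f q a ∂μ) (gradMap fun i => ∫ a, g i p a ∂μ) p := by
  have hgi : ∀ i, Integrable (g i p) μ := fun i =>
    hbi.mono' (hg i) (Filter.Eventually.of_forall (hb i p (Metric.mem_ball_self one_pos)))
  have hm : Integrable (fun a => gradMap fun i => g i p a) μ := integrable_gradMap hgi
  rw [← integral_gradMap hgi]
  refine hasFDerivAt_integral_of_dominated_of_fderiv_le
    (F' := fun q a => gradMap fun i => g i q a)
    (bound := fun a => (∑ i, ‖symCoord (n := n) i‖) * bound a) (Metric.ball_mem_nhds p one_pos)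
    (Filter.Eventually.of_forall hf) hfi hm.aestronglyMeasurable
    (Filter.Eventually.of_forall fun a q hq => ?_) (hbi.const_mul _)
    (Filter.Eventually.of_forall hd)
  refine (norm_gradMap_le _).trans ?_
  rw [Finset.sum_mul]
  exact Finset.sum_le_sum fun i _ => mul_le_mul_of_nonneg_left (hb i q hq a) (norm_nonneg _)

variable {δ ρ m : ℝ} {a : Rn n × Rn n × Rn n → ℂ}

/-- The amplitude of the oscillatory integral of a symbol centred at `p`. -/
noncomputable def windowed (a : Rn n × Rn n × Rn n → ℂ) (p : Rn n × Rn n × Rn n) :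
    Rn n × Rn n → ℂ := window 1 * centred a 1 p

theorem IsSymbol.windowed (ha : IsSymbol δ ρ m a) (hδ : 0 ≤ δ) (hρ : 0 ≤ ρ) :
    AmpFam δ 0 (fun _ => 1) freqWt |m| (windowed a) :=
  (ha.centred_one hδ hρ).window_mul hδ le_rfl one_le_freqWt one_pos

/-- The product carries the sup norm, so ‖ξ‖ and ‖η‖ each change by less than 1. -/
theorem freqWt_le_of_mem_ball {p q : Rn n × Rn n × Rn n} (h : q ∈ Metric.ball p 1) :
    freqWt q ≤ freqWt p + 2 := by
  have h1 : ‖q - p‖ < 1 := by simpa [dist_eq_norm] using h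
  have h2 : ‖q.2.1 - p.2.1‖ ≤ ‖q - p‖ := (norm_fst_le (q - p).2).trans (norm_snd_le (q - p))
  have h3 : ‖q.2.2 - p.2.2‖ ≤ ‖q - p‖ := (norm_snd_le (q - p).2).trans (norm_snd_le (q - p))
  have h4 := norm_le_norm_add_norm_sub' q.2.1 p.2.1
  have h5 := norm_le_norm_add_norm_sub' q.2.2 p.2.2
  unfold freqWt
  linarith

/-- The window does not depend on the base point, so a derivative in p falls on the symbol alone. On
the unit ball a multiple of `prodWt` majorizes all partial derivatives at once. -/
theorem hasFDerivAt_osc_windowed (ha : IsSymbol δ ρ m a) (hδ : 0 ≤ δ) (hρ : 0 ≤ ρ)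
    (p : Rn n × Rn n × Rn n) (θ : Rn n) :
    HasFDerivAt (fun q => osc (windowed a q) θ)
      (gradMap fun i => osc (windowed (dirDeriv (symDir i) a) p) θ) p := by
  have hw := fun i => (ha.deriv i).windowed hδ hρ
  choose C hC hb using fun i => (hw i).bound []
  set r : Fin n ⊕ Fin n ⊕ Fin n → ℝ := fun i => |m + symOrd δ ρ i|
  have hcont : ∀ (F : Rn n × Rn n → ℂ), Continuous F → AEStronglyMeasurable
      (fun z => F (z, θ) * phase z θ) volume := fun F hF => by
    refine Continuous.aestronglyMeasurable (Continuous.mul (by fun_prop) ?_)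
    exact continuous_phase.comp (by fun_prop : Continuous fun z : Rn n => (z, θ))
  refine hasFDerivAt_integral_gradMap
    (f := fun q z => windowed a q (z, θ) * phase z θ)
    (g := fun i q z => windowed (dirDeriv (symDir i) a) q (z, θ) * phase z θ)
    (bound := fun z => (∑ i, C i * ((freqWt p + 2) * (1 + ‖θ‖)) ^ r i) * prodWt z)
    (fun q => hcont _ ((ha.windowed hδ hρ).smooth q).continuous)
    (((ha.windowed hδ hρ).amp one_le_freqWt p).integrable_slice θ)
    (fun i => hcont _ ((hw i).smooth p).continuous) (fun i q hq z => ?_)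
    (integrable_prodWt.const_mul _) (fun z q _ => ?_)
  · rw [norm_mul, norm_phase, mul_one]
    have h1 := hb i q (z, θ)
    simp only [wordDeriv_nil, List.map_nil, List.sum_nil, add_zero, one_mul] at h1
    have h2 := freqWt_le_of_mem_ball hq
    have h0 := one_le_freqWt q
    have h0' := one_le_freqWt p
    have h3 : (freqWt q * (1 + ‖θ‖)) ^ r i ≤ ((freqWt p + 2) * (1 + ‖θ‖)) ^ r i :=
      Real.rpow_le_rpow (by positivity) (by gcongr) (abs_nonneg _)
    have h4 := prodWt_nonneg z
    have h5 : ∀ i, 0 ≤ C i * ((freqWt p + 2) * (1 + ‖θ‖)) ^ r i := fun i =>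
      mul_nonneg (hC i) (Real.rpow_nonneg (by positivity) _)
    calc _ ≤ C i * (prodWt z * (freqWt q * (1 + ‖θ‖)) ^ r i) := h1
      _ ≤ C i * (prodWt z * ((freqWt p + 2) * (1 + ‖θ‖)) ^ r i) := by have := hC i; gcongr
      _ = C i * ((freqWt p + 2) * (1 + ‖θ‖)) ^ r i * prodWt z := by ring
      _ ≤ _ := mul_le_mul_of_nonneg_right
        (Finset.single_le_sum (f := fun i => C i * ((freqWt p + 2) * (1 + ‖θ‖)) ^ r i)
          (fun i _ => h5 i) (Finset.mem_univ i)) h4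
  · have h1 := (hasFDerivAt_gradMap (ha.smooth ()) (q + scaleEmb 1 (z, θ))).comp q
      ((hasFDerivAt_id q).add_const (scaleEmb 1 (z, θ)))
    have h2 := (h1.const_mul (window 1 (z, θ))).mul_const (phase z θ)
    refine h2.congr_fderiv ?_
    rw [ContinuousLinearMap.comp_id, gradMap_mul_const, gradMap_mul_const]
    congr 1
    funext i
    simp only [windowed, centred, Pi.mul_apply]
    ring

/-- The oscillatory integral of the windowed symbol. -/
noncomputable def windowedInt (a : Rn n × Rn n × Rn n → ℂ) (p : Rn n × Rn n × Rn n) : ℂ :=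
  oscInt (windowed a p)

/-- Second differentiation under the integral, now over θ. The majorant is the decay of `osc` for
the derived symbols, polynomial in Λ and hence locally bounded in p. -/
theorem hasFDerivAt_windowedInt (ha : IsSymbol δ ρ m a) (hδ : 0 ≤ δ) (hδ1 : δ < 1) (hρ : 0 ≤ ρ)
    (p : Rn n × Rn n × Rn n) :
    HasFDerivAt (windowedInt a)
      (gradMap fun i => windowedInt (dirDeriv (symDir i) a) p) p := by
  have hw := fun i => (ha.deriv i).windowed hδ hρ
  choose C hC k hb using fun i => (hw i).osc_le_wt hδ hδ1 (by simp) one_le_freqWt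
  refine hasFDerivAt_integral_gradMap (f := fun q θ => osc (windowed a q) θ)
    (g := fun i q θ => osc (windowed (dirDeriv (symDir i) a) q) θ)
    (bound := fun θ => (∑ i, C i * (freqWt p + 2) ^ k i) * wt θ)
    (fun q => (stronglyMeasurable_osc
      ((ha.windowed hδ hρ).smooth q).continuous).aestronglyMeasurable)
    (((ha.windowed hδ hρ).amp one_le_freqWt p).integrable_osc hδ hδ1)
    (fun i => (stronglyMeasurable_osc ((hw i).smooth p).continuous).aestronglyMeasurable)
    (fun i q hq θ => ?_) (integrable_wt.const_mul _)
    (fun θ q _ => hasFDerivAt_osc_windowed ha hδ hρ q θ)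
  have h1 := hb i q θ
  have h2 := freqWt_le_of_mem_ball hq
  have h0 := one_le_freqWt q
  have h0' := one_le_freqWt p
  have h4 := wt_nonneg θ
  have h5 : ∀ i, 0 ≤ C i * (freqWt p + 2) ^ k i := fun i =>
    mul_nonneg (hC i) (by positivity)
  rw [mul_one] at h1
  calc _ ≤ C i * freqWt q ^ k i * wt θ := h1
    _ ≤ C i * (freqWt p + 2) ^ k i * wt θ := by have := hC i; gcongr
    _ ≤ _ := mul_le_mul_of_nonneg_right
      (Finset.single_le_sum (f := fun i => C i * (freqWt p + 2) ^ k i)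
        (fun i _ => h5 i) (Finset.mem_univ i)) h4

/-- Partial derivatives have the same form with a derived symbol, so smoothness follows by induction
over all symbols and orders simultaneously. -/
theorem contDiff_windowedInt (ha : IsSymbol δ ρ m a) (hδ : 0 ≤ δ) (hδ1 : δ < 1) (hρ : 0 ≤ ρ) :
    ContDiff ℝ ∞ (windowedInt a) := by
  rw [contDiff_infty]
  intro k
  induction k generalizing a m with
  | zero =>
    rw [Nat.cast_zero, contDiff_zero]
    exact continuous_iff_continuousAt.2 fun p =>
      (hasFDerivAt_windowedInt ha hδ hδ1 hρ p).continuousAt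
  | succ k ih =>
    rw [Nat.cast_succ, contDiff_succ_iff_fderiv_apply]
    refine ⟨fun p => (hasFDerivAt_windowedInt ha hδ hδ1 hρ p).differentiableAt, by simp,
      fun y => ?_⟩
    have : (fun p => fderiv ℝ (windowedInt a) p y) =
        fun p => ∑ i, (symCoord i y : ℂ) * windowedInt (dirDeriv (symDir i) a) p := by
      funext p
      rw [(hasFDerivAt_windowedInt ha hδ hδ1 hρ p).fderiv, gradMap_apply]
    rw [this]
    exact ContDiff.sum fun i _ => contDiff_const.mul (ih (ha.deriv i))

theorem symCoord_symDir (i j : Fin n ⊕ Fin n ⊕ Fin n) :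
    symCoord i (symDir j) = if i = j then 1 else 0 := by
  rcases i with i | i | i <;> rcases j with j | j | j <;>
    simp [symCoord, symDir, dirX, dirXi, dirEta, eq_comm]

theorem dirDeriv_windowedInt (ha : IsSymbol δ ρ m a) (hδ : 0 ≤ δ) (hδ1 : δ < 1) (hρ : 0 ≤ ρ)
    (i : Fin n ⊕ Fin n ⊕ Fin n) :
    dirDeriv (symDir i) (windowedInt a) = windowedInt (dirDeriv (symDir i) a) := by
  funext p
  rw [dirDeriv_apply (contDiff_windowedInt ha hδ hδ1 hρ),
    (hasFDerivAt_windowedInt ha hδ hδ1 hρ p).fderiv, gradMap_apply]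
  rw [Finset.sum_eq_single i (fun j _ hj => by simp [symCoord_symDir, hj]) (by simp)]
  simp [symCoord_symDir]

theorem prodOp_centred (ha : ContDiff ℝ ∞ a) (p : Rn n × Rn n × Rn n) (L : List (Fin n)) :
    prodOp freqDir 1 L (centred a 1 p) = centred (prodOp dirXi 1 L a) 1 p := by
  have h := prodOp_comp_affine (e := dirXi) (e' := freqDir) ha p (scaleEmb 1) (s := 1) (t := 1)
    (fun j => by simp [scaleEmb_apply, freqDir, phaseDir, dirXi]) L
  rw [one_mul] at h
  exact h

/-- At scale 1, the θ-operators on the centred function are ξ-operators on the symbol itself. Moving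
them there leaves an absolutely convergent iterated integral with a fixed window, which can be
differentiated in p. -/
theorem dualSym_eq (ha : ContDiff ℝ ∞ a) :
    dualSym a = windowedInt (prodOp dirXi 1 (doubleList n) a) := by
  funext p
  rw [dualSym, regInt, prodOp_centred ha, windowedInt, windowed]

theorem dirDeriv_dualSym (ha : IsSymbol δ ρ m a) (hδ : 0 ≤ δ) (hδ1 : δ < 1) (hρ : 0 ≤ ρ)
    (i : Fin n ⊕ Fin n ⊕ Fin n) :
    dirDeriv (symDir i) (dualSym a) = dualSym (dirDeriv (symDir i) a) := by
  have hs := ha.smooth ()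
  rw [dualSym_eq hs, dualSym_eq (contDiff_dirDeriv hs _),
    dirDeriv_windowedInt (ha.prodOp hρ 1 _) hδ hδ1 hρ, dirDeriv_prodOp hs]

theorem wordDeriv_dualSym (ha : IsSymbol δ ρ m a) (hδ : 0 ≤ δ) (hδ1 : δ < 1) (hρ : 0 ≤ ρ)
    (l : List (Fin n ⊕ Fin n ⊕ Fin n)) :
    wordDeriv symDir l (dualSym a) = dualSym (wordDeriv symDir l a) := by
  induction l generalizing a m with
  | nil => rfl
  | cons i l ih => rw [wordDeriv_cons, dirDeriv_dualSym ha hδ hδ1 hρ, ih (ha.deriv i)]; rfl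

/-- A word derivative of `dualSym a` is `dualSym` of a symbol of the shifted order, to which the
pointwise bound applies. -/
theorem IsSymbol.dualSym (ha : IsSymbol δ ρ m a) (hδ : 0 ≤ δ) (hδρ : δ ≤ ρ) (hδ1 : δ < 1) :
    IsSymbol δ ρ m (dualSym a) where
  smooth _ := by
    rw [dualSym_eq (ha.smooth ())]
    exact contDiff_windowedInt (ha.prodOp (hδ.trans hδρ) 1 _) hδ hδ1 (hδ.trans hδρ)
  bound l := by
    obtain ⟨C, hC, h⟩ := IsSymbol.dualSym_bound (SymFam.word ha l) hδ hδρ hδ1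
    refine ⟨C, hC, fun _ p => ?_⟩
    rw [wordDeriv_dualSym ha hδ hδ1 (hδ.trans hδρ), one_mul]
    exact h p

end

/-! ### Linear substitutions in the frequency variables -/

section

variable {n : ℕ} {δ ρ m : ℝ} {a : Rn n × Rn n × Rn n → ℂ}

/-- The map `(x, ξ, η) ↦ (x, αξ + βη, γξ + εη)`. -/
noncomputable def freqMap (α β γ ε : ℝ) : Rn n × Rn n × Rn n →L[ℝ] Rn n × Rn n × Rn n :=
  (ContinuousLinearMap.fst ℝ _ _).prod
    (((α • ContinuousLinearMap.fst ℝ (Rn n) (Rn n) +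
      β • ContinuousLinearMap.snd ℝ (Rn n) (Rn n)).prod
        (γ • ContinuousLinearMap.fst ℝ (Rn n) (Rn n) +
          ε • ContinuousLinearMap.snd ℝ (Rn n) (Rn n))) ∘L ContinuousLinearMap.snd ℝ _ _)

theorem freqMap_apply (α β γ ε : ℝ) (p : Rn n × Rn n × Rn n) :
    freqMap α β γ ε p = (p.1, α • p.2.1 + β • p.2.2, γ • p.2.1 + ε • p.2.2) := rfl

theorem freqWt_freqMap_le (α β γ ε : ℝ) (p : Rn n × Rn n × Rn n) :
    freqWt (freqMap α β γ ε p) ≤ freqWt p * (1 + |α| + |β| + |γ| + |ε|) := by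
  have h1 := norm_add_le (α • p.2.1) (β • p.2.2)
  have h2 := norm_add_le (γ • p.2.1) (ε • p.2.2)
  simp only [norm_smul, Real.norm_eq_abs] at h1 h2
  simp only [freqMap_apply, freqWt]
  have h3 := norm_nonneg p.2.1
  have h4 := norm_nonneg p.2.2
  nlinarith [abs_nonneg α, abs_nonneg β, abs_nonneg γ, abs_nonneg ε,
    mul_nonneg (abs_nonneg α) h4, mul_nonneg (abs_nonneg β) h3, mul_nonneg (abs_nonneg γ) h4,
    mul_nonneg (abs_nonneg ε) h3]

/-- x-directions are fixed and frequency directions go to combinations of frequency directions, all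
of order -ρ. A derivative of the composite is thus the composite of a derived symbol, and only the
comparison of weights remains. -/
theorem IsSymbol.comp_freqMap (ha : IsSymbol δ ρ m a) {α β γ ε : ℝ}
    (hinv : ∀ p : Rn n × Rn n × Rn n, freqMap α β γ ε (freqMap α β γ ε p) = p) :
    IsSymbol δ ρ m (fun p => a (freqMap α β γ ε p)) where
  smooth _ := (ha.smooth ()).comp (freqMap α β γ ε).contDiff
  bound l := by
    have hchain : ∀ {f : Rn n × Rn n × Rn n → ℂ}, ContDiff ℝ ∞ f → ∀ v,
        dirDeriv v (fun p => f (freqMap α β γ ε p)) =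
          fun p => dirDeriv (freqMap α β γ ε v) f (freqMap α β γ ε p) := fun hf v => by
      simpa using dirDeriv_comp_affine hf 0 (freqMap α β γ ε) v
    induction l generalizing a m with
    | nil =>
      obtain ⟨C, hC, hb⟩ := ha.bound []
      set K := 1 + |α| + |β| + |γ| + |ε| with hK
      have hK1 : 0 < K := by positivity
      refine ⟨C * K ^ |m|, by positivity, fun _ p => (hb () _).trans ?_⟩
      have h1 := freqWt_freqMap_le α β γ ε p
      -- The involution turns the upper bound for the weight into the lower bound, needed because m
      -- may be negative.
      have h2 := freqWt_freqMap_le α β γ ε (freqMap α β γ ε p)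
      rw [hinv] at h2
      have h3 := rpow_le_of_comparable (by linarith [one_le_freqWt (freqMap α β γ ε p)])
        (by linarith [one_le_freqWt p]) hK1 h1 h2 m
      simp only [List.map_nil, List.sum_nil, add_zero, one_mul]
      calc _ ≤ C * (freqWt p ^ m * K ^ |m|) := by gcongr
        _ = _ := by ring
    | cons i l ih =>
      have hs := ha.smooth ()
      have h : ∃ b, IsSymbol δ ρ (m + symOrd δ ρ i) b ∧
          dirDeriv (symDir i) (fun p => a (freqMap α β γ ε p)) =
            fun p => b (freqMap α β γ ε p) := by
        have key : ∀ (j : Fin n) (r s : ℝ), IsSymbol δ ρ (m + -ρ)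
            (dirDeriv (r • dirXi j + s • dirEta j) a) := fun j r s => by
          rw [dirDeriv_add_left hs, dirDeriv_smul_left hs, dirDeriv_smul_left hs]
          exact ((ha.deriv (Sum.inr (Sum.inl j))).const_smul (r : ℂ)).add
            ((ha.deriv (Sum.inr (Sum.inr j))).const_smul (s : ℂ))
        refine ⟨dirDeriv (freqMap α β γ ε (symDir i)) a, ?_, hchain hs _⟩
        rcases i with j | j | j
        · have : freqMap α β γ ε (symDir (Sum.inl j)) = symDir (Sum.inl j) := by
            simp [freqMap_apply, symDir, dirX]
          rw [this]
          exact ha.deriv (Sum.inl j)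
        · have : freqMap α β γ ε (symDir (Sum.inr (Sum.inl j))) = α • dirXi j + γ • dirEta j := by
            simp [freqMap_apply, symDir, dirXi, dirEta]
          rw [this]
          exact key j α γ
        · have : freqMap α β γ ε (symDir (Sum.inr (Sum.inr j))) = β • dirXi j + ε • dirEta j := by
            simp [freqMap_apply, symDir, dirXi, dirEta]
          rw [this]
          exact key j β ε
      obtain ⟨b, hb, hab⟩ := h
      obtain ⟨C, hC, hbound⟩ := ih hb
      refine ⟨C, hC, fun _ p => ?_⟩
      rw [wordDeriv_cons, hab, List.map_cons, List.sum_cons, ← add_assoc]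
      exact hbound () p

/-! ### Schwartz translates -/

theorem inv_pow_le_prodWt (z : Rn n) : ((1 + ‖z‖) ^ (2 * n))⁻¹ ≤ prodWt z := by
  rw [prodWt, Finset.prod_inv_distrib]
  refine inv_anti₀ (Finset.prod_pos fun _ _ => by positivity) ?_
  have : ∀ j : Fin n, 1 + z j ^ 2 ≤ (1 + ‖z‖) ^ 2 := fun j => by
    have h := PiLp.norm_apply_le z j
    rw [Real.norm_eq_abs] at h
    have h2 : z j ^ 2 ≤ ‖z‖ ^ 2 := by
      rw [← sq_abs]; gcongr
    nlinarith [norm_nonneg z]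
  calc ∏ j, (1 + z j ^ 2) ≤ ∏ _j : Fin n, (1 + ‖z‖) ^ 2 :=
        Finset.prod_le_prod (fun _ _ => by positivity) fun j _ => this j
    _ = _ := by rw [Finset.prod_const, Finset.card_univ, Fintype.card_fin, pow_mul]

/-- The function `(z, θ) ↦ h(y + z)`. -/
noncomputable def translate (h : 𝓢(Rn n, ℂ)) (y : Rn n) (v : Rn n × Rn n) : ℂ := h (y + v.1)

theorem contDiff_translate (h : 𝓢(Rn n, ℂ)) (y : Rn n) : ContDiff ℝ ∞ (translate h y) :=
  (h.smooth ⊤).comp (contDiff_const.add contDiff_fst)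

theorem dirDeriv_translate (h : 𝓢(Rn n, ℂ)) (y : Rn n) (v : Rn n × Rn n) :
    dirDeriv v (translate h y) = translate (LineDeriv.lineDerivOp v.1 h) y := by
  have := dirDeriv_comp_affine (h.smooth ⊤) y (ContinuousLinearMap.fst ℝ (Rn n) (Rn n)) v
  exact this.trans (funext fun w => (SchwartzMap.lineDerivOp_apply v.1 h (y + w.1)).symm)

theorem wordDeriv_translate (h : 𝓢(Rn n, ℂ)) (l : List (Fin n ⊕ Fin n)) :
    ∃ h' : 𝓢(Rn n, ℂ), ∀ y, wordDeriv phaseDir l (translate h y) = translate h' y := by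
  induction l generalizing h with
  | nil => exact ⟨h, fun _ => rfl⟩
  | cons i l ih =>
    obtain ⟨h', hh⟩ := ih (LineDeriv.lineDerivOp (phaseDir i).1 h)
    exact ⟨h', fun y => by rw [wordDeriv_cons, dirDeriv_translate, hh]⟩

/-- Peetre's inequality 1 + ‖z‖ ≤ (1 + ‖y‖)(1 + ‖y + z‖) trades decay of h at y + z for decay in z.
The exponent 2n is what `prodWt` requires. -/
theorem norm_translate_le (h : 𝓢(Rn n, ℂ)) (y : Rn n) (v : Rn n × Rn n) :
    ‖translate h y v‖ ≤ decay (2 * n) h * ((1 + ‖y‖) ^ (2 * n) * prodWt v.1) := by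
  have h1 := decay_spec (2 * n) h (y + v.1)
  have h2 : 1 + ‖v.1‖ ≤ (1 + ‖y‖) * (1 + ‖y + v.1‖) := by
    have := norm_sub_le (y + v.1) y
    rw [add_sub_cancel_left] at this
    nlinarith [norm_nonneg y, norm_nonneg (y + v.1)]
  have h3 : (1 + ‖v.1‖) ^ (2 * n) * ‖translate h y v‖ ≤
      decay (2 * n) h * (1 + ‖y‖) ^ (2 * n) := by
    calc _ ≤ ((1 + ‖y‖) * (1 + ‖y + v.1‖)) ^ (2 * n) * ‖h (y + v.1)‖ := by
          rw [translate]; gcongr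
      _ = (1 + ‖y‖) ^ (2 * n) * ((1 + ‖y + v.1‖) ^ (2 * n) * ‖h (y + v.1)‖) := by
          rw [mul_pow]; ring
      _ ≤ (1 + ‖y‖) ^ (2 * n) * decay (2 * n) h := by gcongr
      _ = _ := mul_comm _ _
  have h4 := inv_pow_le_prodWt v.1
  have h5 := decay_nonneg (2 * n) h
  calc _ ≤ decay (2 * n) h * (1 + ‖y‖) ^ (2 * n) * ((1 + ‖v.1‖) ^ (2 * n))⁻¹ := by
        rw [← div_eq_mul_inv, le_div_iff₀ (by positivity), mul_comm]; exact h3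
    _ ≤ decay (2 * n) h * (1 + ‖y‖) ^ (2 * n) * prodWt v.1 := by gcongr
    _ = _ := by ring

theorem symFam_translate (h : 𝓢(Rn n, ℂ)) {μ : ℝ} (hδ : 0 ≤ δ) (hμ : 0 ≤ μ)
    {Λ : Rn n → Rn n × Rn n → ℝ} (hΛ : ∀ s v, 1 ≤ Λ s v) :
    SymFam phaseDir (phaseOrd δ μ) (fun y v => (1 + ‖y‖) ^ (2 * n) * prodWt v.1) Λ 0
      (translate h) := by
  refine symFam_of_bounded (phaseOrd_nonneg hδ hμ)
    (fun y v => mul_nonneg (by positivity) (prodWt_nonneg _)) hΛ (contDiff_translate h) fun l => ?_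
  obtain ⟨h', hh⟩ := wordDeriv_translate h l
  refine ⟨decay (2 * n) h', decay_nonneg _ _, fun y v => ?_⟩
  rw [hh]
  exact norm_translate_le h' y v

/-- The function `(z, θ) ↦ e^{i z·η}`. -/
noncomputable def modulation (η : Rn n) (v : Rn n × Rn n) : ℂ := phase v.1 η

theorem contDiff_modulation (η : Rn n) : ContDiff ℝ ∞ (modulation η) := by
  unfold modulation phase
  exact (contDiff_const.mul
    (Complex.ofRealCLM.contDiff.comp (contDiff_fst.inner ℝ contDiff_const))).cexp

theorem dirDeriv_modulation_inl (η : Rn n) (j : Fin n) :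
    dirDeriv (phaseDir (Sum.inl j)) (modulation η) = (Complex.I * η j) • modulation η := by
  funext v
  refine HasLineDerivAt.lineDeriv ?_
  have h := hasLineDerivAt_phase v.1 η j
  unfold HasLineDerivAt at h ⊢
  simpa [modulation, phaseDir] using h

theorem dirDeriv_modulation_inr (η : Rn n) (j : Fin n) :
    dirDeriv (phaseDir (Sum.inr j)) (modulation η) = 0 := by
  funext v
  have : (fun s : ℝ => modulation η (v + s • phaseDir (Sum.inr j))) = fun _ => modulation η v := by
    funext s; simp [modulation, phaseDir]
  simp [dirDeriv, lineDeriv, this]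

/-- The constants depend on η, which is harmless: η stays fixed throughout the transposition
argument. -/
theorem symFam_modulation {P : Type*} (η : Rn n) {μ : ℝ} (hδ : 0 ≤ δ) (hμ : 0 ≤ μ)
    {Λ : P → Rn n × Rn n → ℝ} (hΛ : ∀ s v, 1 ≤ Λ s v) :
    SymFam phaseDir (phaseOrd δ μ) (fun _ _ => 1) Λ 0 (fun _ => modulation η) := by
  refine symFam_of_bounded (phaseOrd_nonneg hδ hμ) (by simp) hΛ
    (fun _ => contDiff_modulation η) fun l => ?_
  have h : ∃ c : ℂ, wordDeriv phaseDir l (modulation η) = c • modulation η := by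
    induction l with
    | nil => exact ⟨1, by simp⟩
    | cons i l ih =>
      rcases i with i | i
      · obtain ⟨c, hc⟩ := ih
        refine ⟨Complex.I * η i * c, ?_⟩
        rw [wordDeriv_cons, dirDeriv_modulation_inl,
          wordDeriv_const_smul _ _ (contDiff_modulation η), hc, smul_smul]
      · refine ⟨0, ?_⟩
        rw [wordDeriv_cons, dirDeriv_modulation_inr, wordDeriv_zero_fun, zero_smul]
  obtain ⟨c, hc⟩ := h
  refine ⟨‖c‖, norm_nonneg _, fun _ v => ?_⟩
  rw [hc, Pi.smul_apply, norm_smul, modulation, norm_phase]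

/-! ### Fourier inversion -/

/-- The constant `(2π)^{-n}`. -/
noncomputable def hatConst (n : ℕ) : ℂ := ((2 * Real.pi : ℝ) : ℂ)⁻¹ ^ n

theorem hat_eq_phase (f : 𝓢(Rn n, ℂ)) (ξ : Rn n) :
    hat f ξ = hatConst n * ∫ x, f x * phase (-x) ξ := by
  simp only [hat, hatConst, phase, inner_neg_left]
  congr 2
  funext x
  push_cast
  ring_nf

/-- Fourier inversion in this normalization: the Jacobian (2π)^n of ζ = 2π w cancels the factor in
`hat`. -/
theorem integral_hat_mul_phase (h : 𝓢(Rn n, ℂ)) (x : Rn n) :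
    ∫ ζ, hat h ζ * phase x ζ = h x := by
  have h1 : 𝓕⁻ (𝓕 h : 𝓢(Rn n, ℂ)) = h := FourierTransform.fourierInv_fourier_eq h
  have hpi : (0 : ℝ) < 2 * Real.pi := by positivity
  have h2 := Measure.integral_comp_inv_smul_of_nonneg (volume : Measure (Rn n))
    (fun w => (𝓕 h : 𝓢(Rn n, ℂ)) w * Complex.exp ((2 * Real.pi * ⟪w, x⟫_ℝ : ℝ) * Complex.I))
    hpi.le
  rw [finrank_euclideanSpace_fin, Complex.real_smul] at h2
  have h3 : ∫ w, (𝓕 h : 𝓢(Rn n, ℂ)) w *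
      Complex.exp ((2 * Real.pi * ⟪w, x⟫_ℝ : ℝ) * Complex.I) = h x := by
    conv_rhs => rw [← h1]
    rw [SchwartzMap.fourierInv_coe, Real.fourierInv_eq']
    simp only [smul_eq_mul, mul_comm]
  rw [h3] at h2
  have h4 : ∀ ζ, hat h ζ * phase x ζ = hatConst n * ((𝓕 h : 𝓢(Rn n, ℂ)) ((2 * Real.pi)⁻¹ • ζ) *
      Complex.exp ((2 * Real.pi * ⟪(2 * Real.pi)⁻¹ • ζ, x⟫_ℝ : ℝ) * Complex.I)) := fun ζ => by
    rw [hat_eq, hatConst, mul_assoc, phase, real_inner_smul_left, ← mul_assoc (2 * Real.pi),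
      mul_inv_cancel₀ hpi.ne', one_mul, real_inner_comm, mul_comm Complex.I]
  simp only [h4]
  rw [integral_const_mul, h2, ← mul_assoc, hatConst]
  have : (Real.pi : ℂ) ≠ 0 := by exact_mod_cast Real.pi_ne_zero
  push_cast
  rw [← mul_pow, inv_mul_cancel₀ (mul_ne_zero two_ne_zero this), one_pow, one_mul]

end

/-! ### The transposed operator -/

section

variable {n : ℕ} {δ ρ m : ℝ} {σ : Rn n × Rn n × Rn n → ℂ}

@[fun_prop]
theorem Continuous.phase {X : Type*} [TopologicalSpace X] {f g : X → Rn n} (hf : Continuous f)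
    (hg : Continuous g) : Continuous fun x => phase (f x) (g x) :=
  continuous_phase.comp (hf.prodMk hg)

attribute [fun_prop] continuous_hat

/-- The bilinear form of `T_σ` with the frequency `η` integrated last. -/
theorem opForm_eq (hσ : σ ∈ BS n m ρ δ) (f g h : 𝓢(Rn n, ℂ)) :
    opForm σ f g h = ∫ η, hat g η *
      ∫ x, h x * ∫ ξ, σ (x, ξ, η) * hat f ξ * phase x (ξ + η) := by
  obtain ⟨C, hC, k, hb⟩ := BS.bound hσ
  have hc := hσ.1.continuous
  have hcf := continuous_hat f
  have hcg := continuous_hat g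
  have h1 : ∀ x, opFun σ f g x = ∫ η, ∫ ξ, opIntegrand σ f g x (ξ, η) := fun x =>
    integral_prod_symm _ (integrable_opIntegrand hσ f g x)
  set D := C * (hatDecay (k + (n + 1)) f * hatDecay (k + (n + 1)) g) with hD
  have hD0 : 0 ≤ D := mul_nonneg hC.le (mul_nonneg (hatDecay_nonneg _ _) (hatDecay_nonneg _ _))
  have hinner : ∀ x η, ‖∫ ξ, opIntegrand σ f g x (ξ, η)‖ ≤ D * (∫ ξ : Rn n, wt ξ) * wt η :=
    fun x η => by
      have := norm_integral_le_of_norm_le (integrable_wt.const_mul (D * wt η))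
        (Filter.Eventually.of_forall fun ξ => (norm_opIntegrand_le hC hb f g x (ξ, η)).trans
          (le_of_eq (by rw [← hD]; ring : _ = D * wt η * wt ξ)))
      rw [integral_const_mul] at this
      exact this.trans (le_of_eq (by ring))
  have hint : Integrable (Function.uncurry fun x η => (∫ ξ, opIntegrand σ f g x (ξ, η)) * h x)
      (volume.prod volume) := by
    have hmeas : StronglyMeasurable
        (fun q : Rn n × Rn n => ∫ ξ, opIntegrand σ f g q.1 (ξ, q.2)) := by
      have : Continuous (fun q : (Rn n × Rn n) × Rn n => opIntegrand σ f g q.1.1 (q.2, q.1.2)) := by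
        unfold opIntegrand; fun_prop
      exact this.stronglyMeasurable.integral_prod_right
    refine (integrable_wt_mul.const_mul
      (D * (∫ ξ : Rn n, wt ξ) * decay (n + 1) h)).mono' ?_ (Filter.Eventually.of_forall fun q => ?_)
    · exact (hmeas.mul (h.continuous.comp continuous_fst).stronglyMeasurable).aestronglyMeasurable
    · have h2 : (1 + ‖q.1‖) ^ 0 * ‖h q.1‖ ≤ decay (n + 1) h * wt q.1 :=
        le_wt_of_decay (by simpa using decay_spec (n + 1) h q.1)
      rw [pow_zero, one_mul] at h2
      rw [Function.uncurry_def, norm_mul]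
      refine (mul_le_mul (hinner q.1 q.2) h2 (norm_nonneg _)
        ((norm_nonneg _).trans (hinner q.1 q.2))).trans (le_of_eq (by ring))
  calc opForm σ f g h = ∫ x, ∫ η, (∫ ξ, opIntegrand σ f g x (ξ, η)) * h x := by
        rw [opForm]
        simp only [h1, integral_mul_const]
    _ = ∫ η, ∫ x, (∫ ξ, opIntegrand σ f g x (ξ, η)) * h x := integral_integral_swap hint
    _ = _ := by
        congr 1
        funext η
        rw [← integral_const_mul]
        congr 1
        funext x
        rw [mul_left_comm, ← integral_const_mul, mul_comm]
        congr 2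
        funext ξ
        simp only [opIntegrand, phase]
        ring

theorem window_eq (t : ℝ) (v : Rn n × Rn n) (θ : Rn n) : window t v = window t (v.1, θ) := by
  have : ∀ L, resProd t L v = resProd t L (v.1, θ) := fun L => by
    induction L with
    | nil => rfl
    | cons j L ih => simp only [resProd, Pi.mul_apply, ih, res]
  exact this _

/-- The shear (ζ, ξ) ↦ (ζ, ζ + ξ) preserves the measure. -/
theorem integrable_wt_shear (η : Rn n) :
    Integrable (fun q : Rn n × Rn n => wt q.1 * wt (q.2 + (q.1 + η))) (volume.prod volume) := by
  have h1 : Integrable (fun q : Rn n × Rn n => wt q.1 * wt (q.2 + η)) (volume.prod volume) :=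
    integrable_wt.mul_prod (integrable_wt.comp_add_right η)
  have h2 := (measurePreserving_prod_add (volume : Measure (Rn n))
    (volume : Measure (Rn n))).integrable_comp_of_integrable h1
  refine h2.congr (Filter.Eventually.of_forall fun q => ?_)
  simp only [Function.comp]
  congr 2
  abel

/-- The amplitude `h(y + z) e^{i z·η} σ(y + z, ξ, η)`. -/
noncomputable def dualAmp (σ : Rn n × Rn n × Rn n → ℂ) (h : 𝓢(Rn n, ℂ)) (η y : Rn n) :
    Rn n × Rn n → ℂ :=
  translate h y * (modulation η * centred σ 1 (y, 0, η))

theorem centred_one_apply (σ : Rn n × Rn n × Rn n → ℂ) (y ξ η : Rn n) (v : Rn n × Rn n) :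
    centred σ 1 (y, ξ, η) v = σ (y + v.1, ξ + v.2, η) := by
  simp [centred, scaleEmb_apply]

/-- The decay of h makes this amplitude integrable in z without a window, at the price of (1 +
‖y‖)^(2n). The centre has ξ = 0, so θ plays the role of the frequency ξ. -/
theorem ampFam_dualAmp (hσ : IsSymbol δ ρ m σ) (hδ : 0 ≤ δ) (hρ : 0 ≤ ρ) (h : 𝓢(Rn n, ℂ))
    (η : Rn n) :
    AmpFam δ 0 (fun y => (1 + ‖y‖) ^ (2 * n)) (fun _ => 1 + ‖η‖) |m| (dualAmp σ h η) := by
  have hΛ : ∀ (s : Rn n) (v : Rn n × Rn n), 1 ≤ (1 + ‖η‖) * (1 + ‖v.2‖) := fun s v => by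
    nlinarith [norm_nonneg η, norm_nonneg v.2]
  have hΛ0 : ∀ (s : Rn n) (v : Rn n × Rn n), 0 < (1 + ‖η‖) * (1 + ‖v.2‖) := fun s v => by
    linarith [hΛ s v]
  have h1 := (hσ.centred_one hδ hρ).comp (fun y : Rn n => (y, 0, η))
  simp only [freqWt, norm_zero, add_zero] at h1
  have h2 := (symFam_translate h hδ le_rfl hΛ).mul
    ((symFam_modulation (P := Rn n) η hδ le_rfl hΛ).mul h1 hΛ0) hΛ0
  simp only [mul_one, zero_add] at h2
  exact h2

theorem prodOp_dualAmp (hσ : ContDiff ℝ ∞ σ) (h : 𝓢(Rn n, ℂ)) (η y : Rn n) (L : List (Fin n)) :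
    prodOp freqDir 1 L (dualAmp σ h η y) = dualAmp (prodOp dirXi 1 L σ) h η y := by
  have h1 : ∀ j : Fin n, dirDeriv (freqDir j) (translate h y) = 0 := fun j => by
    funext v
    have : (fun s : ℝ => translate h y (v + s • freqDir j)) = fun _ => translate h y v := by
      funext s; simp [translate, freqDir, phaseDir]
    simp [dirDeriv, lineDeriv, this]
  rw [dualAmp, prodOp_mul (contDiff_translate h y) h1
    (smooth_mul (contDiff_modulation η) (contDiff_centred hσ _ _)),
    prodOp_mul (contDiff_modulation η) (dirDeriv_modulation_inr η) (contDiff_centred hσ _ _),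
    prodOp_centred hσ, dualAmp]

/-- The inner integral of the transposed operator. -/
theorem integral_dualSym (hσ : IsSymbol δ ρ m σ) (hδ : 0 ≤ δ) (hδ1 : δ < 1) (hρ : 0 ≤ ρ)
    (h : 𝓢(Rn n, ℂ)) (η y : Rn n) :
    ∫ ζ, dualSym σ (y, -ζ - η, η) * hat h ζ * phase y ζ = oscInt (dualAmp σ h η y) := by
  set τ := prodOp dirXi 1 (doubleList n) σ with hτdef
  have hτ : IsSymbol δ ρ m τ := hσ.prodOp hρ 1 _
  set W : Rn n × Rn n → ℂ := windowed τ (y, 0, η) with hWdef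
  have hW : Amp δ 0 |m| W := (hτ.windowed hδ hρ).amp one_le_freqWt (y, 0, η)
  have hWc := hW.continuous
  -- Shifting θ by ζ + η moves the centre back to ξ = 0. Afterwards ζ occurs only in the phase, and
  -- the ζ-integral can be carried out.
  have hWτ : ∀ ζ z ξ : Rn n, windowed τ (y, -ζ - η, η) (z, ξ + (ζ + η)) = W (z, ξ) :=
    fun ζ z ξ => by
      simp only [hWdef, windowed, Pi.mul_apply, centred_one_apply]
      rw [window_eq 1 (z, ξ + (ζ + η)) ξ]
      congr 3
      · abel_nf
  set G : Rn n → Rn n → ℂ := fun ζ ξ => ∫ z, W (z, ξ) * phase z (ξ + (ζ + η)) with hGdef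
  have hG : ∀ ζ ξ, osc (windowed τ (y, -ζ - η, η)) (ξ + (ζ + η)) = G ζ ξ := fun ζ ξ => by
    simp only [osc, hWτ, hGdef]
  have hdual : ∀ ζ, dualSym σ (y, -ζ - η, η) = ∫ ξ, G ζ ξ := fun ζ => by
    rw [dualSym_eq (hσ.smooth ()), windowedInt, oscInt,
      ← integral_add_right_eq_self (osc (windowed τ (y, -ζ - η, η))) (ζ + η)]
    simp only [hG]
  have hcont : Continuous (hat h) := continuous_hat h
  obtain ⟨C, hC, k, hosc⟩ := (hτ.windowed hδ hρ).osc_le_wt hδ hδ1 (by simp) one_le_freqWt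
  -- Fubini in (ζ, ξ): the inner integral decays in ξ + ζ + η but may grow like a power of the
  -- weight at (-ζ - η, η), which the decay of `hat h` absorbs.
  have hGint : Integrable (Function.uncurry fun ζ ξ => hat h ζ * phase y ζ * G ζ ξ)
      (volume.prod volume) := by
    have hmeas : StronglyMeasurable (fun q : Rn n × Rn n => G q.1 q.2) := by
      have : Continuous (fun q : (Rn n × Rn n) × Rn n =>
          W (q.2, q.1.2) * phase q.2 (q.1.2 + (q.1.1 + η))) := by fun_prop
      exact this.stronglyMeasurable.integral_prod_right
    refine ((integrable_wt_shear η).const_mul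
      (C * (1 + 2 * ‖η‖) ^ k * hatDecay (k + (n + 1)) h)).mono' ?_
      (Filter.Eventually.of_forall fun q => ?_)
    · exact (Continuous.stronglyMeasurable (by fun_prop : Continuous fun q : Rn n × Rn n =>
        hat h q.1 * phase y q.1)).mul hmeas |>.aestronglyMeasurable
    · obtain ⟨ζ, ξ⟩ := q
      have h1 := hosc (y, -ζ - η, η) (ξ + (ζ + η))
      rw [hG, mul_one] at h1
      have h2 : freqWt (y, -ζ - η, η) ≤ (1 + 2 * ‖η‖) * (1 + ‖ζ‖) := by
        have := norm_sub_le (-ζ) η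
        rw [norm_neg] at this
        simp only [freqWt]
        nlinarith [norm_nonneg η, norm_nonneg ζ]
      have h3 := le_wt_of_decay (hatDecay_spec (k + (n + 1)) h ζ)
      have h4 := wt_nonneg (ξ + (ζ + η))
      have h5 := one_le_freqWt (y, -ζ - η, η)
      rw [Function.uncurry_apply_pair, norm_mul, norm_mul, norm_phase, mul_one]
      calc ‖hat h ζ‖ * ‖G ζ ξ‖ ≤
            ‖hat h ζ‖ * (C * ((1 + 2 * ‖η‖) * (1 + ‖ζ‖)) ^ k * wt (ξ + (ζ + η))) := by
            refine mul_le_mul_of_nonneg_left (h1.trans ?_) (norm_nonneg _)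
            gcongr
        _ = C * (1 + 2 * ‖η‖) ^ k * ((1 + ‖ζ‖) ^ k * ‖hat h ζ‖) * wt (ξ + (ζ + η)) := by
            rw [mul_pow]; ring
        _ ≤ C * (1 + 2 * ‖η‖) ^ k * (hatDecay (k + (n + 1)) h * wt ζ) * wt (ξ + (ζ + η)) := by
            gcongr
        _ = _ := by ring
  -- For fixed ξ, integrating in ζ first reconstitutes h(y + z) by Fourier inversion.
  have hslice : ∀ ξ, ∫ ζ, hat h ζ * phase y ζ * G ζ ξ =
      osc (window 1 * dualAmp τ h η y) ξ := fun ξ => by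
    obtain ⟨C', hC'⟩ := hW.slice [] ξ
    have hint : Integrable (Function.uncurry fun ζ z =>
        hat h ζ * phase y ζ * (W (z, ξ) * phase z (ξ + (ζ + η)))) (volume.prod volume) := by
      refine ((integrable_wt.mul_prod integrable_prodWt).const_mul
        (hatDecay (n + 1) h * C')).mono' (Continuous.aestronglyMeasurable ?_)
        (Filter.Eventually.of_forall fun q => ?_)
      · unfold Function.uncurry; fun_prop
      · obtain ⟨ζ, z⟩ := q
        have h3 : (1 + ‖ζ‖) ^ 0 * ‖hat h ζ‖ ≤ hatDecay (n + 1) h * wt ζ :=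
          le_wt_of_decay (by simpa using hatDecay_spec (n + 1) h ζ)
        rw [pow_zero, one_mul] at h3
        rw [Function.uncurry_apply_pair, norm_mul, norm_mul, norm_mul, norm_phase, norm_phase,
          mul_one, mul_one]
        exact (mul_le_mul h3 (hC' z) (norm_nonneg _) ((norm_nonneg _).trans h3)).trans
          (le_of_eq (by ring))
    calc ∫ ζ, hat h ζ * phase y ζ * G ζ ξ
        = ∫ ζ, ∫ z, hat h ζ * phase y ζ * (W (z, ξ) * phase z (ξ + (ζ + η))) := by
          simp only [hGdef, integral_const_mul]
      _ = ∫ z, ∫ ζ, hat h ζ * phase y ζ * (W (z, ξ) * phase z (ξ + (ζ + η))) :=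
          integral_integral_swap hint
      _ = _ := by
          rw [osc]
          congr 1
          funext z
          have : ∀ ζ, hat h ζ * phase y ζ * (W (z, ξ) * phase z (ξ + (ζ + η))) =
              W (z, ξ) * phase z ξ * phase z η * (hat h ζ * phase (y + z) ζ) := fun ζ => by
            rw [phase_add_right, phase_add_right, phase_add_left]; ring
          simp only [this]
          rw [integral_const_mul, integral_hat_mul_phase]
          simp only [hWdef, windowed, dualAmp, Pi.mul_apply, translate, modulation]
          ring
  calc ∫ ζ, dualSym σ (y, -ζ - η, η) * hat h ζ * phase y ζ
      = ∫ ζ, ∫ ξ, hat h ζ * phase y ζ * G ζ ξ := by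
        congr 1
        funext ζ
        rw [integral_const_mul, ← hdual]
        ring
    _ = ∫ ξ, ∫ ζ, hat h ζ * phase y ζ * G ζ ξ := integral_integral_swap hGint
    _ = oscInt (window 1 * dualAmp τ h η y) := by simp only [hslice, oscInt]
    _ = _ := by
        -- With h(y + z) in place the window is no longer needed. Since σ is the only factor
        -- depending on θ, the integration by parts in θ can be undone.
        have hL : ∀ _ : Rn n, 1 ≤ 1 + ‖η‖ := fun _ => by simp
        rw [oscInt_prodOp hδ hδ1 le_rfl ((ampFam_dualAmp hσ hδ hρ h η).amp hL y) one_pos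
          (doubleList n), prodOp_dualAmp (hσ.smooth ()), window]

/-- Substitute x = y + z; the factor `phase (-y) ξ` compensates the extra phase in y and is later
absorbed into f̂(ξ). -/
theorem osc_dualAmp (h : 𝓢(Rn n, ℂ)) (η y ξ : Rn n) :
    phase y η * osc (dualAmp σ h η y) ξ =
      ∫ x, h x * σ (x, ξ, η) * phase x (ξ + η) * phase (-y) ξ := by
  rw [osc, ← integral_const_mul,
    ← integral_add_left_eq_self (fun x => h x * σ (x, ξ, η) * phase x (ξ + η) * phase (-y) ξ) y]
  congr 1
  funext z
  have h1 : phase y ξ * phase (-y) ξ = 1 := by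
    rw [← phase_add_left, add_neg_cancel]; simp [phase]
  simp only [dualAmp, Pi.mul_apply, translate, modulation, centred_one_apply, zero_add,
    phase_add_left, phase_add_right]
  linear_combination (-(h (y + z) * σ (y + z, ξ, η) * phase y η * phase z ξ * phase z η)) * h1

/-- The symbol of the first transpose. -/
noncomputable def transposeSym (σ : Rn n × Rn n × Rn n → ℂ) : Rn n × Rn n × Rn n → ℂ :=
  hatConst n • fun p => dualSym σ (freqMap (-1) (-1) 0 1 p)

theorem IsSymbol.transposeSym (hσ : IsSymbol δ ρ m σ) (hδ : 0 ≤ δ) (hδρ : δ ≤ ρ)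
    (hδ1 : δ < 1) : IsSymbol δ ρ m (transposeSym σ) := by
  have h1 := (hσ.dualSym hδ hδρ hδ1).comp_freqMap (α := -1) (β := -1) (γ := 0) (ε := 1)
    (fun p => by simp [freqMap_apply])
  exact h1.const_smul (hatConst n)

/-- Both sides equal (2π)^{-n} ∫∫ f(y) e^{i y·η} `osc (dualAmp σ h η y)` ξ, taken in the two orders
of integration. One order yields f̂ and the other the transposed symbol. -/
theorem transpose_identity (hσ : IsSymbol δ ρ m σ) (hδ : 0 ≤ δ) (hδ1 : δ < 1) (hρ : 0 ≤ ρ)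
    (f h : 𝓢(Rn n, ℂ)) (η : Rn n) :
    ∫ x, h x * ∫ ξ, σ (x, ξ, η) * hat f ξ * phase x (ξ + η) =
      ∫ y, f y * ∫ ζ, transposeSym σ (y, ζ, η) * hat h ζ * phase y (ζ + η) := by
  have hc : Continuous σ := (hσ.smooth ()).continuous
  obtain ⟨C, hC, k, hb⟩ := BS.bound (mem_BS_iff.2 hσ)
  have hcf := continuous_hat f
  have hL : ∀ _ : Rn n, 1 ≤ 1 + ‖η‖ := fun _ => by simp
  have hR : ∀ y, f y * ∫ ζ, transposeSym σ (y, ζ, η) * hat h ζ * phase y (ζ + η) =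
      hatConst n * ∫ ξ, f y * (phase y η * osc (dualAmp σ h η y) ξ) := fun y => by
    have h1 : ∀ ζ, transposeSym σ (y, ζ, η) * hat h ζ * phase y (ζ + η) =
        hatConst n * phase y η * (dualSym σ (y, -ζ - η, η) * hat h ζ * phase y ζ) := fun ζ => by
      have : freqMap (-1) (-1) 0 1 (y, ζ, η) = (y, -ζ - η, η) := by
        simp [freqMap_apply, sub_eq_add_neg]
      rw [transposeSym, Pi.smul_apply, this, phase_add_right, smul_eq_mul]
      ring
    simp only [h1]
    rw [integral_const_mul, integral_dualSym hσ hδ hδ1 hρ, oscInt, integral_const_mul,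
      integral_const_mul]
    ring
  obtain ⟨A, hA, k', hosc⟩ := (ampFam_dualAmp hσ hδ hρ h η).osc_le_wt hδ hδ1
    (fun y => by positivity) hL
  have hfy : ∀ j y, (1 + ‖y‖) ^ j * ‖f y‖ ≤ decay (j + (n + 1)) f * wt y := fun j y =>
    le_wt_of_decay (decay_spec (j + (n + 1)) f y)
  have hf0 : ∀ y, ‖f y‖ ≤ decay (0 + (n + 1)) f * wt y := fun y => by simpa using hfy 0 y
  have hh0 : ∀ x, ‖h x‖ ≤ decay (0 + (n + 1)) h * wt x := fun x => by
    simpa using le_wt_of_decay (k := 0) (decay_spec (0 + (n + 1)) h x)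
  -- The decay of f absorbs the growth (1 + ‖y‖)^(2n) of the amplitude; the decay in ξ is that of
  -- `osc`, since σ alone may grow in ξ.
  have hint1 : Integrable (Function.uncurry fun y ξ =>
      f y * (phase y η * osc (dualAmp σ h η y) ξ)) (volume.prod volume) := by
    have hmeas : StronglyMeasurable (fun q : Rn n × Rn n => osc (dualAmp σ h η q.1) q.2) := by
      have : Continuous (fun q : (Rn n × Rn n) × Rn n =>
          dualAmp σ h η q.1.1 (q.2, q.1.2) * phase q.2 q.1.2) := by
        simp only [dualAmp, Pi.mul_apply, translate, modulation, centred_one_apply]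
        have := h.continuous
        fun_prop
      exact this.stronglyMeasurable.integral_prod_right
    refine (integrable_wt_mul.const_mul
      (decay (2 * n + (n + 1)) f * A * (1 + ‖η‖) ^ k')).mono' ?_
      (Filter.Eventually.of_forall fun q => ?_)
    · have hcfc := f.continuous
      exact ((Continuous.stronglyMeasurable (by fun_prop : Continuous fun q : Rn n × Rn n =>
        f q.1)).mul ((Continuous.stronglyMeasurable (by fun_prop :
          Continuous fun q : Rn n × Rn n => phase q.1 η)).mul hmeas)).aestronglyMeasurable
    · obtain ⟨y, ξ⟩ := q
      have h1 := hosc y ξ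
      have h2 := hfy (2 * n) y
      have h3 := wt_nonneg ξ
      rw [Function.uncurry_apply_pair, norm_mul, norm_mul, norm_phase, one_mul]
      calc ‖f y‖ * ‖osc (dualAmp σ h η y) ξ‖
          ≤ ‖f y‖ * (A * (1 + ‖y‖) ^ (2 * n) * (1 + ‖η‖) ^ k' * wt ξ) := by gcongr
        _ = ((1 + ‖y‖) ^ (2 * n) * ‖f y‖) * (A * (1 + ‖η‖) ^ k' * wt ξ) := by ring
        _ ≤ (decay (2 * n + (n + 1)) f * wt y) * (A * (1 + ‖η‖) ^ k' * wt ξ) := by gcongr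
        _ = _ := by ring
  have hslice : ∀ ξ, hatConst n * ∫ y, f y * (phase y η * osc (dualAmp σ h η y) ξ) =
      ∫ x, h x * (σ (x, ξ, η) * hat f ξ * phase x (ξ + η)) := fun ξ => by
    have hint2 : Integrable (Function.uncurry fun y x =>
        f y * (h x * σ (x, ξ, η) * phase x (ξ + η) * phase (-y) ξ)) (volume.prod volume) := by
      refine (integrable_wt_mul.const_mul (decay (0 + (n + 1)) f * decay (0 + (n + 1)) h *
        (C * ((1 + ‖ξ‖) ^ k * (1 + ‖η‖) ^ k)))).mono' (Continuous.aestronglyMeasurable ?_)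
        (Filter.Eventually.of_forall fun q => ?_)
      · have := h.continuous
        have := f.continuous
        unfold Function.uncurry
        fun_prop
      · obtain ⟨y, x⟩ := q
        rw [Function.uncurry_apply_pair, norm_mul, norm_mul, norm_mul, norm_mul, norm_phase,
          norm_phase, mul_one, mul_one]
        have h1 := hf0 y
        have h2 := hh0 x
        have h3 := hb x ξ η
        have h4 := (norm_nonneg _).trans h1
        have h5 := (norm_nonneg _).trans h2
        calc _ ≤ (decay (0 + (n + 1)) f * wt y) * ((decay (0 + (n + 1)) h * wt x) *
              (C * ((1 + ‖ξ‖) ^ k * (1 + ‖η‖) ^ k))) := by gcongr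
          _ = _ := by ring
    calc hatConst n * ∫ y, f y * (phase y η * osc (dualAmp σ h η y) ξ)
        = hatConst n * ∫ y, ∫ x, f y * (h x * σ (x, ξ, η) * phase x (ξ + η) * phase (-y) ξ) := by
          simp only [osc_dualAmp, integral_const_mul]
      _ = hatConst n * ∫ x, ∫ y, f y * (h x * σ (x, ξ, η) * phase x (ξ + η) * phase (-y) ξ) := by
          rw [integral_integral_swap hint2]
      _ = ∫ x, hatConst n * ∫ y, f y * (h x * σ (x, ξ, η) * phase x (ξ + η) * phase (-y) ξ) := by
          rw [integral_const_mul]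
      _ = _ := by
          congr 1
          funext x
          have : ∀ y, f y * (h x * σ (x, ξ, η) * phase x (ξ + η) * phase (-y) ξ) =
              h x * σ (x, ξ, η) * phase x (ξ + η) * (f y * phase (-y) ξ) := fun y => by ring
          simp only [this]
          rw [integral_const_mul, hat_eq_phase]
          ring
  have hint3 : Integrable (Function.uncurry fun x ξ =>
      h x * (σ (x, ξ, η) * hat f ξ * phase x (ξ + η))) (volume.prod volume) := by
    refine (integrable_wt_mul.const_mul (decay (0 + (n + 1)) h * C * (1 + ‖η‖) ^ k *
      hatDecay (k + (n + 1)) f)).mono' (Continuous.aestronglyMeasurable ?_)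
      (Filter.Eventually.of_forall fun q => ?_)
    · have := h.continuous
      unfold Function.uncurry
      fun_prop
    · obtain ⟨x, ξ⟩ := q
      rw [Function.uncurry_apply_pair, norm_mul, norm_mul, norm_mul, norm_phase, mul_one]
      have h2 := hh0 x
      have h3 := hb x ξ η
      have h5 := (norm_nonneg _).trans h2
      have h6 := le_wt_of_decay (hatDecay_spec (k + (n + 1)) f ξ)
      calc _ ≤ (decay (0 + (n + 1)) h * wt x) *
            (C * ((1 + ‖ξ‖) ^ k * (1 + ‖η‖) ^ k) * ‖hat f ξ‖) := by gcongr
        _ = (decay (0 + (n + 1)) h * wt x) * (C * (1 + ‖η‖) ^ k) *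
            ((1 + ‖ξ‖) ^ k * ‖hat f ξ‖) := by ring
        _ ≤ (decay (0 + (n + 1)) h * wt x) * (C * (1 + ‖η‖) ^ k) *
            (hatDecay (k + (n + 1)) f * wt ξ) := by gcongr
        _ = _ := by ring
  calc ∫ x, h x * ∫ ξ, σ (x, ξ, η) * hat f ξ * phase x (ξ + η)
      = ∫ x, ∫ ξ, h x * (σ (x, ξ, η) * hat f ξ * phase x (ξ + η)) := by
        simp only [integral_const_mul]
    _ = ∫ ξ, ∫ x, h x * (σ (x, ξ, η) * hat f ξ * phase x (ξ + η)) := integral_integral_swap hint3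
    _ = ∫ ξ, hatConst n * ∫ y, f y * (phase y η * osc (dualAmp σ h η y) ξ) := by
        simp only [hslice]
    _ = hatConst n * ∫ y, ∫ ξ, f y * (phase y η * osc (dualAmp σ h η y) ξ) := by
        rw [integral_const_mul, integral_integral_swap hint1]
    _ = _ := by simp only [hR, integral_const_mul]

theorem opForm_transposeSym (hσ : σ ∈ BS n m ρ δ) (hδ : 0 ≤ δ) (hδρ : δ ≤ ρ) (hδ1 : δ < 1)
    (f g h : 𝓢(Rn n, ℂ)) : opForm σ f g h = opForm (transposeSym σ) h g f := by
  have hs := mem_BS_iff.1 hσ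
  rw [opForm_eq hσ, opForm_eq (mem_BS_iff.2 (hs.transposeSym hδ hδρ hδ1))]
  simp only [transpose_identity hs hδ hδ1 (hδ.trans hδρ)]

/-! ### Exchange of the two arguments. -/

/-- The symbol with the two frequency variables exchanged. -/
noncomputable def swapSym (σ : Rn n × Rn n × Rn n → ℂ) : Rn n × Rn n × Rn n → ℂ :=
  fun p => σ (freqMap 0 1 1 0 p)

theorem IsSymbol.swapSym (hσ : IsSymbol δ ρ m σ) : IsSymbol δ ρ m (swapSym σ) :=
  hσ.comp_freqMap fun p => by simp [freqMap_apply]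

theorem opForm_swapSym (f g h : 𝓢(Rn n, ℂ)) : opForm (swapSym σ) g f h = opForm σ f g h := by
  have : ∀ x, opFun (swapSym σ) g f x = opFun σ f g x := fun x => by
    rw [opFun, opFun, Measure.volume_eq_prod, ← integral_prod_swap]
    congr 1
    funext p
    simp only [swapSym, freqMap_apply, Prod.fst_swap, Prod.snd_swap, zero_smul, one_smul, zero_add,
      add_zero, add_comm p.2 p.1]
    ring
  simp only [opForm, this]

end

end BilinearPDO

theorem theorem1 (n : ℕ) (m ρ δ : ℝ) (hδ : 0 ≤ δ) (hδρ : δ ≤ ρ) (hρ : ρ ≤ 1) (hδ1 : δ < 1)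
    (σ : BilinearPDO.BS n m ρ δ) :
    (∃ σ₁ : BilinearPDO.BS n m ρ δ,
      (BilinearPDO.op σ).transpose₁ = BilinearPDO.op σ₁) ∧
    (∃ σ₂ : BilinearPDO.BS n m ρ δ,
      (BilinearPDO.op σ).transpose₂ = BilinearPDO.op σ₂) := by
  open BilinearPDO in
  have hs := mem_BS_iff.1 σ.2
  -- The second transpose is obtained by exchanging the arguments, taking the first transpose, and
  -- exchanging back.
  refine ⟨⟨⟨transposeSym σ, mem_BS_iff.2 (hs.transposeSym hδ hδρ hδ1)⟩, ?_⟩,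
    ⟨⟨swapSym (transposeSym (swapSym σ)),
      mem_BS_iff.2 (hs.swapSym.transposeSym hδ hδρ hδ1).swapSym⟩, ?_⟩⟩
  · ext h g f
    exact opForm_transposeSym σ.2 hδ hδρ hδ1 f g h
  · ext f h g
    change opForm σ.1 f g h = opForm (swapSym (transposeSym (swapSym σ.1))) f h g
    rw [opForm_swapSym, ← opForm_transposeSym (mem_BS_iff.2 hs.swapSym) hδ hδρ hδ1,
      opForm_swapSym]
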